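/- **Conventions.** $\mathrm{Sym}(\mathbb N)$ carries the topology of pointwise convergence. Its closed subgroups form a Borel subset $\mathcal U(\mathrm{Sym}(\mathbb N))$ of the Effros space of closed subsets of $\mathrm{Sym}(\mathbb N)$. A *Borel category* is a small category whose sets of objects and of morphisms carry standard Borel structures such that domain, codomain, identities and composition are Borel. A *Borel equivalence* between Borel categories $\mathcal C,\mathcal D$ is a pair of Borel functors $F:\mathcal C\to\mathcal D$, $G:\mathcal D\to\mathcal C$ with natural isomorphisms $\eta_X: X\to G(F(X))$ and $\varepsilon_Y:Y\to F(G(Y))$ such that $X\mapsto\eta_X$ and $Y\mapsto \varepsilon_Y$ are Borel. A *groupoid* is a set $M$ with a partial operation $\cdot$ and a unary operation ${}^{-1}$ such that $(A\cdot B)\cdot C=A\cdot (B\cdot C)$ (both sides or neither being defined), $A\cdot A^{-1}$ and $A^{-1}\cdot A$ are always defined, and if $A\cdot B$ is defined then $A\cdot B\cdot B^{-1}=A$ and $A^{-1}\cdot A\cdot B=B$. A *meet groupoid* is a groupoid that is also a meet semilattice $(M,\cap)$ with least element $\emptyset$, with order $A\subseteq B\Leftrightarrow A\cap B=A$, such that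 $\emptyset^{-1}=\emptyset=\emptyset\cdot\emptyset$; $\emptyset\cdot A$ and $A\cdot\emptyset$ are undefined for $A\ne\emptyset$; $U\cap V\neq\emptyset$ for idempotents $U,V\ne\emptyset$; $A\subseteq B\Leftrightarrow A^{-1}\subseteq B^{-1}$; and $(A_0\cap A_1)\cdot(B_0\cap B_1)=A_0\cdot B_0\cap A_1\cdot B_1$ whenever $A_0\cdot B_0$ and $A_1\cdot B_1$ are defined and $A_0\cap A_1\ne\emptyset\ne B_0\cap B_1$. Call $A$ a left (right) $U$-\*coset if $A\cdot U=A$ (if $U\cdot A=A$). A meet groupoid is *full* if for all idempotents $U\subseteq V$ different from $\emptyset$: each left (right) $U$-\*coset is contained in a unique left (right) $V$-\*coset; and if $U\neq V$, each left (right) $V$-\*coset contains at least two distinct left (right) $U$-\*cosets. Isomorphisms of meet groupoids are the bijections preserving $\cdot$, ${}^{-1}$ and $\cap$. For a full meet groupoid $M$ with domain contained in $\mathbb N$, let $\mathcal G(M)$ be the closed subgroup of $\mathrm{Sym}(\mathbb N)$ of all permutations that are the identity outside $M$ and restrict to an automorphism $p$ of $(M,\cap)$ with $p(A\cdot B)=p(A)\cdot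 B$ whenever $A\cdot B$ is defined. For an isomorphism $\theta:M\to N$ let $\mathcal G(\theta)(p)=\theta\circ p\circ\theta^{-1}$ on $N$. **Theorem.** Let $\mathbf{Gr}\subseteq\mathcal U(\mathrm{Sym}(\mathbb N))$ be a Borel class that is closed under topological isomorphism (if $G\in\mathbf{Gr}$ and $H$ is a closed subgroup of $\mathrm{Sym}(\mathbb N)$ topologically isomorphic to $G$, then $H\in\mathbf{Gr}$) and satisfies the invariant countable basis condition: to each $G\in\mathbf{Gr}$ is assigned a countable set $\mathcal S_G$ of open subgroups of $G$ forming a neighbourhood basis of $1_G$, such that $\{(G,U): G\in\mathbf{Gr},\ U\in\mathcal S_G\}$ is Borel and, for every topological isomorphism $h:G\to H$ between groups in $\mathbf{Gr}$ and every subgroup $U$ of $G$, $U\in\mathcal S_G\Leftrightarrow h(U)\in\mathcal S_H$. Write $\overline{\mathcal S}_G$ for the set of intersections of nonempty finite subsets of $\mathcal S_G$. Then: 1. $\mathbf{Gr}$, with topological isomorphisms as morphisms (coded by domain, codomain and graph, as a closed subset of $\mathrm{Sym}(\mathbb N)^2$), is a Borel category. 2. Let $\mathcal M$ be the category whose objects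 are the full meet groupoids $M$ with domain contained in $\mathbb N$ such that $\mathcal G(M)\in\mathbf{Gr}$ and $\{\{p\in\mathcal G(M):p(U)=U\}: U\in M,\ U\cdot U=U\neq\emptyset\}=\overline{\mathcal S}_{\mathcal G(M)}$, and whose morphisms are the isomorphisms of meet groupoids (coded by domain, codomain and graph). Then $\mathcal M$ is a Borel category. 3. There is a functor $\mathcal W:\mathbf{Gr}\to\mathcal M$ such that $\mathcal W(G)$ is, via bijections $c_G$ depending on $G$ in a Borel way, the coset meet groupoid of $G$: its elements are $\emptyset$ and all left cosets of subgroups in $\overline{\mathcal S}_G$; $A\cdot B$ is the setwise product, defined if $A$ is a left coset and $B$ a right coset of the same subgroup in $\overline{\mathcal S}_G$, or if $A=B=\emptyset$; the inverse is the setwise inverse, and the meet is intersection. Via these bijections, $\mathcal W(\alpha)(A)=\alpha(A)$ for each topological isomorphism $\alpha$ in $\mathbf{Gr}$. The functors $\mathcal W:\mathbf{Gr}\to\mathcal M$ and $\mathcal G:\mathcal M\to\mathbf{Gr}$ are Borel and form a Borel equivalence of categories. -/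

import Mathlib

open CategoryTheory MeasurableSpace

noncomputable section

namespace BorelDuality

/-! ### Borel categories, Borel functors, Borel equivalences -/

/-- A small category, with a σ-algebra on its set of objects and one on its set of morphisms, is a
Borel category if both are standard Borel spaces (that is, isomorphic to Borel subsets of Polish
spaces), and domain, codomain, identities and the composition relation are Borel. -/
structure IsBorelCategory (C : Type) [Category.{0} C] [MeasurableSpace C]
    [MeasurableSpace (Arrow C)] : Prop where
  objects : StandardBorelSpace C
  morphisms : StandardBorelSpace (Arrow C)
  dom : Measurable fun f : Arrow C => (f.left : C)
  cod : Measurable fun f : Arrow C => (f.right : C)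
  ident : Measurable fun X : C => Arrow.mk (𝟙 X)
  comp : MeasurableSet {t : Arrow C × Arrow C × Arrow C |
    ∃ (X Y Z : C) (f : X ⟶ Y) (g : Y ⟶ Z), t = (Arrow.mk f, Arrow.mk g, Arrow.mk (f ≫ g))}

/-- A functor is Borel if its action on objects and its action on morphisms are Borel maps. -/
structure IsBorelFunctor {C D : Type} [Category.{0} C] [MeasurableSpace C]
    [MeasurableSpace (Arrow C)] [Category.{0} D] [MeasurableSpace D] [MeasurableSpace (Arrow D)]
    (F : C ⥤ D) : Prop where
  obj : Measurable fun X : C => F.obj X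
  map : Measurable fun f : Arrow C => Arrow.mk (F.map f.hom)

/-- `F : C ⥤ D` and `G : D ⥤ C` form a Borel equivalence: both functors are Borel, and there are
natural isomorphisms `η_X : X → G (F X)` and `ε_Y : Y → F (G Y)` such that the assignments
`X ↦ η_X` and `Y ↦ ε_Y` are Borel maps from objects to morphisms. -/
structure IsBorelEquivalence {C D : Type} [Category.{0} C] [MeasurableSpace C]
    [MeasurableSpace (Arrow C)] [Category.{0} D] [MeasurableSpace D] [MeasurableSpace (Arrow D)]
    (F : C ⥤ D) (G : D ⥤ C) : Prop where
  functor : IsBorelFunctor F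
  inverse : IsBorelFunctor G
  unit : ∃ η : 𝟭 C ≅ F ⋙ G, Measurable fun X : C => Arrow.mk (η.hom.app X)
  counit : ∃ ε : 𝟭 D ≅ G ⋙ F, Measurable fun Y : D => Arrow.mk (ε.hom.app Y)

/-! ### The space of closed subgroups of `Sym(ℕ)` -/

/-- The topology of pointwise convergence on `Sym(ℕ)` (with `ℕ` discrete). -/
instance permTopology : TopologicalSpace (Equiv.Perm ℕ) :=
  TopologicalSpace.induced (fun p : Equiv.Perm ℕ => (p : ℕ → ℕ)) inferInstance

/-- The Effros σ-algebra on the set of closed subsets of `X`, generated by the sets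
`{F | F ∩ O ≠ ∅}` with `O` open. -/
@[reducible] def effros (X : Type) [TopologicalSpace X] : MeasurableSpace (TopologicalSpace.Closeds X) :=
  generateFrom {A | ∃ O : Set X, IsOpen O ∧ A = {F : TopologicalSpace.Closeds X | ((F : Set X) ∩ O).Nonempty}}

/-- The closed subgroups of `Sym(ℕ)` as a subspace of the Effros space of `Sym(ℕ)`. -/
instance : MeasurableSpace (ClosedSubgroup (Equiv.Perm ℕ)) :=
  (effros (Equiv.Perm ℕ)).comap fun G => ⟨(G : Set (Equiv.Perm ℕ)), G.isClosed'⟩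

/-- The class `Gr` is closed under topological isomorphism of closed subgroups of `Sym(ℕ)`. -/
def IsomorphismInvariant (Gr : Set (ClosedSubgroup (Equiv.Perm ℕ))) : Prop :=
  ∀ G H : ClosedSubgroup (Equiv.Perm ℕ), G ∈ Gr → Nonempty (G ≃ₜ* H) → H ∈ Gr

/-- `S` witnesses the invariant countable basis condition for `Gr`: to each `G ∈ Gr` it assigns a
countable set `S G` of open subgroups of `G` which is a neighbourhood basis of the identity, in a
way that is invariant under topological isomorphisms between groups in `Gr`, and such that the
relation `{(G, U) | G ∈ Gr, U ∈ S G}` is Borel. -/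
structure InvariantCountableBasis (Gr : Set (ClosedSubgroup (Equiv.Perm ℕ)))
    (S : ∀ G : ClosedSubgroup (Equiv.Perm ℕ), Set (Subgroup G)) : Prop where
  countable : ∀ G ∈ Gr, (S G).Countable
  isOpen : ∀ G ∈ Gr, ∀ U ∈ S G, IsOpen (U : Set G)
  basis : ∀ G ∈ Gr, ∀ O : Set G, IsOpen O → 1 ∈ O → ∃ U ∈ S G, (U : Set G) ⊆ O
  invariant : ∀ G ∈ Gr, ∀ H ∈ Gr, ∀ (h : G ≃ₜ* H) (U : Subgroup G),
    U ∈ S G ↔ U.map (h.toMulEquiv : G →* H) ∈ S H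
  borel : MeasurableSet {t : ClosedSubgroup (Equiv.Perm ℕ) × ClosedSubgroup (Equiv.Perm ℕ) |
    t.1 ∈ Gr ∧ ∃ U ∈ S t.1, (t.2 : Set (Equiv.Perm ℕ)) = Subtype.val '' (U : Set t.1)}

/-- The closure of a set of subgroups under (nonempty) finite intersections. -/
def interClosure {G : Type} [Group G] (T : Set (Subgroup G)) : Set (Subgroup G) :=
  {V | ∃ F : Finset (Subgroup G), F.Nonempty ∧ (F : Set (Subgroup G)) ⊆ T ∧
    V = sInf (F : Set (Subgroup G))}

/-! ### The category of groups in `Gr` with topological isomorphisms -/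

/-- The objects are the groups in `Gr`. -/
structure GrCat (Gr : Set (ClosedSubgroup (Equiv.Perm ℕ))) : Type where
  grp : ClosedSubgroup (Equiv.Perm ℕ)
  mem : grp ∈ Gr

variable {Gr : Set (ClosedSubgroup (Equiv.Perm ℕ))}

/-- The morphisms are the topological group isomorphisms. -/
instance : Category.{0} (GrCat Gr) where
  Hom G H := G.grp ≃ₜ* H.grp
  id G := ContinuousMulEquiv.refl G.grp
  comp f g := ContinuousMulEquiv.trans f g

instance : MeasurableSpace (GrCat Gr) :=
  MeasurableSpace.comap GrCat.grp inferInstance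

/-- The graph of a topological isomorphism between closed subgroups, a closed subset of
`Sym(ℕ) × Sym(ℕ)`. -/
def isoGraph {G H : ClosedSubgroup (Equiv.Perm ℕ)} (h : G ≃ₜ* H) :
    TopologicalSpace.Closeds (Equiv.Perm ℕ × Equiv.Perm ℕ) where
  carrier := Set.range fun x : G => ((x : Equiv.Perm ℕ), (h x : Equiv.Perm ℕ))
  isClosed' := by
    have : T2Space (Equiv.Perm ℕ) :=
      T2Space.of_injective_continuous (f := fun p : Equiv.Perm ℕ => (p : ℕ → ℕ))
        DFunLike.coe_injective continuous_induced_dom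
    have hc : Topology.IsClosedEmbedding
        (Prod.map (Subtype.val : G → Equiv.Perm ℕ) (Subtype.val : H → Equiv.Perm ℕ)) :=
      G.isClosed'.isClosedEmbedding_subtypeVal.prodMap H.isClosed'.isClosedEmbedding_subtypeVal
    have hg : IsClosed {t : G × H | h t.1 = t.2} :=
      isClosed_eq (h.continuous.comp continuous_fst) continuous_snd
    have := hc.isClosedMap _ hg
    convert this using 1
    ext ⟨a, b⟩
    constructor
    · rintro ⟨x, hx⟩
      exact ⟨(x, h x), rfl, hx⟩
    · rintro ⟨⟨x, y⟩, hxy, hx⟩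
      refine ⟨x, ?_⟩
      have hxy' : h x = y := hxy
      rw [← hx, ← hxy']
      rfl

/-- A morphism is coded by its domain, its codomain and its graph. -/
instance : MeasurableSpace (Arrow (GrCat Gr)) :=
  letI := effros (Equiv.Perm ℕ × Equiv.Perm ℕ)
  MeasurableSpace.comap (fun f : Arrow (GrCat Gr) =>
    ((f.left : GrCat Gr), (f.right : GrCat Gr),
      isoGraph (show f.left.grp ≃ₜ* f.right.grp from f.hom))) inferInstance

/-! ### Meet groupoids -/

/-- The signature of meet groupoids: a partial binary product (`mul A B = none` means that `A · B`
is undefined), an inversion, a meet and a constant. -/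
structure MGOps (M : Type) where
  mul : M → M → Option M
  inv : M → M
  inf : M → M → M
  bot : M

namespace MGOps

variable {M N P : Type}

/-- The order of the meet semilattice. -/
def Le (s : MGOps M) (A B : M) : Prop := s.inf A B = A

/-- `U` is an idempotent different from the least element. -/
def IsIdem (s : MGOps M) (U : M) : Prop := U ≠ s.bot ∧ s.mul U U = some U

/-- A meet groupoid. -/
structure IsMeetGroupoid (s : MGOps M) : Prop where
  assoc : ∀ A B C, ((s.mul A B).bind fun X => s.mul X C) = (s.mul B C).bind fun Y => s.mul A Y
  mul_inv_defined : ∀ A, (s.mul A (s.inv A)).isSome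
  inv_mul_defined : ∀ A, (s.mul (s.inv A) A).isSome
  cancel_right : ∀ A B C, s.mul A B = some C → s.mul C (s.inv B) = some A
  cancel_left : ∀ A B C, s.mul A B = some C → s.mul (s.inv A) C = some B
  inf_assoc : ∀ A B C, s.inf (s.inf A B) C = s.inf A (s.inf B C)
  inf_comm : ∀ A B, s.inf A B = s.inf B A
  inf_idem : ∀ A, s.inf A A = A
  bot_le : ∀ A, s.Le s.bot A
  inv_bot : s.inv s.bot = s.bot
  bot_mul_bot : s.mul s.bot s.bot = some s.bot
  bot_mul : ∀ A, A ≠ s.bot → s.mul s.bot A = none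
  mul_bot : ∀ A, A ≠ s.bot → s.mul A s.bot = none
  idem_inf : ∀ U V, s.IsIdem U → s.IsIdem V → s.inf U V ≠ s.bot
  inv_le_inv : ∀ A B, s.Le A B ↔ s.Le (s.inv A) (s.inv B)
  inf_mul_inf : ∀ A₀ A₁ B₀ B₁ C₀ C₁, s.mul A₀ B₀ = some C₀ → s.mul A₁ B₁ = some C₁ →
    s.inf A₀ A₁ ≠ s.bot → s.inf B₀ B₁ ≠ s.bot →
    s.mul (s.inf A₀ A₁) (s.inf B₀ B₁) = some (s.inf C₀ C₁)

/-- A full meet groupoid. Here `A` is a left `U` *coset if `A · U = A` and a right `U` *coset if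
`U · A = A`; as usual the idempotents `U`, `V` are taken to be different from the least element. -/
structure IsFull (s : MGOps M) : Prop extends s.IsMeetGroupoid where
  up_left : ∀ U V A, s.IsIdem U → s.IsIdem V → s.Le U V → s.mul A U = some A →
    ∃! B, s.mul B V = some B ∧ s.Le A B
  up_right : ∀ U V A, s.IsIdem U → s.IsIdem V → s.Le U V → s.mul U A = some A →
    ∃! B, s.mul V B = some B ∧ s.Le A B
  down_left : ∀ U V B, s.IsIdem U → s.IsIdem V → s.Le U V → U ≠ V → s.mul B V = some B →
    ∃ A A', A ≠ A' ∧ s.mul A U = some A ∧ s.mul A' U = some A' ∧ s.Le A B ∧ s.Le A' B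
  down_right : ∀ U V B, s.IsIdem U → s.IsIdem V → s.Le U V → U ≠ V → s.mul V B = some B →
    ∃ A A', A ≠ A' ∧ s.mul U A = some A ∧ s.mul U A' = some A' ∧ s.Le A B ∧ s.Le A' B

/-- Isomorphisms: bijections preserving product, inversion and meet (hence the least element). -/
@[ext]
structure Iso (s : MGOps M) (t : MGOps N) where
  equiv : M ≃ N
  map_mul : ∀ A B, t.mul (equiv A) (equiv B) = (s.mul A B).map equiv
  map_inv : ∀ A, equiv (s.inv A) = t.inv (equiv A)
  map_inf : ∀ A B, equiv (s.inf A B) = t.inf (equiv A) (equiv B)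

/-- The identity isomorphism. -/
def Iso.refl (s : MGOps M) : Iso s s where
  equiv := Equiv.refl M
  map_mul := by simp
  map_inv _ := rfl
  map_inf _ _ := rfl

/-- Composition of isomorphisms. -/
def Iso.trans {s : MGOps M} {t : MGOps N} {u : MGOps P} (e : Iso s t) (f : Iso t u) :
    Iso s u where
  equiv := e.equiv.trans f.equiv
  map_mul A B := by
    simp only [Equiv.trans_apply, f.map_mul, e.map_mul, Option.map_map]
    rfl
  map_inv A := by simp [e.map_inv, f.map_inv]
  map_inf A B := by simp [e.map_inf, f.map_inf]

/-- The group of all permutations `p` of `M` which are automorphisms of the meet semilattice and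
satisfy `p (A · B) = p A · B`, with `p A · B` defined if and only if `A · B` is. -/
def leftAut (s : MGOps M) : Subgroup (Equiv.Perm M) where
  carrier := {p | (∀ A B, p (s.inf A B) = s.inf (p A) (p B)) ∧
    ∀ A B, s.mul (p A) B = (s.mul A B).map p}
  one_mem' := by simp
  mul_mem' := by
    rintro p q ⟨hp, hp'⟩ ⟨hq, hq'⟩
    refine ⟨fun A B => by simp [hp, hq], fun A B => ?_⟩
    simp only [Equiv.Perm.mul_apply, hp', hq', Option.map_map]
    rfl
  inv_mem' := by
    rintro p ⟨hp, hp'⟩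
    refine ⟨fun A B => ?_, fun A B => ?_⟩
    · apply p.injective
      simp [hp]
    · have h := hp' (p⁻¹ A) B
      rw [show p (p⁻¹ A) = A from p.apply_symm_apply A] at h
      rw [h, Option.map_map]
      have : (p⁻¹ : Equiv.Perm M) ∘ p = id := by
        ext x
        simp
      rw [this, Option.map_id, id]

/-- An isomorphism `θ` induces the group isomorphism `p ↦ θ ∘ p ∘ θ⁻¹`. -/
def Iso.conj {s : MGOps M} {t : MGOps N} (e : Iso s t) : s.leftAut ≃* t.leftAut :=
  (e.equiv.permCongrHom.subgroupMap s.leftAut).trans <| MulEquiv.subgroupCongr <| by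
    have hinf : ∀ C D, e.equiv.symm (t.inf C D) = s.inf (e.equiv.symm C) (e.equiv.symm D) := by
      intro C D
      apply e.equiv.injective
      simp [e.map_inf]
    have hmul : ∀ C D, s.mul (e.equiv.symm C) (e.equiv.symm D) =
        (t.mul C D).map e.equiv.symm := by
      intro C D
      have h := e.map_mul (e.equiv.symm C) (e.equiv.symm D)
      simp only [Equiv.apply_symm_apply] at h
      rw [h, Option.map_map]
      simp
    ext q
    constructor
    · rintro ⟨p, ⟨hp, hp'⟩, rfl⟩
      refine ⟨fun C D => ?_, fun C D => ?_⟩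
      · simp [Equiv.permCongrHom, Equiv.permCongr_apply, hinf, hp, e.map_inf]
      · have h := e.map_mul (p (e.equiv.symm C)) (e.equiv.symm D)
        rw [Equiv.apply_symm_apply, hp', hmul, Option.map_map, Option.map_map] at h
        exact h
    · rintro ⟨hq, hq'⟩
      refine ⟨e.equiv.symm.permCongrHom q, ⟨fun A B => ?_, fun A B => ?_⟩, ?_⟩
      · simp [Equiv.permCongrHom, Equiv.permCongr_apply, hinf, hq, e.map_inf]
      · have h := hmul (q (e.equiv A)) (e.equiv B)
        rw [Equiv.symm_apply_apply, hq', e.map_mul, Option.map_map, Option.map_map] at h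
        exact h
      · ext x
        simp [Equiv.permCongrHom, Equiv.permCongr_apply]

lemma Iso.conj_apply {s : MGOps M} {t : MGOps N} (e : Iso s t) (p : s.leftAut) (C : N) :
    (e.conj p : Equiv.Perm N) C = e.equiv ((p : Equiv.Perm M) (e.equiv.symm C)) := rfl

end MGOps

/-! ### The space of countable structures and the automorphism group -/

/-- Countable structures in the signature of meet groupoids, with domain a subset of `ℕ`. -/
structure CountableMG : Type where
  carrier : Set ℕ
  ops : MGOps carrier

/-- The usual σ-algebra on the space of countable structures, generated by the sets of structures
in which a given atomic relation holds of given numbers. -/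
instance : MeasurableSpace CountableMG := generateFrom
  ({A | ∃ a : ℕ, A = {M | a ∈ M.carrier}} ∪
    {A | ∃ a b c : ℕ, A = {M | ∃ ha hb hc, M.ops.mul ⟨a, ha⟩ ⟨b, hb⟩ = some ⟨c, hc⟩}} ∪
    {A | ∃ a b : ℕ, A = {M | ∃ ha hb, M.ops.inv ⟨a, ha⟩ = ⟨b, hb⟩}} ∪
    {A | ∃ a b c : ℕ, A = {M | ∃ ha hb hc, M.ops.inf ⟨a, ha⟩ ⟨b, hb⟩ = ⟨c, hc⟩}} ∪
    {A | ∃ a : ℕ, A = {M | ∃ ha, M.ops.bot = ⟨a, ha⟩}})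

namespace CountableMG

open Classical in
/-- A permutation of the domain is extended to `ℕ` by the identity outside the domain. -/
def extendPerm (M : CountableMG) : Equiv.Perm M.carrier →* Equiv.Perm ℕ :=
  Equiv.Perm.ofSubtype (p := fun n => n ∈ M.carrier)

lemma extendPerm_coe (M : CountableMG) (p : Equiv.Perm M.carrier) (a : M.carrier) :
    M.extendPerm p a = p a := by
  classical
  exact Equiv.Perm.ofSubtype_apply_coe (p := fun n => n ∈ M.carrier) p a

lemma extendPerm_of_notMem (M : CountableMG) (p : Equiv.Perm M.carrier) {n : ℕ}
    (hn : n ∉ M.carrier) : M.extendPerm p n = n := by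
  classical
  exact Equiv.Perm.ofSubtype_apply_of_not_mem (p := fun n => n ∈ M.carrier) p hn

lemma extendPerm_injective (M : CountableMG) : Function.Injective M.extendPerm := by
  classical
  exact Equiv.Perm.ofSubtype_injective (p := fun n => n ∈ M.carrier)

lemma mem_map_leftAut (M : CountableMG) (q : Equiv.Perm ℕ) :
    q ∈ M.ops.leftAut.map M.extendPerm ↔
      (∀ n, n ∉ M.carrier → q n = n) ∧
      (∀ A B : M.carrier, ∃ A' B' : M.carrier, q A = A' ∧ q B = B' ∧
        q (M.ops.inf A B) = M.ops.inf A' B' ∧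
        (M.ops.mul A' B).map Subtype.val = (M.ops.mul A B).map fun C : M.carrier => q (C : ℕ)) := by
  classical
  constructor
  · rintro ⟨p, ⟨hp, hp'⟩, rfl⟩
    refine ⟨fun n hn => M.extendPerm_of_notMem p hn, fun A B => ⟨p A, p B, ?_, ?_, ?_, ?_⟩⟩
    · exact M.extendPerm_coe p A
    · exact M.extendPerm_coe p B
    · rw [M.extendPerm_coe, hp]
    · rw [hp', Option.map_map]
      refine congrArg (fun f => Option.map f (M.ops.mul A B)) (funext fun C => ?_)
      exact (M.extendPerm_coe p C).symm
  · rintro ⟨h1, h2⟩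
    have hmem : ∀ n, q n ∈ M.carrier ↔ n ∈ M.carrier := by
      intro n
      constructor
      · intro hn
        by_contra hn'
        rw [h1 n hn'] at hn
        exact hn' hn
      · intro hn
        obtain ⟨A', _, hA, _⟩ := h2 ⟨n, hn⟩ ⟨n, hn⟩
        have : q n = A' := hA
        rw [this]
        exact A'.2
    refine ⟨q.subtypePerm hmem, ⟨fun A B => ?_, fun A B => ?_⟩, ?_⟩
    · obtain ⟨A', B', hA, hB, hi, _⟩ := h2 A B
      have eA : q.subtypePerm hmem A = A' := Subtype.ext hA
      have eB : q.subtypePerm hmem B = B' := Subtype.ext hB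
      rw [eA, eB]
      exact Subtype.ext hi
    · obtain ⟨A', B', hA, hB, _, hm⟩ := h2 A B
      have eA : q.subtypePerm hmem A = A' := Subtype.ext hA
      rw [eA]
      apply Option.map_injective Subtype.val_injective
      rw [hm, Option.map_map]
      rfl
    · ext n
      by_cases hn : n ∈ M.carrier
      · exact M.extendPerm_coe _ ⟨n, hn⟩
      · rw [M.extendPerm_of_notMem _ hn, h1 n hn]

/-- The group `𝒢(M)`, as a closed subgroup of `Sym(ℕ)`. -/
def autGroup (M : CountableMG) : ClosedSubgroup (Equiv.Perm ℕ) where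
  toSubgroup := M.ops.leftAut.map M.extendPerm
  isClosed' := by
    have hev : ∀ n : ℕ, Continuous fun q : Equiv.Perm ℕ => q n := fun n =>
      (continuous_apply n).comp continuous_induced_dom
    have hset : ((M.ops.leftAut.map M.extendPerm : Subgroup (Equiv.Perm ℕ)) :
        Set (Equiv.Perm ℕ)) =
        (⋂ n : {n : ℕ // n ∉ M.carrier}, {q : Equiv.Perm ℕ | q (n : ℕ) = n}) ∩
        ⋂ A : M.carrier, ⋂ B : M.carrier,
          (fun q : Equiv.Perm ℕ => (q A, q B, q (M.ops.inf A B),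
            (M.ops.mul A B).elim 0 fun C : M.carrier => q (C : ℕ))) ⁻¹'
          {t : ℕ × ℕ × ℕ × ℕ | ∃ A' B' : M.carrier, t.1 = A' ∧ t.2.1 = B' ∧ t.2.2.1 = M.ops.inf A' B' ∧
            (M.ops.mul A' B).map Subtype.val = (M.ops.mul A B).map fun _ => t.2.2.2} := by
      ext q
      have h := M.mem_map_leftAut q
      simp only [SetLike.mem_coe, h, Set.mem_inter_iff, Set.mem_iInter, Set.mem_ofPred_eq,
        Set.mem_preimage, Subtype.forall]
      have hopt : ∀ o : Option M.carrier, (o.map fun C : M.carrier => q (C : ℕ)) =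
          o.map fun _ => o.elim 0 fun C : M.carrier => q (C : ℕ) := by
        rintro (_ | C) <;> rfl
      simp only [← hopt]
    change IsClosed (((M.ops.leftAut.map M.extendPerm : Subgroup (Equiv.Perm ℕ)) :
        Set (Equiv.Perm ℕ)))
    rw [hset]
    refine IsClosed.inter (isClosed_iInter fun n => ?_)
      (isClosed_iInter fun A => isClosed_iInter fun B => ?_)
    · exact isClosed_eq (hev n) continuous_const
    · refine (isClosed_discrete _).preimage ?_
      refine (hev A).prodMk ((hev B).prodMk ((hev _).prodMk ?_))
      cases M.ops.mul A B with
      | none => exact continuous_const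
      | some C => exact hev C

/-- The topological group isomorphism `𝒢(M) → 𝒢(N)`, `p ↦ θ ∘ p ∘ θ⁻¹`, as a group isomorphism. -/
def autMulEquiv {M N : CountableMG} (e : MGOps.Iso M.ops N.ops) : M.autGroup ≃* N.autGroup :=
  (M.ops.leftAut.equivMapOfInjective M.extendPerm M.extendPerm_injective).symm.trans
    (e.conj.trans (N.ops.leftAut.equivMapOfInjective N.extendPerm N.extendPerm_injective))

lemma autMulEquiv_symm_mk {M N : CountableMG} (e : MGOps.Iso M.ops N.ops) (q : M.autGroup) :
    ∃ p : M.ops.leftAut, (q : Equiv.Perm ℕ) = M.extendPerm p ∧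
      (autMulEquiv e q : Equiv.Perm ℕ) = N.extendPerm (e.conj p) := by
  refine ⟨(M.ops.leftAut.equivMapOfInjective M.extendPerm M.extendPerm_injective).symm q,
    ?_, rfl⟩
  have h := (M.ops.leftAut.equivMapOfInjective M.extendPerm
    M.extendPerm_injective).apply_symm_apply q
  exact (congrArg Subtype.val h).symm

lemma autMulEquiv_apply {M N : CountableMG} (e : MGOps.Iso M.ops N.ops) (q : M.autGroup)
    (A : M.carrier) (hA : (q : Equiv.Perm ℕ) A ∈ M.carrier) :
    (autMulEquiv e q : Equiv.Perm ℕ) (e.equiv A) = e.equiv ⟨(q : Equiv.Perm ℕ) A, hA⟩ := by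
  obtain ⟨p, hq, hp⟩ := autMulEquiv_symm_mk e q
  rw [hp, N.extendPerm_coe, MGOps.Iso.conj_apply, Equiv.symm_apply_apply]
  congr 2
  apply Subtype.ext
  change _ = (q : Equiv.Perm ℕ) A
  rw [hq, M.extendPerm_coe]

lemma autMulEquiv_apply_of_notMem {M N : CountableMG} (e : MGOps.Iso M.ops N.ops)
    (q : M.autGroup) {n : ℕ} (hn : n ∉ N.carrier) :
    (autMulEquiv e q : Equiv.Perm ℕ) n = n := by
  obtain ⟨p, hq, hp⟩ := autMulEquiv_symm_mk e q
  rw [hp, N.extendPerm_of_notMem _ hn]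

lemma autGroup_apply_mem (M : CountableMG) (q : M.autGroup) (A : M.carrier) :
    (q : Equiv.Perm ℕ) A ∈ M.carrier := by
  obtain ⟨p, _, hp⟩ := q.2
  rw [← hp, M.extendPerm_coe]
  exact (p A).2

lemma autMulEquiv_continuous {M N : CountableMG} (e : MGOps.Iso M.ops N.ops) :
    Continuous (autMulEquiv e) := by
  classical
  refine Continuous.subtype_mk (f := fun q => (autMulEquiv e q : Equiv.Perm ℕ)) ?_ _
  refine continuous_induced_rng.2 (continuous_pi fun n => ?_)
  by_cases hn : n ∈ N.carrier
  · have hval : (fun q : M.autGroup => (autMulEquiv e q : Equiv.Perm ℕ) n) =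
        (fun m : ℕ => if h : m ∈ M.carrier then (e.equiv ⟨m, h⟩ : ℕ) else 0) ∘
        (fun f : ℕ → ℕ => f (e.equiv.symm ⟨n, hn⟩)) ∘
        (fun p : Equiv.Perm ℕ => (p : ℕ → ℕ)) ∘ (Subtype.val : M.autGroup → Equiv.Perm ℕ) := by
      funext q
      have hA := M.autGroup_apply_mem q (e.equiv.symm ⟨n, hn⟩)
      have h := autMulEquiv_apply e q (e.equiv.symm ⟨n, hn⟩) hA
      rw [Equiv.apply_symm_apply] at h
      simp only [Function.comp_apply]
      rw [dif_pos hA]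
      exact h
    change Continuous fun q : M.autGroup => (autMulEquiv e q : Equiv.Perm ℕ) n
    rw [hval]
    exact continuous_of_discreteTopology.comp ((continuous_apply _).comp
      (continuous_induced_dom.comp continuous_subtype_val))
  · change Continuous fun q : M.autGroup => (autMulEquiv e q : Equiv.Perm ℕ) n
    simp only [autMulEquiv_apply_of_notMem e _ hn]
    exact continuous_const

/-- The inverse isomorphism. -/
def isoSymm {M N : CountableMG} (e : MGOps.Iso M.ops N.ops) : MGOps.Iso N.ops M.ops where
  equiv := e.equiv.symm
  map_mul A B := by
    have h := e.map_mul (e.equiv.symm A) (e.equiv.symm B)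
    simp only [Equiv.apply_symm_apply] at h
    rw [h, Option.map_map]
    simp
  map_inv A := by
    apply e.equiv.injective
    simp [e.map_inv]
  map_inf A B := by
    apply e.equiv.injective
    simp [e.map_inf]

lemma autMulEquiv_symm {M N : CountableMG} (e : MGOps.Iso M.ops N.ops) :
    (autMulEquiv e).symm = autMulEquiv (isoSymm e) := by
  apply MulEquiv.ext
  intro q
  rw [MulEquiv.symm_apply_eq]
  apply Subtype.ext
  apply Equiv.ext
  intro n
  by_cases hn : n ∈ N.carrier
  · have h1 := autMulEquiv_apply (isoSymm e) q ⟨n, hn⟩ (N.autGroup_apply_mem q ⟨n, hn⟩)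
    have hm := M.autGroup_apply_mem (autMulEquiv (isoSymm e) q) (e.equiv.symm ⟨n, hn⟩)
    have h2 := autMulEquiv_apply e (autMulEquiv (isoSymm e) q) (e.equiv.symm ⟨n, hn⟩) hm
    rw [Equiv.apply_symm_apply] at h2
    have h3 : (⟨_, hm⟩ : M.carrier) =
        e.equiv.symm ⟨(q : Equiv.Perm ℕ) n, N.autGroup_apply_mem q ⟨n, hn⟩⟩ := Subtype.ext h1
    rw [h3, Equiv.apply_symm_apply] at h2
    exact h2.symm
  · rw [autMulEquiv_apply_of_notMem e _ hn]
    obtain ⟨p, _, hp⟩ := q.2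
    rw [← hp]
    exact N.extendPerm_of_notMem p hn

/-- The topological group isomorphism `𝒢(M) → 𝒢(N)`, `p ↦ θ ∘ p ∘ θ⁻¹`. -/
def autMap {M N : CountableMG} (e : MGOps.Iso M.ops N.ops) : M.autGroup ≃ₜ* N.autGroup where
  toMulEquiv := autMulEquiv e
  continuous_toFun := autMulEquiv_continuous e
  continuous_invFun := by
    have h : Continuous (autMulEquiv e).symm := by
      rw [autMulEquiv_symm]
      exact autMulEquiv_continuous _
    exact h

end CountableMG

/-! ### The category of meet groupoids associated with `Gr` and `S` -/

/-- The objects are the full meet groupoids `M` with domain contained in `ℕ` such that `𝒢(M) ∈ Gr`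
and the subgroups `{p ∈ 𝒢(M) | p U = U}`, for `U` a nonzero idempotent of `M`, are exactly the
finite intersections of subgroups in `S 𝒢(M)`. -/
structure MCat (Gr : Set (ClosedSubgroup (Equiv.Perm ℕ)))
    (S : ∀ G : ClosedSubgroup (Equiv.Perm ℕ), Set (Subgroup G)) : Type where
  str : CountableMG
  full : str.ops.IsFull
  aut_mem : str.autGroup ∈ Gr
  basis : ∀ V : Subgroup str.autGroup, V ∈ interClosure (S str.autGroup) ↔
    ∃ U : str.carrier, str.ops.IsIdem U ∧
      (V : Set str.autGroup) = {p : str.autGroup | (p : Equiv.Perm ℕ) U = U}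

variable {S : ∀ G : ClosedSubgroup (Equiv.Perm ℕ), Set (Subgroup G)}

/-- The morphisms are the isomorphisms of meet groupoids. -/
instance : Category.{0} (MCat Gr S) where
  Hom M N := MGOps.Iso M.str.ops N.str.ops
  id M := MGOps.Iso.refl M.str.ops
  comp f g := MGOps.Iso.trans f g

instance : MeasurableSpace (MCat Gr S) :=
  MeasurableSpace.comap MCat.str inferInstance

/-- The graph of an isomorphism between structures with domains contained in `ℕ`. -/
def mgIsoGraph {M N : CountableMG} (e : MGOps.Iso M.ops N.ops) : ℕ × ℕ → Prop :=
  fun t => ∃ a : M.carrier, (a : ℕ) = t.1 ∧ (e.equiv a : ℕ) = t.2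

/-- A morphism is coded by its domain, its codomain and its graph, a subset of `ℕ × ℕ`; the space
of subsets of `ℕ × ℕ` carries the product σ-algebra. -/
instance : MeasurableSpace (Arrow (MCat Gr S)) :=
  MeasurableSpace.comap (fun f : Arrow (MCat Gr S) =>
    ((f.left : MCat Gr S), (f.right : MCat Gr S),
      mgIsoGraph (show MGOps.Iso f.left.str.ops f.right.str.ops from f.hom))) inferInstance

variable (Gr S) in
/-- The functor `𝒢`, sending `M` to the group `𝒢(M)` and an isomorphism `θ` to
`p ↦ θ ∘ p ∘ θ⁻¹`. -/
def autFunctor : MCat Gr S ⥤ GrCat Gr where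
  obj M := ⟨M.str.autGroup, M.aut_mem⟩
  map f := CountableMG.autMap f
  map_id M := by
    apply ContinuousMulEquiv.ext
    intro q
    apply Subtype.ext
    apply Equiv.ext
    intro n
    by_cases hn : n ∈ M.str.carrier
    · exact CountableMG.autMulEquiv_apply (MGOps.Iso.refl M.str.ops) q ⟨n, hn⟩
        (M.str.autGroup_apply_mem q ⟨n, hn⟩)
    · refine (CountableMG.autMulEquiv_apply_of_notMem (MGOps.Iso.refl M.str.ops) q hn).trans ?_
      obtain ⟨p, _, hp⟩ := q.2
      change n = (q : Equiv.Perm ℕ) n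
      rw [← hp]
      exact (M.str.extendPerm_of_notMem p hn).symm
  map_comp {M N P} f g := by
    apply ContinuousMulEquiv.ext
    intro q
    apply Subtype.ext
    apply Equiv.ext
    intro n
    change (CountableMG.autMulEquiv (MGOps.Iso.trans f g) q : Equiv.Perm ℕ) n =
      (CountableMG.autMulEquiv g (CountableMG.autMulEquiv f q) : Equiv.Perm ℕ) n
    by_cases hn : n ∈ P.str.carrier
    · obtain ⟨A, hA⟩ := (MGOps.Iso.trans f g).equiv.surjective ⟨n, hn⟩
      have hnA : n = (MGOps.Iso.trans f g).equiv A := by rw [hA]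
      have h1 := CountableMG.autMulEquiv_apply (MGOps.Iso.trans f g) q A
        (M.str.autGroup_apply_mem q A)
      have h2 := CountableMG.autMulEquiv_apply f q A (M.str.autGroup_apply_mem q A)
      have hm := N.str.autGroup_apply_mem (CountableMG.autMulEquiv f q) (MGOps.Iso.equiv f A)
      have h3 := CountableMG.autMulEquiv_apply g (CountableMG.autMulEquiv f q)
        (MGOps.Iso.equiv f A) hm
      have h4 : (⟨_, hm⟩ : N.str.carrier) = MGOps.Iso.equiv f ⟨(q : Equiv.Perm ℕ) A,
        M.str.autGroup_apply_mem q A⟩ := Subtype.ext h2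
      rw [h4] at h3
      rw [hnA, h1]
      exact h3.symm
    · rw [CountableMG.autMulEquiv_apply_of_notMem _ _ hn,
        CountableMG.autMulEquiv_apply_of_notMem _ _ hn]

/-! ### The coset meet groupoid -/

/-- `A` is a left coset `g U`. -/
def IsLeftCoset {G : Type} [Group G] (U : Subgroup G) (A : Set G) : Prop :=
  ∃ g : G, A = {x | ∃ u ∈ U, x = g * u}

/-- `A` is a right coset `U g`. -/
def IsRightCoset {G : Type} [Group G] (U : Subgroup G) (A : Set G) : Prop :=
  ∃ g : G, A = {x | ∃ u ∈ U, x = u * g}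

open scoped Pointwise in
/-- The bijection `c` identifies the structure `M` with the coset meet groupoid of `G` with respect
to `T`: its elements are `∅` and the left cosets of finite intersections of subgroups in `T`; the
product `A · B` is the setwise product `A B`, defined if `A` is a left coset and `B` a right coset
of the same such finite intersection, or if `A = B = ∅`; the inverse is the setwise inverse, the
meet is the intersection, and the least element is `∅`. -/
structure IsCosetMeetGroupoid {G : Type} [Group G] (T : Set (Subgroup G)) {M : Type}
    (s : MGOps M) (c : M → Set G) : Prop where
  injective : Function.Injective c
  range : Set.range c = {A | A = ∅ ∨ ∃ U ∈ interClosure T, IsLeftCoset U A}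
  mul : ∀ A B C, s.mul A B = some C ↔
    ((c A = ∅ ∧ c B = ∅) ∨
      ∃ U ∈ interClosure T, IsLeftCoset U (c A) ∧ IsRightCoset U (c B)) ∧ c C = c A * c B
  inv : ∀ A, c (s.inv A) = (c A)⁻¹
  inf : ∀ A B, c (s.inf A B) = c A ∩ c B
  bot : c s.bot = ∅

/-- `W` is the functor sending `G` to its coset meet groupoid with respect to `S G`, copied to a
domain contained in `ℕ` by means of the bijections `c G`, and sending an isomorphism `α : G → H` to
`A ↦ α(A)`. The copying is done in a Borel way: for each `n`, the coset `c G n` is a Borel function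
of `G` with values in the Effros space of `Sym(ℕ)`, on the Borel set of the `G` for which `n` is in
the domain. -/
structure IsCosetFunctor (W : GrCat Gr ⥤ MCat Gr S)
    (c : ∀ G : GrCat Gr, (W.obj G).str.carrier → Set G.grp) : Prop where
  obj : ∀ G : GrCat Gr, IsCosetMeetGroupoid (S G.grp) (W.obj G).str.ops (c G)
  map : ∀ (G H : GrCat Gr) (α : G ⟶ H) (A : (W.obj G).str.carrier),
    c H (MGOps.Iso.equiv (W.map α) A) = ContinuousMulEquiv.toMulEquiv α '' c G A
  borel : ∀ (n : ℕ) (O : Set (Equiv.Perm ℕ)), IsOpen O →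
    MeasurableSet {G : GrCat Gr | ∃ hn : n ∈ (W.obj G).str.carrier,
      (Subtype.val '' c G ⟨n, hn⟩ ∩ O).Nonempty}

end BorelDuality

end

open CategoryTheory MeasurableSpace MeasureTheory Set Topology TopologicalSpace

namespace BorelDuality

/-! ### The Lusin–Novikov theorem -/

/-! The algebraic core is a reconstruction of a group from the left translations of its cosets. For
`G` in `Gr` and `g ∈ G` the map `A ↦ g A` preserves intersections and commutes with multiplication
from the right, so it belongs to the group of left automorphisms of the coset meet groupoid.
Conversely, let `p` be a left automorphism. The cosets `p(U)`, for `U` an idempotent, form a filter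
base. Each `p(U)` is a left coset of `U`, so the values of the points of `p(U)` at a given number
stabilise as `U` shrinks. Every subgroup `W` of the basis also has some `p(U)` as a right coset, so
the values of the inverses stabilise too. Since `G` is closed in `Sym(ℕ)` there is a point common to
all `p(U)`, and `p` is translation by it (`IsCosetMeetGroupoid.exists_common_point`,
`IsCosetMeetGroupoid.exists_autIso`). Closure of the subgroups under conjugation, needed for the
right cosets, is invariance under inner automorphisms.

For an abstract full meet groupoid `M`, attach to `A ≠ ∅` the set `hat A` of left automorphisms
taking `A⁻¹ · A` to `A`. It is nonempty: as `M` is countable, a descending sequence below `A`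
generates a filter with exactly one left and one right *coset of each nonzero idempotent, and
multiplying by members of this filter is the required automorphism (`IsFull.exists_isFullFilter`,
`IsFullFilter.exists_leftAut`). The axiom that a *coset of a larger idempotent contains two *cosets
of a smaller one makes `hat` injective. Thus `hat` presents `M` as the coset meet groupoid of its
own group (`IsFull.isCosetMeetGroupoid_hat`). Two coset meet groupoids over isomorphic groups with
corresponding subgroups are isomorphic (`IsCosetMeetGroupoid.exists_iso`). This yields the action of
the functor on morphisms and the counit; the unit is translation.

Borelness rests on two facts. First, closed sets have Borel dense sequences of selectors
(`exists_dense_selectors`); cosets are clopen, so each identity between them is tested on a dense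
sequence by countable quantifiers. Second, a Borel relation with countable sections is a union of
countably many Borel graphs (`exists_measurable_enumeration`); this enumerates the basis of `G`,
then its finite intersections, then all cosets, the latter being indexed by a dense point and a
subgroup. Keeping the first index of each coset gives a structure with domain in `ℕ`. In the other
direction, whether the group of `M` meets a basic clopen set is a question about a permutation, but
it reduces to one about a single element of `M`, because the value at one small enough idempotent
determines the values at finitely many elements (`autGroup_inter_cylinder_nonempty_iff`). Objects
and morphisms form standard Borel spaces because their codes are injective and have Borel range
(`standardBorelSpace_of_injective`). -/

lemma analyticSet_inter {Y : Type*} [TopologicalSpace Y] [T2Space Y] {A B : Set Y}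
    (hA : AnalyticSet A) (hB : AnalyticSet B) : AnalyticSet (A ∩ B) := by
  have := AnalyticSet.iInter (s := fun b : Bool => cond b A B)
    (by rintro (_ | _) <;> assumption)
  rwa [← inter_eq_iInter] at this

lemma analyticSet_iInter {Y : Type*} [TopologicalSpace Y] [PolishSpace Y] {ι : Type*} [Countable ι]
    {D : ι → Set Y} (hD : ∀ i, AnalyticSet (D i)) : AnalyticSet (⋂ i, D i) := by
  rcases isEmpty_or_nonempty ι with h | h
  · rw [iInter_of_empty]
    exact isClosed_univ.analyticSet
  · exact AnalyticSet.iInter hD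

/-- Induction from Lusin separation of two sets: a Borel `u` separates the first set from the
intersection of the others. The traces of the others on `u` then have empty intersection, and
enlarging their Borel hulls by the complement of `u` is harmless because the first hull is `u`. -/
lemma exists_measurable_iInter_eq_empty_fin {Y : Type*} [TopologicalSpace Y] [PolishSpace Y]
    [MeasurableSpace Y] [BorelSpace Y] (n : ℕ) (D : Fin n → Set Y)
    (hD : ∀ i, AnalyticSet (D i)) (h : ⋂ i, D i = ∅) :
    ∃ C : Fin n → Set Y, (∀ i, MeasurableSet (C i)) ∧ (∀ i, D i ⊆ C i) ∧ ⋂ i, C i = ∅ := by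
  induction n with
  | zero => exact ⟨D, fun i => i.elim0, fun i => i.elim0, h⟩
  | succ n ih =>
    -- The separation argument needs two sets at least: that a point lies in `u` is read off from a
    -- member of the remaining family.
    rcases n with _ | n
    · refine ⟨fun _ => ∅, fun _ => .empty, fun i => ?_, iInter_const _⟩
      rw [← h]
      exact subset_iInter fun j => by rw [Subsingleton.elim (α := Fin 1) i j]
    obtain ⟨u, hu, hu', hum⟩ := (hD 0).measurablySeparable
      (analyticSet_iInter fun i : Fin (n + 1) => hD i.succ) (by
        rw [Set.disjoint_left]
        intro y hy hy'
        rw [← mem_empty_iff_false y, ← h, mem_iInter, Fin.forall_fin_succ]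
        exact ⟨hy, mem_iInter.1 hy'⟩)
    obtain ⟨C, hC, hDC, hCe⟩ := ih (fun i => D i.succ ∩ u)
      (fun i => analyticSet_inter (hD _) hum.analyticSet) (by
        rw [eq_empty_iff_forall_notMem]
        intro y hy
        rw [mem_iInter] at hy
        exact Set.disjoint_left.1 hu' (mem_iInter.2 fun i => (hy i).1) (hy 0).2)
    refine ⟨Fin.cons u fun i => C i ∪ uᶜ, ?_, ?_, ?_⟩
    · rw [Fin.forall_fin_succ]
      exact ⟨hum, fun i => (hC i).union hum.compl⟩
    · rw [Fin.forall_fin_succ]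
      refine ⟨hu, fun i y hy => ?_⟩
      by_cases hyu : y ∈ u
      · exact Or.inl (hDC i ⟨hy, hyu⟩)
      · exact Or.inr hyu
    · rw [eq_empty_iff_forall_notMem]
      intro y hy
      rw [mem_iInter, Fin.forall_fin_succ] at hy
      rw [← mem_empty_iff_false y, ← hCe, mem_iInter]
      exact fun i => (hy.2 i).resolve_right fun h' => h' hy.1


/-- Finitely many analytic sets with empty intersection are contained in Borel sets with empty
intersection. -/
theorem exists_measurable_iInter_eq_empty {Y : Type*} [TopologicalSpace Y] [PolishSpace Y]
    [MeasurableSpace Y] [BorelSpace Y] {ι : Type*} [Finite ι] (D : ι → Set Y)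
    (hD : ∀ i, AnalyticSet (D i)) (h : ⋂ i, D i = ∅) :
    ∃ C : ι → Set Y, (∀ i, MeasurableSet (C i)) ∧ (∀ i, D i ⊆ C i) ∧ ⋂ i, C i = ∅ := by
  obtain ⟨n, ⟨e⟩⟩ := Finite.exists_equiv_fin ι
  obtain ⟨C, hC, hDC, hCe⟩ := exists_measurable_iInter_eq_empty_fin n (fun i => D (e.symm i))
    (fun i => hD _) (by rw [← h]; exact e.symm.surjective.iInter_comp D)
  refine ⟨fun i => C (e i), fun i => hC _, fun i => ?_, ?_⟩
  · simpa using hDC (e i)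
  · rw [← hCe]
    exact e.surjective.iInter_comp C

/-! ### Countable-to-one maps are injective on countably many Borel pieces -/

section LusinNovikov

variable {X Y : Type*} [MeasurableSpace X]

/-- `A` is covered by countably many Borel sets on which `f` is injective. -/
def IsSmall (f : X → Y) (A : Set X) : Prop :=
  ∃ B : ℕ → Set X, (∀ n, MeasurableSet (B n) ∧ InjOn f (B n)) ∧ A ⊆ ⋃ n, B n

lemma IsSmall.mono {f : X → Y} {A A' : Set X} (h : IsSmall f A) (hA : A' ⊆ A) : IsSmall f A' := by
  obtain ⟨B, hB, hAB⟩ := h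
  exact ⟨B, hB, hA.trans hAB⟩

lemma isSmall_of_injOn {f : X → Y} {A : Set X} (hA : MeasurableSet A) (h : InjOn f A) :
    IsSmall f A :=
  ⟨fun _ => A, fun _ => ⟨hA, h⟩, by simp [iUnion_const]⟩

lemma isSmall_iUnion {f : X → Y} {ι : Type*} [Countable ι] {A : ι → Set X}
    (h : ∀ i, IsSmall f (A i)) : IsSmall f (⋃ i, A i) := by
  choose B hB hAB using h
  rcases isEmpty_or_nonempty ι with hι | hι
  · rw [iUnion_of_empty]
    exact isSmall_of_injOn .empty (injOn_empty f)
  obtain ⟨e, he⟩ := exists_surjective_nat (ι × ℕ)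
  refine ⟨fun n => B (e n).1 (e n).2, fun n => hB _ _, iUnion_subset fun i x hx => ?_⟩
  obtain ⟨m, hm⟩ := mem_iUnion.1 (hAB i hx)
  obtain ⟨n, hn⟩ := he (i, m)
  exact mem_iUnion.2 ⟨n, by rw [hn]; exact hm⟩

lemma IsSmall.union {f : X → Y} {A A' : Set X} (h : IsSmall f A) (h' : IsSmall f A') :
    IsSmall f (A ∪ A') := by
  rw [union_eq_iUnion]
  exact isSmall_iUnion (by rintro (_ | _) <;> assumption)

lemma IsSmall.exists_measurableSet {f : X → Y} {A : Set X} (h : IsSmall f A) :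
    ∃ N, MeasurableSet N ∧ IsSmall f N ∧ A ⊆ N := by
  obtain ⟨B, hB, hAB⟩ := h
  exact ⟨⋃ n, B n, .iUnion fun n => (hB n).1, ⟨B, hB, subset_rfl⟩, hAB⟩

variable [MeasurableSpace Y]

/-- Up to small sets, the images under `f` of the members of the family are contained in Borel sets
with empty intersection. -/
def IsSmallFamily (f : X → Y) {ι : Type*} (A : ι → Set X) : Prop :=
  ∃ C : ι → Set Y, (∀ i, MeasurableSet (C i)) ∧ ⋂ i, C i = ∅ ∧ ∀ i, IsSmall f (A i \ f ⁻¹' C i)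

lemma IsSmallFamily.of_equiv {f : X → Y} {ι κ : Type*} {A : ι → Set X} (e : κ ≃ ι)
    (h : IsSmallFamily f fun k => A (e k)) : IsSmallFamily f A := by
  obtain ⟨C, hC, hCe, hA⟩ := h
  refine ⟨fun i => C (e.symm i), fun i => hC _, ?_, fun i => ?_⟩
  · rw [← hCe]
    exact e.symm.surjective.iInter_comp C
  · simpa using hA (e.symm i)

variable [TopologicalSpace X] [PolishSpace X] [BorelSpace X] [TopologicalSpace Y] [PolishSpace Y]
  [BorelSpace Y]

/-- Separation of the analytic images leaves no exceptional set at all. It is used in contrapositive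
form: for a family that is not small, one fibre meets every member. -/
lemma isSmallFamily_of_iInter_eq_empty {f : X → Y} (hf : Continuous f) {ι : Type*} [Finite ι]
    {A : ι → Set X} (hA : ∀ i, MeasurableSet (A i)) (h : ⋂ i, f '' A i = ∅) :
    IsSmallFamily f A := by
  obtain ⟨C, hC, hAC, hCe⟩ := exists_measurable_iInter_eq_empty (fun i => f '' A i)
    (fun i => (hA i).analyticSet.image_of_continuous hf) h
  refine ⟨C, hC, hCe, fun i => ?_⟩
  rw [sdiff_eq_empty.2 (image_subset_iff.1 (hAC i))]
  exact isSmall_of_injOn .empty (injOn_empty f)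

/-- If all splittings were small, then after removing one small Borel set no value could have two
distinct preimages in every `U i` at once. Separating the analytic sets of such values by Borel sets
with empty intersection leaves pieces of the `U i` on which the map is injective, so the family `U`
itself would be small. -/
lemma exists_split {X : Type*} [MetricSpace X] [SecondCountableTopology X] [CompleteSpace X]
    [MeasurableSpace X] [BorelSpace X] {f : X → Y} (hf : Continuous f) {ι : Type*} [Finite ι]
    {U : ι → Set X} (hU : ∀ i, IsOpen (U i)) (h : ¬ IsSmallFamily f U) {ε : ℝ} (hε : 0 < ε) :
    ∃ V : ι × Bool → Set X, (∀ t, IsOpen (V t)) ∧ (∀ t, closure (V t) ⊆ U t.1) ∧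
      (∀ i, Disjoint (V (i, false)) (V (i, true))) ∧
      (∀ t, ∀ x ∈ V t, ∀ y ∈ V t, dist x y ≤ ε) ∧ ¬ IsSmallFamily f V := by
  by_contra! hV
  let B := countableBasis X
  have hB := isBasis_countableBasis X
  let Q : Type _ := ι × Bool → B
  have : Countable B := (countable_countableBasis X).to_subtype
  let good : Set Q := {q | (∀ t, closure (q t : Set X) ⊆ U t.1) ∧
    (∀ i, Disjoint (q (i, false) : Set X) (q (i, true))) ∧
    ∀ t, ∀ x ∈ (q t : Set X), ∀ y ∈ (q t : Set X), dist x y ≤ ε}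
  have hq : ∀ q : good, IsSmallFamily f fun t => (q.1 t : Set X) := fun q =>
    hV _ (fun t => isOpen_of_mem_countableBasis (q.1 t).2) q.2.1 q.2.2.1 q.2.2.2
  choose C hC hCe hCs using hq
  -- Pieces are taken from a countable basis, so there are countably many admissible choices and all
  -- their exceptional sets fit into one small Borel set.
  obtain ⟨N, hN, hNs, hNsub⟩ := (isSmall_iUnion fun p : good × (ι × Bool) =>
    hCs p.1 p.2).exists_measurableSet
  -- Outside `N`, the map is injective on the part of `U i` not mapped into `D i`.
  let D : ι → Set Y := fun i => (fun p : X × X => f p.1) ''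
    {p | p.1 ∈ U i ∧ p.2 ∈ U i ∧ p.1 ∉ N ∧ p.2 ∉ N ∧ f p.1 = f p.2 ∧ p.1 ≠ p.2}
  have hDa : ∀ i, AnalyticSet (D i) := by
    intro i
    refine MeasurableSet.analyticSet_image ?_ (hf.measurable.comp measurable_fst)
    have h1 := (hU i).measurableSet
    have h2 : MeasurableSet {p : X × X | f p.1 = f p.2} :=
      measurableSet_eq_fun (hf.measurable.comp measurable_fst) (hf.measurable.comp measurable_snd)
    have h3 : MeasurableSet {p : X × X | p.1 = p.2} :=
      measurableSet_eq_fun measurable_fst measurable_snd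
    exact (measurable_fst h1).inter ((measurable_snd h1).inter ((measurable_fst hN.compl).inter
      ((measurable_snd hN.compl).inter (h2.inter h3.compl))))
  have hDe : ⋂ i, D i = ∅ := by
    rw [eq_empty_iff_forall_notMem]
    intro y hy
    rw [mem_iInter] at hy
    choose p hp hpy using hy
    -- The two preimages in `U i` are enclosed in disjoint basic sets inside balls of radius `ε /
    -- 2`, which gives diameter at most `ε`.
    have key : ∀ i, ∃ a b : B, (p i).1 ∈ (a : Set X) ∧ (p i).2 ∈ (b : Set X) ∧
        closure (a : Set X) ⊆ U i ∧ closure (b : Set X) ⊆ U i ∧ Disjoint (a : Set X) b ∧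
        (∀ x ∈ (a : Set X), ∀ y ∈ (a : Set X), dist x y ≤ ε) ∧
        ∀ x ∈ (b : Set X), ∀ y ∈ (b : Set X), dist x y ≤ ε := by
      intro i
      obtain ⟨h1, h2, -, -, -, h6⟩ := hp i
      obtain ⟨u, v, hu, hv, hpu, hpv, huv⟩ := t2_separation h6
      obtain ⟨a, haB, hpa, ha⟩ := hB.exists_closure_subset (Filter.inter_mem
        ((hU i).mem_nhds h1) (Filter.inter_mem (hu.mem_nhds hpu)
          (Metric.ball_mem_nhds (p i).1 (half_pos hε))))
      obtain ⟨b, hbB, hpb, hb⟩ := hB.exists_closure_subset (Filter.inter_mem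
        ((hU i).mem_nhds h2) (Filter.inter_mem (hv.mem_nhds hpv)
          (Metric.ball_mem_nhds (p i).2 (half_pos hε))))
      refine ⟨⟨a, haB⟩, ⟨b, hbB⟩, hpa, hpb, fun x hx => (ha hx).1, fun x hx => (hb hx).1,
        huv.mono (fun x hx => (ha (subset_closure hx)).2.1)
          (fun x hx => (hb (subset_closure hx)).2.1), fun x hx y hy => ?_, fun x hx y hy => ?_⟩
      · have h1 := (ha (subset_closure hx)).2.2
        have h2 := (ha (subset_closure hy)).2.2
        rw [Metric.mem_ball] at h1 h2
        linarith [dist_triangle_right x y (p i).1]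
      · have h1 := (hb (subset_closure hx)).2.2
        have h2 := (hb (subset_closure hy)).2.2
        rw [Metric.mem_ball] at h1 h2
        linarith [dist_triangle_right x y (p i).2]
    choose a b ha hb hca hcb hab hda hdb using key
    let q : good := ⟨fun t => cond t.2 (b t.1) (a t.1), by
      rintro ⟨i, (_ | _)⟩ <;> simp [hca, hcb], hab, by
      rintro ⟨i, (_ | _)⟩
      exacts [hda i, hdb i]⟩
    -- If `y` missed one of these sets, the chosen preimage of `y` would be exceptional for `q` and
    -- hence lie in `N`.
    have hmem : ∀ t, y ∈ C q t := by
      rintro ⟨i, c⟩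
      by_contra hy
      obtain ⟨h1, h2, h3, h4, h5, -⟩ := hp i
      have hpy' : f (p i).1 = y := hpy i
      have hsub : (q.1 (i, c) : Set X) \ f ⁻¹' C q (i, c) ⊆ N :=
        (subset_iUnion (fun p : good × (ι × Bool) => (p.1.1 p.2 : Set X) \ f ⁻¹' C p.1 p.2)
          (q, (i, c))).trans hNsub
      cases c
      · exact h3 (hsub ⟨ha i, by rw [mem_preimage, hpy']; exact hy⟩)
      · exact h4 (hsub ⟨hb i, by rw [mem_preimage, ← h5, hpy']; exact hy⟩)
    rw [← mem_empty_iff_false y, ← hCe q, mem_iInter]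
    exact hmem
  obtain ⟨C', hC', hDC, hCe'⟩ := exists_measurable_iInter_eq_empty D hDa hDe
  refine h ⟨C', hC', hCe', fun i => ?_⟩
  refine (hNs.union (isSmall_of_injOn (A := (U i \ N) \ f ⁻¹' C' i)
    (((hU i).measurableSet.diff hN).diff (hf.measurable (hC' i))) ?_)).mono ?_
  · rintro x ⟨⟨hx, hxN⟩, hxC⟩ x' ⟨⟨hx', hxN'⟩, -⟩ hxx
    by_contra hne
    exact hxC (hDC i ⟨(x, x'), ⟨hx, hx', hxN, hxN', hxx, hne⟩, rfl⟩)
  · rintro x ⟨hx, hxC⟩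
    by_cases hxN : x ∈ N
    · exact Or.inl hxN
    · exact Or.inr ⟨⟨hx, hxN⟩, hxC⟩

/-- A tree-indexed scheme produced by repeated splitting. -/
lemma exists_scheme {X : Type*} [MetricSpace X] [SecondCountableTopology X] [CompleteSpace X]
    [MeasurableSpace X] [BorelSpace X] {f : X → Y} (hf : Continuous f)
    (h : ¬ IsSmall f (univ : Set X)) :
    ∃ U : ∀ n, (Fin n → Bool) → Set X, (∀ n, ¬ IsSmallFamily f (U n)) ∧
      (∀ n s, IsOpen (U n s)) ∧ (∀ n s, closure (U (n + 1) s) ⊆ U n (Fin.init s)) ∧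
      (∀ n s t, Fin.init s = Fin.init t → s ≠ t → Disjoint (U (n + 1) s) (U (n + 1) t)) ∧
      (∀ n s, ∀ x ∈ U (n + 1) s, ∀ y ∈ U (n + 1) s, dist x y ≤ (1 / 2 : ℝ) ^ n) := by
  let State (n : ℕ) := {U : (Fin n → Bool) → Set X // (∀ s, IsOpen (U s)) ∧ ¬ IsSmallFamily f U}
  have step : ∀ n (U : State n), ∃ V : State (n + 1),
      (∀ s, closure (V.1 s) ⊆ U.1 (Fin.init s)) ∧
      (∀ s t, Fin.init s = Fin.init t → s ≠ t → Disjoint (V.1 s) (V.1 t)) ∧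
      (∀ s, ∀ x ∈ V.1 s, ∀ y ∈ V.1 s, dist x y ≤ (1 / 2 : ℝ) ^ n) := by
    intro n U
    obtain ⟨V, hVo, hVc, hVd, hVε, hV⟩ := exists_split hf U.2.1 U.2.2
      (ε := (1 / 2 : ℝ) ^ n) (by positivity)
    let e : (Fin (n + 1) → Bool) ≃ (Fin n → Bool) × Bool :=
      { toFun := fun s => (Fin.init s, s (Fin.last n))
        invFun := fun t => Fin.snoc t.1 t.2
        left_inv := fun s => Fin.snoc_init_self s
        right_inv := fun t => by simp }
    refine ⟨⟨fun s => V (e s), fun s => hVo _, fun hs => hV (hs.of_equiv e)⟩, fun s => hVc _,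
      fun s t hst hne => ?_, fun s => hVε _⟩
    have hlast : s (Fin.last n) ≠ t (Fin.last n) := by
      intro hl
      exact hne (e.injective (Prod.ext hst hl))
    change Disjoint (V (Fin.init s, s (Fin.last n))) (V (Fin.init t, t (Fin.last n)))
    rw [← hst]
    cases hs : s (Fin.last n) <;> cases ht : t (Fin.last n)
    · exact absurd (hs.trans ht.symm) hlast
    · exact hVd _
    · exact (hVd _).symm
    · exact absurd (hs.trans ht.symm) hlast
  choose next hnext using step
  -- With a single index the intersection condition makes the Borel set empty, so smallness of this
  -- family is smallness of the whole space.
  have h0 : ¬ IsSmallFamily f fun _ : Fin 0 → Bool => (univ : Set X) := by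
    rintro ⟨C, -, hCe, hC⟩
    refine h ((hC default).mono fun x _ => ⟨trivial, fun hx => ?_⟩)
    rw [← mem_empty_iff_false (f x), ← hCe, mem_iInter]
    intro i
    rwa [Subsingleton.elim i default]
  let U : ∀ n, State n := fun n => Nat.rec ⟨fun _ => univ, fun _ => isOpen_univ, h0⟩ next n
  exact ⟨fun n => (U n).1, fun n => (U n).2.2, fun n => (U n).2.1,
    fun n => (hnext n (U n)).1, fun n => (hnext n (U n)).2.1, fun n => (hnext n (U n)).2.2⟩

/-- A countable-to-one continuous function on a Polish space is injective on each member of a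
countable Borel cover. -/
theorem isSmall_univ_of_countable_fibers {f : X → Y} (hf : Continuous f)
    (hc : ∀ y, (f ⁻¹' {y}).Countable) : IsSmall f (univ : Set X) := by
  by_contra h
  let _ := upgradeIsCompletelyMetrizable X
  obtain ⟨U, hU, hUo, hUc, hUd, hUε⟩ := exists_scheme hf h
  -- One value `y n` serves all branches at level `n`; this is why the limits along different
  -- branches end up in the same fibre.
  have hy : ∀ n, ∃ y, ∀ s, ∃ x ∈ U n s, f x = y := by
    intro n
    by_contra! hy
    refine hU n (isSmallFamily_of_iInter_eq_empty hf (fun s => (hUo n s).measurableSet) ?_)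
    rw [eq_empty_iff_forall_notMem]
    intro y hy'
    obtain ⟨s, hs⟩ := hy y
    obtain ⟨x, hx, hxy⟩ := mem_iInter.1 hy' s
    exact hs x hx hxy
  choose y x hxU hxy using hy
  let r : ∀ n, (ℕ → Bool) → Fin n → Bool := fun n α i => α i
  have hanti : ∀ α, Antitone fun n => U n (r n α) := fun α =>
    antitone_nat_of_succ_le fun n => subset_closure.trans (hUc n (r (n + 1) α))
  -- The diameter bound `(1 / 2) ^ n` is available from level `n + 1` on, whence the shift.
  have hcau : ∀ α, CauchySeq fun n => x (n + 1) (r (n + 1) α) := fun α =>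
    cauchySeq_of_le_tendsto_0 (fun n : ℕ => (1 / 2 : ℝ) ^ n)
      (fun n m N hn hm => hUε N (r (N + 1) α) _ (hanti α (by omega) (hxU _ _)) _
        (hanti α (by omega) (hxU _ _)))
      (tendsto_pow_atTop_nhds_zero_of_lt_one (by norm_num) (by norm_num))
  choose z hz using fun α => cauchySeq_tendsto_of_complete (hcau α)
  have hzU : ∀ α n, z α ∈ U n (r n α) := by
    intro α n
    refine hUc n (r (n + 1) α) (mem_closure_of_tendsto (hz α) ?_)
    filter_upwards [Filter.eventually_ge_atTop n] with m hm
    exact hanti α (by omega) (hxU _ _)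
  have hzf : ∀ α, f (z α) = f (z fun _ => false) := by
    intro α
    have h1 := (hf.tendsto _).comp (hz α)
    have h2 := (hf.tendsto _).comp (hz fun _ => false)
    simp only [Function.comp_def, hxy] at h1 h2
    exact tendsto_nhds_unique h1 h2
  have hzi : Function.Injective z := by
    intro α β hαβ
    by_contra hne
    obtain ⟨n, hn, hmin⟩ : ∃ n, α n ≠ β n ∧ ∀ m < n, α m = β m := by
      have hex := Function.ne_iff.1 hne
      classical
      exact ⟨Nat.find hex, Nat.find_spec hex, fun m hm => not_not.1 (Nat.find_min hex hm)⟩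
    refine Set.disjoint_left.1 (hUd n (r (n + 1) α) (r (n + 1) β) ?_ ?_) (hzU α _)
      (hαβ ▸ hzU β _)
    · funext i
      exact hmin i i.2
    · intro he
      exact hn (congrFun he (Fin.last n))
  have : Countable (f ⁻¹' {f (z fun _ => false)}) := (hc _).to_subtype
  have hct : Countable (ℕ → Bool) :=
    Function.Injective.countable (f := fun α => (⟨z α, hzf α⟩ : f ⁻¹' {f (z fun _ => false)}))
      fun α β hαβ => hzi (congrArg Subtype.val hαβ)
  obtain ⟨e, he⟩ := exists_surjective_nat (ℕ → Bool)
  obtain ⟨n, hn⟩ := he fun n => !(e n n)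
  exact Bool.not_ne_self _ (congrFun hn n).symm

end LusinNovikov

/-- **Lusin–Novikov uniformization**: a Borel relation with nonempty countable sections is the union
of the graphs of countably many Borel functions. -/
theorem exists_measurable_enumeration {X Y : Type*} [MeasurableSpace X] [StandardBorelSpace X]
    [MeasurableSpace Y] [StandardBorelSpace Y] {P : Set (X × Y)} (hP : MeasurableSet P)
    (hc : ∀ x, {y | (x, y) ∈ P}.Countable) (hne : ∀ x, ∃ y, (x, y) ∈ P) :
    ∃ f : ℕ → X → Y, (∀ n, Measurable (f n)) ∧ ∀ x, {y | (x, y) ∈ P} = range fun n => f n x := by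
  obtain ⟨B, hB, hPB⟩ : ∃ B : ℕ → Set (X × Y), (∀ n, MeasurableSet (B n) ∧
      InjOn Prod.fst (B n)) ∧ P = ⋃ n, B n := by
    have : StandardBorelSpace P := hP.standardBorel
    let _ := upgradeStandardBorel X
    let tP := (upgradeStandardBorel P).toTopologicalSpace
    have : PolishSpace P := (upgradeStandardBorel P).toPolishSpace
    have hbP : BorelSpace P := (upgradeStandardBorel P).toBorelSpace
    -- A finer Polish topology with the same Borel sets makes the projection continuous.
    obtain ⟨t, ht, hcont, hpol⟩ := (measurable_fst.comp measurable_subtype_coe :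
      Measurable fun p : P => (p : X × Y).1).exists_continuous
    have hbor : @BorelSpace P t _ := ⟨hbP.measurable_eq.trans
      (borel_eq_borel_of_le hpol this ht).symm⟩
    obtain ⟨B, hB, hBu⟩ := @isSmall_univ_of_countable_fibers P X _ _ t hpol hbor _ _ _ _ hcont
      (fun x => by
        refine MapsTo.countable_of_injOn (f := fun p : P => (p : X × Y).2) ?_ ?_ (hc x)
        · rintro ⟨⟨x', y⟩, hp⟩ rfl
          exact hp
        · rintro ⟨⟨x', y⟩, hp⟩ rfl ⟨⟨x'', y'⟩, hp'⟩ h' rfl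
          exact Subtype.ext (Prod.ext h'.symm rfl))
    refine ⟨fun n => Subtype.val '' B n, fun n => ⟨?_, ?_⟩, ?_⟩
    · exact (MeasurableEmbedding.subtype_coe hP).measurableSet_image.2 (hB n).1
    · rintro _ ⟨a, ha, rfl⟩ _ ⟨b, hb, rfl⟩ hab
      rw [(hB n).2 ha hb hab]
    · rw [← image_iUnion, univ_subset_iff.1 hBu, image_univ, Subtype.range_coe]
  let D : ℕ → Set X := fun n => Prod.fst '' B n
  have hD : ∀ n, MeasurableSet (D n) := fun n =>
    (hB n).1.image_of_measurable_injOn measurable_fst (hB n).2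
  -- `Q` is a uniformization: over each point only the first piece reaching it is kept.
  let Q : Set (X × Y) := ⋃ n, B n \ Prod.fst ⁻¹' ⋃ m < n, D m
  have hQ : MeasurableSet Q := .iUnion fun n => (hB n).1.diff
    (measurable_fst (.iUnion fun m => .iUnion fun _ => hD m))
  have hQP : Q ⊆ P := by
    rw [hPB]
    exact iUnion_mono fun n => sdiff_subset
  have hQi : InjOn Prod.fst Q := by
    intro a ha b hb hab
    obtain ⟨n, han, han'⟩ := mem_iUnion.1 ha
    obtain ⟨m, hbm, hbm'⟩ := mem_iUnion.1 hb
    rcases lt_trichotomy n m with h | rfl | h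
    · exact (hbm' (mem_iUnion₂.2 ⟨n, h, a, han, hab⟩)).elim
    · exact (hB n).2 han hbm hab
    · exact (han' (mem_iUnion₂.2 ⟨m, h, b, hbm, hab.symm⟩)).elim
  have hQs : ∀ x, ∃ y, (x, y) ∈ Q := by
    intro x
    have hex : ∃ n, x ∈ D n := by
      obtain ⟨y, hy⟩ := hne x
      rw [hPB] at hy
      obtain ⟨n, hn⟩ := mem_iUnion.1 hy
      exact ⟨n, _, hn, rfl⟩
    classical
    obtain ⟨⟨x', y⟩, hy, rfl⟩ := Nat.find_spec hex
    refine ⟨y, mem_iUnion.2 ⟨_, hy, fun h => ?_⟩⟩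
    obtain ⟨m, hm, hm'⟩ := mem_iUnion₂.1 h
    exact Nat.find_min hex hm hm'
  -- Completing `B n` by `Q` off its projection makes it the graph of a total function while staying
  -- inside `P`.
  let R : ℕ → Set (X × Y) := fun n => B n ∪ (Q ∩ Prod.fst ⁻¹' (D n)ᶜ)
  have hR : ∀ n, MeasurableSet (R n) := fun n =>
    (hB n).1.union (hQ.inter (measurable_fst (hD n).compl))
  have hRi : ∀ n, InjOn Prod.fst (R n) := by
    rintro n a (ha | ⟨ha, ha'⟩) b (hb | ⟨hb, hb'⟩) hab
    · exact (hB n).2 ha hb hab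
    · exact absurd (hab ▸ mem_image_of_mem _ ha) hb'
    · exact absurd (hab ▸ mem_image_of_mem _ hb) ha'
    · exact hQi ha hb hab
  have hRP : ∀ n, R n ⊆ P := fun n => union_subset (hPB ▸ subset_iUnion B n)
    (inter_subset_left.trans hQP)
  have hRs : ∀ n x, ∃ y, (x, y) ∈ R n := by
    intro n x
    by_cases hx : x ∈ D n
    · obtain ⟨⟨x', y⟩, hy, rfl⟩ := hx
      exact ⟨y, Or.inl hy⟩
    · obtain ⟨y, hy⟩ := hQs x
      exact ⟨y, Or.inr ⟨hy, hx⟩⟩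
  choose f hf using hRs
  refine ⟨f, fun n A hA => ?_, fun x => ?_⟩
  · have : f n ⁻¹' A = Prod.fst '' (R n ∩ Prod.snd ⁻¹' A) := by
      ext x
      constructor
      · exact fun hx => ⟨(x, f n x), ⟨hf n x, hx⟩, rfl⟩
      · rintro ⟨⟨x', y⟩, ⟨hy, hyA⟩, rfl⟩
        have := hRi n hy (hf n x') rfl
        have hyf : y = f n x' := congrArg Prod.snd this
        exact hyf ▸ hyA
    rw [this]
    exact ((hR n).inter (measurable_snd hA)).image_of_measurable_injOn measurable_fst
      ((hRi n).mono inter_subset_left)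
  · ext y
    constructor
    · intro hy
      have hy' : (x, y) ∈ P := hy
      rw [hPB] at hy'
      obtain ⟨n, hn⟩ := mem_iUnion.1 hy'
      exact ⟨n, (congrArg Prod.snd (hRi n (Or.inl hn) (hf n x) rfl)).symm⟩
    · rintro ⟨n, rfl⟩
      exact hRP n (hf n x)

end BorelDuality

namespace BorelDuality

/-! ### The Effros Borel space -/

/-- Such an `f` is a Borel isomorphism onto its range. Every later standard Borel claim is reduced
in this way to describing a set of codes by countably many Borel conditions. -/
lemma standardBorelSpace_of_injective {α β : Type*} [mα : MeasurableSpace α] [mβ : MeasurableSpace β]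
    [StandardBorelSpace β] {f : α → β} (hf : Function.Injective f)
    (hm : mα = MeasurableSpace.comap f mβ) (hr : MeasurableSet (range f)) :
    StandardBorelSpace α := by
  have hfm : Measurable f := hm ▸ comap_measurable f
  have he : MeasurableEmbedding f := by
    refine ⟨hf, hfm, fun s hs => ?_⟩
    rw [hm] at hs
    obtain ⟨t, ht, rfl⟩ := hs
    rw [image_preimage_eq_inter_range]
    exact ht.inter hr
  have := hr.standardBorel
  let _ := upgradeStandardBorel (range f)
  let e := he.equivRange
  let _ : TopologicalSpace α := TopologicalSpace.induced e inferInstance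
  refine ⟨_, ⟨?_⟩, e.toEquiv.polishSpace_induced⟩
  rw [borel_comap (f := e), ← BorelSpace.measurable_eq (α := range f)]
  exact le_antisymm (fun s hs => ⟨e '' s, e.measurableSet_image.2 hs,
    preimage_image_eq s e.injective⟩) (measurable_iff_comap_le.1 e.measurable)

attribute [local instance] effros

section Effros

variable {X : Type} [TopologicalSpace X]

lemma measurable_hit {O : Set X} (hO : IsOpen O) :
    Measurable fun F : Closeds X => ((F : Set X) ∩ O).Nonempty :=
  measurableSet_setOfPred.1 (measurableSet_generateFrom ⟨O, hO, rfl⟩)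

lemma hit_iff_of_basis {ι : Type*} {b : ι → Set X} (hb : IsTopologicalBasis (range b)) {O : Set X}
    (hO : IsOpen O) (F : Set X) :
    (F ∩ O).Nonempty ↔ ∃ n, b n ⊆ O ∧ (F ∩ b n).Nonempty := by
  constructor
  · rintro ⟨x, hx, hxO⟩
    obtain ⟨_, ⟨n, rfl⟩, hxn, hn⟩ := hb.exists_subset_of_mem_open hxO hO
    exact ⟨n, hn, x, hx, hxn⟩
  · rintro ⟨n, hn, x, hx, hxn⟩
    exact ⟨x, hx, hn hxn⟩

lemma measurable_of_hit {Ω : Type*} [MeasurableSpace Ω] {ι : Type*} [Countable ι] {b : ι → Set X}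
    (hb : IsTopologicalBasis (range b)) {f : Ω → Closeds X}
    (hf : ∀ n, Measurable fun ω => ((f ω : Set X) ∩ b n).Nonempty) : Measurable f := by
  refine measurable_generateFrom ?_
  rintro _ ⟨O, hO, rfl⟩
  have : Measurable fun ω => ((f ω : Set X) ∩ O).Nonempty := by
    simp only [hit_iff_of_basis hb hO]
    exact .exists fun n => measurable_const.and (hf n)
  exact measurableSet_setOfPred.2 this

lemma exists_nat_basis (X : Type) [TopologicalSpace X] [SecondCountableTopology X] [Nonempty X] :
    ∃ b : ℕ → Set X, IsTopologicalBasis (range b) := by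
  obtain ⟨b, hb⟩ := (countable_countableBasis X).exists_eq_range (by
    obtain ⟨u, hu, -⟩ := (isBasis_countableBasis X).exists_subset_of_mem_open
      (mem_univ (Classical.arbitrary X)) isOpen_univ
    exact ⟨u, hu⟩)
  exact ⟨b, hb ▸ isBasis_countableBasis X⟩

/-- A point belongs to a closed set exactly when each basic neighbourhood of the point meets the
set, which is a countable intersection of Borel conditions. -/
lemma measurable_mem_closeds [SecondCountableTopology X] [Nonempty X] [MeasurableSpace X]
    [OpensMeasurableSpace X] : Measurable fun t : X × Closeds X => t.1 ∈ t.2 := by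
  obtain ⟨b, hb⟩ := exists_nat_basis X
  have : (fun t : X × Closeds X => t.1 ∈ t.2) =
      fun t => ∀ n, t.1 ∈ b n → ((t.2 : Set X) ∩ b n).Nonempty := by
    ext t
    constructor
    · exact fun h n hn => ⟨t.1, h, hn⟩
    · intro h
      by_contra hn
      obtain ⟨_, ⟨n, rfl⟩, hxn, hn⟩ := hb.exists_subset_of_mem_open
        (show t.1 ∈ (t.2 : Set X)ᶜ from hn) t.2.isClosed.isOpen_compl
      obtain ⟨x, hx, hx'⟩ := h n hxn
      exact hn hx' hx
  rw [this]
  refine .forall fun n => .imp ?_ ?_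
  · exact measurableSet_setOfPred.1 (measurable_fst (hb.isOpen (mem_range_self n)).measurableSet)
  · exact (measurable_hit (hb.isOpen (mem_range_self n))).comp measurable_snd

/-- A closed set is coded by the basic open sets it meets. The codes are the upward closed families
of nonempty basic sets in which each member contains the closures of arbitrarily small members;
completeness turns the last condition into the existence of points. -/
theorem standardBorelSpace_closeds [PolishSpace X] [Nonempty X] : StandardBorelSpace (Closeds X) := by
  let _ := upgradeIsCompletelyMetrizable X
  obtain ⟨b, hb⟩ := exists_nat_basis X
  let code : Closeds X → ℕ → Prop := fun F n => ((F : Set X) ∩ b n).Nonempty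
  have hbo : ∀ n, IsOpen (b n) := fun n => hb.isOpen (mem_range_self n)
  refine standardBorelSpace_of_injective (f := code) ?_ (le_antisymm ?_ ?_) ?_
  · intro F F' h
    have h' : ∀ n, ((F : Set X) ∩ b n).Nonempty ↔ ((F' : Set X) ∩ b n).Nonempty := fun n =>
      iff_of_eq (congrFun h n)
    have key : ∀ F F' : Closeds X, (∀ n, ((F : Set X) ∩ b n).Nonempty ↔
        ((F' : Set X) ∩ b n).Nonempty) → (F : Set X) ⊆ F' := by
      intro F F' h x hx
      by_contra hx'
      obtain ⟨_, ⟨n, rfl⟩, hxn, hn⟩ := hb.exists_subset_of_mem_open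
        (show x ∈ (F' : Set X)ᶜ from hx') F'.isClosed.isOpen_compl
      obtain ⟨y, hy, hyn⟩ := (h n).1 ⟨x, hx, hxn⟩
      exact hn hyn hy
    exact SetLike.coe_injective (subset_antisymm (key F F' h') (key F' F fun n => (h' n).symm))
  · have : @Measurable _ _ (MeasurableSpace.comap code inferInstance) _ (id : Closeds X → Closeds X) :=
      @measurable_of_hit X _ _ (MeasurableSpace.comap code inferInstance) _ _ b hb id
        fun n => (measurable_pi_apply n).comp (comap_measurable code)
    intro s hs
    exact this hs
  · exact measurable_iff_comap_le.1 (measurable_pi_lambda _ fun n => measurable_hit (hbo n))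
  · have hrange : range code = {A | (∀ n, A n → (b n).Nonempty) ∧
        (∀ n m, b m ⊆ b n → A m → A n) ∧
        ∀ n k : ℕ, A n → ∃ m, (closure (b m) ⊆ b n ∧ ∀ x ∈ b m, ∀ y ∈ b m, dist x y ≤ (1 / 2 : ℝ) ^ k) ∧
          A m} := by
      ext A
      constructor
      · rintro ⟨F, rfl⟩
        refine ⟨fun n hn => hn.mono inter_subset_right, fun n m hmn hm =>
          hm.mono (inter_subset_inter_right _ hmn), ?_⟩
        rintro n k ⟨x, hx, hxn⟩
        have hε : (0 : ℝ) < (1 / 2 : ℝ) ^ k / 2 := by positivity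
        obtain ⟨_, ⟨m, rfl⟩, hxm, hm⟩ := hb.exists_closure_subset (Filter.inter_mem
          ((hbo n).mem_nhds hxn) (Metric.ball_mem_nhds x hε))
        refine ⟨m, ⟨fun y hy => (hm hy).1, fun y hy z hz => ?_⟩, x, hx, hxm⟩
        have h1 := (hm (subset_closure hy)).2
        have h2 := (hm (subset_closure hz)).2
        rw [Metric.mem_ball] at h1 h2
        linarith [dist_triangle_right y z x]
      · rintro ⟨hA0, hA1, hA2⟩
        let F : Closeds X := ⟨{x | ∀ n, x ∈ b n → A n}, by
          rw [← isOpen_compl_iff, isOpen_iff_mem_nhds]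
          intro x hx
          simp only [mem_compl_iff, mem_ofPred_eq, not_forall] at hx
          obtain ⟨n, hn, hAn⟩ := hx
          filter_upwards [(hbo n).mem_nhds hn] with y hy hy'
          exact hAn (hy' n hy)⟩
        refine ⟨F, funext fun n => propext ⟨fun ⟨x, hx, hxn⟩ => hx n hxn, fun hn => ?_⟩⟩
        -- Iterated refinement below `b n` gives nested members of the code with vanishing diameter;
        -- their limit is the point of `F` sought in `b n`.
        choose! next hnext hnextA using hA2
        let s : ℕ → ℕ := fun k => Nat.rec n (fun k i => next i k) k
        have hsA : ∀ k, A (s k) := fun k => by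
          induction k with
          | zero => exact hn
          | succ k ih => exact hnextA _ _ ih
        have hanti : Antitone fun k => b (s k) := antitone_nat_of_succ_le fun k =>
          subset_closure.trans (hnext (s k) k (hsA k)).1
        choose x hx using fun k => hA0 _ (hsA k)
        have hcau : CauchySeq fun k => x (k + 1) :=
          cauchySeq_of_le_tendsto_0 (fun n : ℕ => (1 / 2 : ℝ) ^ n)
            (fun i j N hi hj => (hnext (s N) N (hsA N)).2 _ (hanti (Nat.succ_le_succ hi) (hx (i + 1))) _
              (hanti (Nat.succ_le_succ hj) (hx (j + 1))))
            (tendsto_pow_atTop_nhds_zero_of_lt_one (by norm_num) (by norm_num))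
        obtain ⟨z, hz⟩ := cauchySeq_tendsto_of_complete hcau
        have hzb : ∀ k, z ∈ b (s k) := by
          intro k
          refine (hnext (s k) k (hsA k)).1 (mem_closure_of_tendsto hz ?_)
          filter_upwards [Filter.eventually_ge_atTop k] with m hm
          exact hanti (show k + 1 ≤ m + 1 by omega) (hx (m + 1))
        refine ⟨z, fun m hm => ?_, hzb 0⟩
        -- A basic neighbourhood of the limit contains a late member of the sequence, so upward
        -- closure puts it into the code.
        obtain ⟨ε, hε, hεm⟩ := Metric.isOpen_iff.1 (hbo m) z hm
        obtain ⟨k, hk⟩ := exists_pow_lt_of_lt_one hε (show (1 / 2 : ℝ) < 1 by norm_num)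
        refine hA1 m (s (k + 1)) (fun y hy => hεm ?_) (hsA (k + 1))
        rw [Metric.mem_ball]
        exact ((hnext (s k) k (hsA k)).2 y hy z (hzb (k + 1))).trans_lt hk
    rw [hrange]
    refine measurableSet_setOfPred.2 (.and ?_ (.and ?_ ?_))
    · exact .forall fun n => (measurable_pi_apply n).imp measurable_const
    · exact .forall fun n => .forall fun m => measurable_const.imp
        ((measurable_pi_apply m).imp (measurable_pi_apply n))
    · exact .forall fun n => .forall fun k => (measurable_pi_apply n).imp
        (.exists fun m => measurable_const.and (measurable_pi_apply m))

lemma measurable_sInf_nat {Ω : Type*} [MeasurableSpace Ω] {p : ℕ → Ω → Prop}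
    (hp : ∀ i, Measurable (p i)) : Measurable fun ω => sInf {i | p i ω} := by
  refine measurable_to_countable' fun m => ?_
  -- The second alternative accounts for the convention `sInf ∅ = 0`.
  have : (fun ω => sInf {i | p i ω}) ⁻¹' {m} =
      {ω | (p m ω ∧ ∀ i, i < m → ¬ p i ω) ∨ (m = 0 ∧ ∀ i, ¬ p i ω)} := by
    ext ω
    simp only [mem_preimage, mem_singleton_iff, mem_ofPred_eq]
    constructor
    · rintro rfl
      by_cases h : ∃ i, p i ω
      · exact Or.inl ⟨Nat.sInf_mem h, fun i hi hpi => Nat.notMem_of_lt_sInf hi hpi⟩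
      · push Not at h
        exact Or.inr ⟨by simp [h], h⟩
    · rintro (⟨h1, h2⟩ | ⟨rfl, h⟩)
      · exact le_antisymm (Nat.sInf_le h1) (le_csInf ⟨m, h1⟩ fun i hi => not_lt.1 fun h => h2 i h hi)
      · simp [h]
  rw [this]
  exact measurableSet_setOfPred.2 (((hp m).and (.forall fun i => measurable_const.imp (hp i).not)).or
    (measurable_const.and (.forall fun i => (hp i).not)))

/-- **Kuratowski–Ryll-Nardzewski**: Borel selectors of closed sets. -/
theorem exists_dense_selectors [PolishSpace X] [Nonempty X] [MeasurableSpace X] [BorelSpace X] :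
    ∃ d : ℕ → Closeds X → X, (∀ n, Measurable (d n)) ∧ ∀ F : Closeds X, (F : Set X).Nonempty →
      (∀ n, d n F ∈ F) ∧ (F : Set X) ⊆ closure (range fun n => d n F) := by
  let _ := upgradeIsCompletelyMetrizable X
  let x := denseSeq X
  let r : ℕ → ℝ := fun n => (1 / 2 : ℝ) ^ n
  have hr : ∀ n, 0 < r n := fun n => by positivity
  have hdense : ∀ z ε, 0 < ε → ∃ i, dist (x i) z < ε := fun z ε hε => by
    obtain ⟨i, hi⟩ := (denseRange_denseSeq X).exists_dist_lt z hε
    exact ⟨i, by rwa [dist_comm] at hi⟩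
  let hit (F : Closeds X) (O : Set X) : Prop := ((F : Set X) ∩ O).Nonempty
  -- Centres of balls that meet `F`, with radii `r j`, `r (j + 1)` and so on, each ball meeting its
  -- predecessor inside `F`. The first centre is `x k` whenever its ball meets `F`, which is what
  -- makes the limits dense; otherwise it is the least index that works.
  let idx (k j : ℕ) (F : Closeds X) (n : ℕ) : ℕ := Nat.rec
    (sInf {i | hit F (Metric.ball (x i) (r j)) ∧ (i = k ∨ ¬ hit F (Metric.ball (x k) (r j)))})
    (fun n m => sInf {i | hit F (Metric.ball (x i) (r (j + n + 1)) ∩ Metric.ball (x m) (r (j + n)))})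
    n
  have hidx : ∀ k j n, Measurable fun F => idx k j F n := by
    intro k j n
    induction n with
    | zero =>
      exact measurable_sInf_nat fun i => (measurable_hit Metric.isOpen_ball).and
        (measurable_const.or (measurable_hit Metric.isOpen_ball).not)
    | succ n ih =>
      refine measurable_sInf_nat (p := fun i F => hit F (Metric.ball (x i) (r (j + n + 1)) ∩
        Metric.ball (x (idx k j F n)) (r (j + n)))) fun i => ?_
      have : (fun F => hit F (Metric.ball (x i) (r (j + n + 1)) ∩
          Metric.ball (x (idx k j F n)) (r (j + n)))) = fun F => ∃ m, idx k j F n = m ∧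
          hit F (Metric.ball (x i) (r (j + n + 1)) ∩ Metric.ball (x m) (r (j + n))) := by
        ext F
        simp
      rw [this]
      exact .exists fun m => (measurableSet_setOfPred.1 (ih (measurableSet_singleton m))).and
        (measurable_hit (Metric.isOpen_ball.inter Metric.isOpen_ball))
  have hex : ∀ F : Closeds X, (F : Set X).Nonempty → ∀ k j n,
      hit F (Metric.ball (x (idx k j F n)) (r (j + n))) ∧
      dist (x (idx k j F n)) (x (idx k j F (n + 1))) ≤ 2 * r j / 1 * (1 / 2 : ℝ) ^ n := by
    intro F hF k j n
    have hstep : ∀ n, hit F (Metric.ball (x (idx k j F n)) (r (j + n))) →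
        hit F (Metric.ball (x (idx k j F (n + 1))) (r (j + n + 1)) ∩
          Metric.ball (x (idx k j F n)) (r (j + n))) := by
      rintro n ⟨z, hz, hzn⟩
      obtain ⟨i, hi⟩ := hdense z _ (hr (j + n + 1))
      exact Nat.sInf_mem (s := {i | hit F (Metric.ball (x i) (r (j + n + 1)) ∩
        Metric.ball (x (idx k j F n)) (r (j + n)))}) ⟨i, z, hz, by
          rwa [Metric.mem_ball, dist_comm], hzn⟩
    have h0 : hit F (Metric.ball (x (idx k j F n)) (r (j + n))) := by
      induction n with
      | zero =>
        have hne : {i | hit F (Metric.ball (x i) (r j)) ∧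
            (i = k ∨ ¬ hit F (Metric.ball (x k) (r j)))}.Nonempty := by
          by_cases hk : hit F (Metric.ball (x k) (r j))
          · exact ⟨k, hk, Or.inl rfl⟩
          · obtain ⟨z, hz⟩ := hF
            obtain ⟨i, hi⟩ := hdense z _ (hr j)
            exact ⟨i, ⟨z, hz, by rwa [Metric.mem_ball, dist_comm]⟩, Or.inr hk⟩
        exact (Nat.sInf_mem hne).1
      | succ n ih => exact (hstep n ih).mono (inter_subset_inter_right _ inter_subset_left)
    refine ⟨h0, ?_⟩
    obtain ⟨z, -, hz1, hz2⟩ := hstep n h0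
    rw [Metric.mem_ball] at hz1 hz2
    have h3 : r (j + n + 1) ≤ r (j + n) :=
      pow_le_pow_of_le_one (by norm_num) (by norm_num) (Nat.le_succ _)
    have h4 : r (j + n) = r j * (1 / 2) ^ n := pow_add _ _ _
    linarith [dist_triangle_left (x (idx k j F n)) (x (idx k j F (n + 1))) z]
  have hlim : ∀ k j F, ∃ z, Filter.Tendsto (fun n => x (idx k j F n)) Filter.atTop (𝓝 z) := by
    intro k j F
    by_cases hF : (F : Set X).Nonempty
    · exact cauchySeq_tendsto_of_complete (cauchySeq_of_le_geometric (1 / 2) (2 * r j / 1)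
        (by norm_num) fun n => (hex F hF k j n).2)
    -- For empty `F` every infimum is over the empty set, so all indices are `0` and the sequence is
    -- constant.
    · refine ⟨x 0, tendsto_const_nhds.congr fun n => ?_⟩
      have hno : ∀ O, ¬ hit F O := fun O h => hF (h.mono inter_subset_left)
      cases n <;> simp [idx, hno]
  choose z hz using hlim
  refine ⟨fun n F => z n.unpair.1 n.unpair.2 F, fun n => ?_, fun F hF => ⟨fun n => ?_, ?_⟩⟩
  · exact measurable_of_tendsto_metrizable (f := fun m F => x (idx n.unpair.1 n.unpair.2 F m))
      (fun m => (measurable_of_countable x).comp (hidx _ _ m))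
      (tendsto_pi_nhds.2 fun F => hz _ _ F)
  · have hlim := hz n.unpair.1 n.unpair.2 F
    choose y hy hyb using fun m => (hex F hF n.unpair.1 n.unpair.2 m).1
    refine F.isClosed.mem_of_tendsto (hlim.congr_dist ?_) (Filter.Eventually.of_forall hy)
    refine squeeze_zero (fun _ => dist_nonneg) (fun m => ?_)
      (tendsto_pow_atTop_nhds_zero_of_lt_one (r := (1 / 2 : ℝ)) (by norm_num) (by norm_num))
    have h1 := hyb m
    rw [Metric.mem_ball, dist_comm] at h1
    exact h1.le.trans (pow_le_pow_of_le_one (by norm_num) (by norm_num) (Nat.le_add_left _ _))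
  · intro w hw
    rw [Metric.mem_closure_iff]
    intro ε hε
    -- The limit is within `4 * r j` of the first centre, by the geometric series, and that centre
    -- is within `r j` of `w`; hence the `5`.
    obtain ⟨j, hj⟩ := exists_pow_lt_of_lt_one (show 0 < ε / 5 by positivity)
      (show (1 / 2 : ℝ) < 1 by norm_num)
    obtain ⟨k, hk⟩ := hdense w _ (hr j)
    refine ⟨_, ⟨Nat.pair k j, rfl⟩, ?_⟩
    simp only [Nat.unpair_pair]
    have hhit : hit F (Metric.ball (x k) (r j)) := ⟨w, hw, by rwa [Metric.mem_ball, dist_comm]⟩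
    have h0 : idx k j F 0 = k := by
      have : {i | hit F (Metric.ball (x i) (r j)) ∧
          (i = k ∨ ¬ hit F (Metric.ball (x k) (r j)))} = {k} := by
        ext i
        simp only [mem_ofPred_eq, hhit, not_true, or_false, mem_singleton_iff]
        exact ⟨fun h => h.2, fun h => ⟨h ▸ hhit, h⟩⟩
      change sInf _ = k
      rw [this]
      exact csInf_singleton k
    have hd := dist_le_of_le_geometric_of_tendsto₀ (1 / 2) (2 * r j / 1) (by norm_num)
      (fun n => (hex F hF k j n).2) (hz k j F)
    rw [h0] at hd
    have hj' : r j < ε / 5 := hj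
    have := dist_triangle_left w (z k j F) (x k)
    norm_num at hd
    linarith

end Effros

end BorelDuality

namespace BorelDuality

attribute [local instance] effros

/-! ### The Polish group `Sym(ℕ)` -/

lemma continuous_perm_apply (n : ℕ) : Continuous fun p : Equiv.Perm ℕ => p n :=
  (continuous_apply n).comp continuous_induced_dom

lemma tendsto_perm_iff {ι : Type*} {l : Filter ι} {f : ι → Equiv.Perm ℕ} {p : Equiv.Perm ℕ} :
    Filter.Tendsto f l (𝓝 p) ↔ ∀ n, ∀ᶠ i in l, f i n = p n := by
  rw [nhds_induced, Filter.tendsto_comap_iff, tendsto_pi_nhds]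
  simp only [nhds_discrete, Filter.tendsto_pure]
  rfl

instance : IsTopologicalGroup (Equiv.Perm ℕ) where
  continuous_mul := by
    rw [continuous_iff_continuousAt]
    rintro ⟨p, q⟩
    refine tendsto_perm_iff.2 fun n => ?_
    have h1 : ∀ᶠ t : Equiv.Perm ℕ × Equiv.Perm ℕ in 𝓝 (p, q), t.2 n = q n :=
      tendsto_perm_iff.1 continuous_snd.continuousAt n
    have h2 : ∀ᶠ t : Equiv.Perm ℕ × Equiv.Perm ℕ in 𝓝 (p, q), t.1 (q n) = p (q n) :=
      tendsto_perm_iff.1 continuous_fst.continuousAt (q n)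
    filter_upwards [h1, h2] with t ht ht'
    rw [Equiv.Perm.mul_apply, Equiv.Perm.mul_apply, ht, ht']
  continuous_inv := by
    rw [continuous_iff_continuousAt]
    intro p
    refine tendsto_perm_iff.2 fun n => ?_
    have h : ∀ᶠ q : Equiv.Perm ℕ in 𝓝 p, q (p⁻¹ n) = p (p⁻¹ n) :=
      tendsto_perm_iff.1 Filter.tendsto_id _
    filter_upwards [h] with q hq
    rw [Equiv.Perm.inv_eq_iff_eq, hq]
    simp

/-- The bijections are not closed among the self-maps of `ℕ`. Recording the inverse as well replaces
bijectivity by the closed condition that two maps are mutually inverse. -/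
lemma isClosedEmbedding_perm : IsClosedEmbedding
    fun p : Equiv.Perm ℕ => ((p : ℕ → ℕ), ((p⁻¹ : Equiv.Perm ℕ) : ℕ → ℕ)) := by
  have hc : Continuous fun p : Equiv.Perm ℕ => ((p : ℕ → ℕ), ((p⁻¹ : Equiv.Perm ℕ) : ℕ → ℕ)) :=
    continuous_induced_dom.prodMk (continuous_induced_dom.comp continuous_inv)
  refine ⟨⟨.of_comp hc continuous_fst ⟨rfl⟩, fun p q h => DFunLike.coe_injective
    (congrArg Prod.fst h)⟩, ?_⟩
  · have : range (fun p : Equiv.Perm ℕ => ((p : ℕ → ℕ), ((p⁻¹ : Equiv.Perm ℕ) : ℕ → ℕ))) =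
        {t | ∀ n m, (t.1 n = m ↔ t.2 m = n)} := by
      ext ⟨f, g⟩
      constructor
      · rintro ⟨p, hp⟩ n m
        rw [← hp]
        simp only [Equiv.Perm.inv_eq_iff_eq]
        exact eq_comm
      · intro h
        have h1 : Function.LeftInverse g f := fun n => (h n (f n)).1 rfl
        have h2 : Function.RightInverse g f := fun n => (h (g n) n).2 rfl
        exact ⟨⟨f, g, h1, h2⟩, rfl⟩
    rw [this]
    simp only [ofPred_forall]
    refine isClosed_iInter fun n => isClosed_iInter fun m => ?_
    have hn : Continuous fun t : (ℕ → ℕ) × (ℕ → ℕ) => (t.1 n, t.2 m) :=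
      ((continuous_apply n).comp continuous_fst).prodMk ((continuous_apply m).comp continuous_snd)
    exact (isClosed_discrete {t : ℕ × ℕ | t.1 = m ↔ t.2 = n}).preimage hn

instance : PolishSpace (Equiv.Perm ℕ) := isClosedEmbedding_perm.polishSpace

instance : MeasurableSpace (Equiv.Perm ℕ) := borel _

instance : BorelSpace (Equiv.Perm ℕ) := ⟨rfl⟩

lemma measurable_perm_iff {Ω : Type*} [MeasurableSpace Ω] {f : Ω → Equiv.Perm ℕ} :
    Measurable f ↔ ∀ n, Measurable fun ω => f ω n := by
  have : borel (Equiv.Perm ℕ) =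
      MeasurableSpace.comap (fun p : Equiv.Perm ℕ => (p : ℕ → ℕ)) inferInstance := by
    rw [BorelSpace.measurable_eq (α := ℕ → ℕ), ← borel_comap]
  rw [BorelSpace.measurable_eq (α := Equiv.Perm ℕ), this, measurable_comap_iff, measurable_pi_iff]
  rfl

lemma Measurable.perm_apply {Ω : Type*} [MeasurableSpace Ω] {f : Ω → Equiv.Perm ℕ} {g : Ω → ℕ}
    (hf : Measurable f) (hg : Measurable g) : Measurable fun ω => f ω (g ω) := by
  have : Measurable fun t : Ω × ℕ => f t.1 t.2 :=
    measurable_from_prod_countable_left fun n => measurable_perm_iff.1 hf n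
  exact this.comp (measurable_id.prodMk hg)

lemma measurable_of_apply_eq {Ω : Type*} [MeasurableSpace Ω] {f : Ω → Equiv.Perm ℕ}
    (hf : ∀ n m, Measurable fun ω => f ω n = m) : Measurable f :=
  measurable_perm_iff.2 fun n => measurable_to_countable' fun m =>
    measurableSet_setOfPred.2 (hf n m)

/-- The basic clopen sets of `Sym(ℕ)`. -/
def cylinder (s : Finset (ℕ × ℕ)) : Set (Equiv.Perm ℕ) := {p | ∀ t ∈ s, p t.1 = t.2}

lemma isClopen_apply_eq (n m : ℕ) : IsClopen {p : Equiv.Perm ℕ | p n = m} :=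
  (isClopen_discrete {m}).preimage (continuous_perm_apply n)

lemma isClopen_cylinder (s : Finset (ℕ × ℕ)) : IsClopen (cylinder s) := by
  have : cylinder s = ⋂ t ∈ s, {p : Equiv.Perm ℕ | p t.1 = t.2} := by
    ext p
    simp [cylinder]
  rw [this]
  exact s.finite_toSet.isClopen_biInter fun t _ => isClopen_apply_eq _ _

lemma exists_cylinder {p : Equiv.Perm ℕ} {O : Set (Equiv.Perm ℕ)} (hO : IsOpen O) (hp : p ∈ O) :
    ∃ s, p ∈ cylinder s ∧ cylinder s ⊆ O := by
  obtain ⟨V, hV, rfl⟩ := isOpen_induced_iff.1 hO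
  obtain ⟨I, u, hu, hIV⟩ := isOpen_pi_iff.1 hV p hp
  refine ⟨I.image fun n => (n, p n), ?_, fun q hq => hIV fun n hn => ?_⟩
  · intro t ht
    obtain ⟨n, -, rfl⟩ := Finset.mem_image.1 ht
    rfl
  · have := hq (n, p n) (Finset.mem_image_of_mem _ hn)
    exact (this ▸ (hu n hn).2 : q n ∈ u n)

lemma isTopologicalBasis_cylinder : IsTopologicalBasis (range cylinder) :=
  isTopologicalBasis_of_isOpen_of_nhds (by rintro _ ⟨s, rfl⟩; exact (isClopen_cylinder s).isOpen)
    fun p O hp hO => by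
      obtain ⟨s, hs, hsO⟩ := exists_cylinder hO hp
      exact ⟨_, mem_range_self s, hs, hsO⟩

/-- A net of permutations which, together with the net of inverses, is pointwise eventually
constant, converges. -/
lemma exists_tendsto_perm {ι : Type*} {l : Filter ι} [l.NeBot] {u : ι → Equiv.Perm ℕ}
    (h : ∀ k, ∃ a, ∀ᶠ i in l, u i k = a) (h' : ∀ k, ∃ a, ∀ᶠ i in l, (u i)⁻¹ k = a) :
    ∃ p, Filter.Tendsto u l (𝓝 p) := by
  choose f hf using h
  choose g hg using h'
  refine ⟨⟨f, g, fun k => ?_, fun k => ?_⟩, tendsto_perm_iff.2 hf⟩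
  · obtain ⟨i, hi, hi'⟩ := ((hf k).and (hg (f k))).exists
    rw [← hi', ← hi]
    simp
  · obtain ⟨i, hi, hi'⟩ := ((hg k).and (hf (g k))).exists
    rw [← hi', ← hi]
    simp

/-! ### The space of closed subgroups of `Sym(ℕ)` -/

/-- The underlying closed set of a closed subgroup. -/
def toCloseds (G : ClosedSubgroup (Equiv.Perm ℕ)) : Closeds (Equiv.Perm ℕ) :=
  ⟨(G : Set (Equiv.Perm ℕ)), G.isClosed'⟩

lemma measurable_toCloseds : Measurable toCloseds := comap_measurable _

lemma measurable_subgroup_of_cylinder {Ω : Type*} [MeasurableSpace Ω]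
    {f : Ω → ClosedSubgroup (Equiv.Perm ℕ)}
    (hf : ∀ s, Measurable fun ω => ((f ω : Set (Equiv.Perm ℕ)) ∩ cylinder s).Nonempty) :
    Measurable f :=
  measurable_comap_iff.2 (measurable_of_hit (f := fun ω => toCloseds (f ω))
    isTopologicalBasis_cylinder hf)

lemma measurable_subgroup_hit {O : Set (Equiv.Perm ℕ)} (hO : IsOpen O) :
    Measurable fun G : ClosedSubgroup (Equiv.Perm ℕ) => ((G : Set (Equiv.Perm ℕ)) ∩ O).Nonempty :=
  (measurable_hit hO).comp measurable_toCloseds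

lemma measurable_mem_subgroup :
    Measurable fun t : Equiv.Perm ℕ × ClosedSubgroup (Equiv.Perm ℕ) => t.1 ∈ t.2 :=
  measurable_mem_closeds.comp (measurable_fst.prodMk (measurable_toCloseds.comp measurable_snd))

/-- By continuity of `(a, b) ↦ a⁻¹ b`. It turns the group axioms for a closed set into countably
many conditions on a dense sequence, so that closed subgroups form a Borel set of closed sets. -/
lemma div_mem_of_dense {Γ : Type*} [TopologicalSpace Γ] [Group Γ] [IsTopologicalGroup Γ]
    {F : Set Γ} (hF : IsClosed F) {d : ℕ → Γ} (hd : F ⊆ closure (range d))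
    (h : ∀ n m, (d n)⁻¹ * d m ∈ F) {x y : Γ} (hx : x ∈ F) (hy : y ∈ F) : x⁻¹ * y ∈ F := by
  refine hF.closure_subset (map_mem_closure₂ (f := fun a b : Γ => a⁻¹ * b)
    (continuous_fst.inv.mul continuous_snd) (hd hx) (hd hy) ?_)
  rintro _ ⟨n, rfl⟩ _ ⟨m, rfl⟩
  exact h n m

instance : StandardBorelSpace (ClosedSubgroup (Equiv.Perm ℕ)) := by
  have : StandardBorelSpace (Closeds (Equiv.Perm ℕ)) := standardBorelSpace_closeds
  refine standardBorelSpace_of_injective (f := toCloseds) (fun G H h => ?_) rfl ?_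
  · exact SetLike.coe_injective (congrArg (fun F : Closeds _ => (F : Set (Equiv.Perm ℕ))) h)
  · obtain ⟨d, hd, hdF⟩ := exists_dense_selectors (X := Equiv.Perm ℕ)
    have : range toCloseds = {F | 1 ∈ F ∧ ∀ n m, (d n F)⁻¹ * d m F ∈ F} := by
      ext F
      constructor
      · rintro ⟨G, rfl⟩
        have hG : ∀ n, d n (toCloseds G) ∈ G := (hdF (toCloseds G) ⟨1, one_mem G⟩).1
        exact ⟨one_mem G, fun n m => show _ ∈ G from mul_mem (inv_mem (hG n)) (hG m)⟩
      · rintro ⟨h1, h2⟩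
        have hmul : ∀ {x y}, x ∈ F → y ∈ F → x⁻¹ * y ∈ F := fun hx hy =>
          div_mem_of_dense F.isClosed (hdF F ⟨1, h1⟩).2 h2 hx hy
        have hinv : ∀ {x}, x ∈ F → x⁻¹ ∈ F := fun hx => by simpa using hmul hx h1
        exact ⟨⟨⟨⟨⟨F, fun hx hy => by simpa using hmul (hinv hx) hy⟩, h1⟩, hinv⟩, F.isClosed⟩, rfl⟩
    rw [this]
    refine measurableSet_setOfPred.2 (.and ?_ (.forall fun n => .forall fun m => ?_))
    · exact measurable_mem_closeds.comp (measurable_const.prodMk measurable_id)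
    · exact measurable_mem_closeds.comp (((hd n).inv.mul (hd m)).prodMk measurable_id)

lemma exists_subgroup_dense : ∃ d : ℕ → ClosedSubgroup (Equiv.Perm ℕ) → Equiv.Perm ℕ,
    (∀ n, Measurable (d n)) ∧ ∀ G : ClosedSubgroup (Equiv.Perm ℕ), (∀ n, d n G ∈ G) ∧
      (G : Set (Equiv.Perm ℕ)) ⊆ closure (range fun n => d n G) := by
  obtain ⟨d, hd, hdF⟩ := exists_dense_selectors (X := Equiv.Perm ℕ)
  exact ⟨fun n G => d n (toCloseds G), fun n => (hd n).comp measurable_toCloseds,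
    fun G => hdF (toCloseds G) ⟨1, one_mem G⟩⟩

/-- A dense sequence of elements of a closed subgroup, depending on the subgroup in a Borel way. -/
noncomputable def dense (n : ℕ) (G : ClosedSubgroup (Equiv.Perm ℕ)) : Equiv.Perm ℕ :=
  exists_subgroup_dense.choose n G

lemma measurable_dense (n : ℕ) : Measurable (dense n) := exists_subgroup_dense.choose_spec.1 n

lemma dense_mem (n : ℕ) (G : ClosedSubgroup (Equiv.Perm ℕ)) : dense n G ∈ G :=
  (exists_subgroup_dense.choose_spec.2 G).1 n

lemma exists_dense_mem (G : ClosedSubgroup (Equiv.Perm ℕ)) {A : Set G} (hA : IsOpen A)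
    (hne : A.Nonempty) : ∃ n, (⟨dense n G, dense_mem n G⟩ : G) ∈ A := by
  obtain ⟨O, hO, rfl⟩ := hA
  obtain ⟨x, hx⟩ := hne
  obtain ⟨_, hy, ⟨n, rfl⟩⟩ := mem_closure_iff.1
    ((exists_subgroup_dense.choose_spec.2 G).2 x.2) O hO hx
  exact ⟨n, hy⟩

/-- Two clopen sets which contain the same points of the dense sequence are equal. -/
lemma eq_of_dense (G : ClosedSubgroup (Equiv.Perm ℕ)) {A B : Set G} (hA : IsClopen A)
    (hB : IsClopen B) (h : ∀ n, (⟨dense n G, dense_mem n G⟩ : G) ∈ A ↔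
      (⟨dense n G, dense_mem n G⟩ : G) ∈ B) : A = B := by
  have key : ∀ A B : Set G, IsClopen A → IsClopen B → (∀ n, (⟨dense n G, dense_mem n G⟩ : G) ∈ A →
      (⟨dense n G, dense_mem n G⟩ : G) ∈ B) → A ⊆ B := by
    intro A B hA hB h x hx
    by_contra hxB
    obtain ⟨n, hn, hn'⟩ := exists_dense_mem G (hA.isOpen.inter hB.compl.isOpen) ⟨x, hx, hxB⟩
    exact hn' (h n hn)
  exact subset_antisymm (key A B hA hB fun n => (h n).1) (key B A hB hA fun n => (h n).2)

end BorelDuality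

namespace BorelDuality

attribute [local instance] effros

variable {Gr : Set (ClosedSubgroup (Equiv.Perm ℕ))}

/-! ### The Borel category of groups -/

lemma measurable_grp : Measurable (GrCat.grp : GrCat Gr → _) := comap_measurable _

lemma grp_injective : Function.Injective (GrCat.grp : GrCat Gr → _) := by
  rintro ⟨G, hG⟩ ⟨H, hH⟩ h
  cases h
  rfl

lemma standardBorelSpace_grCat (hGr : MeasurableSet Gr) : StandardBorelSpace (GrCat Gr) := by
  refine standardBorelSpace_of_injective grp_injective rfl ?_
  convert hGr
  ext G
  exact ⟨by rintro ⟨X, rfl⟩; exact X.mem, fun h => ⟨⟨G, h⟩, rfl⟩⟩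

open Classical in
/-- The value of a morphism at a permutation, which is set to be `1` outside the domain. -/
noncomputable def app (f : Arrow (GrCat Gr)) (x : Equiv.Perm ℕ) : Equiv.Perm ℕ :=
  if h : x ∈ f.left.grp then
    ((show f.left.grp ≃ₜ* f.right.grp from f.hom) ⟨x, h⟩ : Equiv.Perm ℕ) else 1

lemma app_of_mem (f : Arrow (GrCat Gr)) {x : Equiv.Perm ℕ} (h : x ∈ f.left.grp) :
    app f x = ((show f.left.grp ≃ₜ* f.right.grp from f.hom) ⟨x, h⟩ : Equiv.Perm ℕ) := dif_pos h

lemma app_mem (f : Arrow (GrCat Gr)) (x : Equiv.Perm ℕ) : app f x ∈ f.right.grp := by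
  unfold app
  split_ifs
  · exact Subtype.property _
  · exact one_mem _

/-- The graph of a morphism. -/
def arrowGraph (f : Arrow (GrCat Gr)) : Closeds (Equiv.Perm ℕ × Equiv.Perm ℕ) :=
  isoGraph (show f.left.grp ≃ₜ* f.right.grp from f.hom)

lemma mem_arrowGraph (f : Arrow (GrCat Gr)) (t : Equiv.Perm ℕ × Equiv.Perm ℕ) :
    t ∈ arrowGraph f ↔ t.1 ∈ f.left.grp ∧ app f t.1 = t.2 := by
  constructor
  · rintro ⟨x, rfl⟩
    exact ⟨x.2, app_of_mem f x.2⟩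
  · rintro ⟨h, h'⟩
    exact ⟨⟨t.1, h⟩, Prod.ext rfl ((app_of_mem f h).symm.trans h')⟩

lemma measurable_arrow_left : Measurable fun f : Arrow (GrCat Gr) => (f.left : GrCat Gr) :=
  measurable_fst.comp (comap_measurable _)

lemma measurable_arrow_right : Measurable fun f : Arrow (GrCat Gr) => (f.right : GrCat Gr) :=
  (measurable_fst.comp measurable_snd).comp (comap_measurable _)

lemma measurable_arrowGraph : Measurable (arrowGraph : Arrow (GrCat Gr) → _) :=
  (measurable_snd.comp measurable_snd).comp (comap_measurable _)

/-- By continuity the value at `k` is locally constant, so it can be recognised from a cylinder over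
which the graph avoids all other values. This expresses evaluation through the Effros code of the
graph. Off the domain the value is the identity by convention. -/
lemma app_eq_iff (f : Arrow (GrCat Gr)) (x : Equiv.Perm ℕ) (k a : ℕ) : app f x k = a ↔
    (x ∈ f.left.grp ∧ ∃ s, x ∈ cylinder s ∧
      ¬ ((arrowGraph f : Set (Equiv.Perm ℕ × Equiv.Perm ℕ)) ∩
        (cylinder s ×ˢ {y | y k ≠ a})).Nonempty) ∨ (x ∉ f.left.grp ∧ k = a) := by
  by_cases hx : x ∈ f.left.grp
  · simp only [hx, true_and, not_true, false_and, or_false]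
    constructor
    · intro h
      have hc : Continuous fun y : f.left.grp => app f y k := by
        have : Continuous fun y : f.left.grp =>
            ((show f.left.grp ≃ₜ* f.right.grp from f.hom) y : Equiv.Perm ℕ) k :=
          (continuous_perm_apply k).comp
            (continuous_subtype_val.comp
            (show f.left.grp ≃ₜ* f.right.grp from f.hom).continuous_toFun)
        exact this.congr fun y => by rw [app_of_mem f y.2]
      obtain ⟨O, hO, hOe⟩ := ((isOpen_discrete {a}).preimage hc)
      obtain ⟨s, hs, hsO⟩ := exists_cylinder hO
        (show (⟨x, hx⟩ : f.left.grp) ∈ Subtype.val ⁻¹' O by rw [hOe]; exact h)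
      refine ⟨s, hs, ?_⟩
      rintro ⟨t, ht, hts, hta⟩
      rw [SetLike.mem_coe, mem_arrowGraph] at ht
      have : (⟨t.1, ht.1⟩ : f.left.grp) ∈ Subtype.val ⁻¹' O := hsO hts
      rw [hOe] at this
      exact hta (ht.2 ▸ this)
    · rintro ⟨s, hs, hn⟩
      by_contra hne
      exact hn ⟨(x, app f x), (mem_arrowGraph f _).2 ⟨hx, rfl⟩, hs, hne⟩
  · simp [hx, app]

lemma measurable_app : Measurable fun t : Arrow (GrCat Gr) × Equiv.Perm ℕ => app t.1 t.2 := by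
  refine measurable_of_apply_eq fun k a => ?_
  simp only [app_eq_iff]
  have hmem : Measurable fun t : Arrow (GrCat Gr) × Equiv.Perm ℕ => t.2 ∈ t.1.left.grp :=
    measurable_mem_subgroup.comp (measurable_snd.prodMk
      (measurable_grp.comp (measurable_arrow_left.comp measurable_fst)))
  refine (hmem.and (.exists fun s => .and ?_ (.not ?_))).or (hmem.not.and measurable_const)
  · exact measurableSet_setOfPred.1 (measurable_snd (isClopen_cylinder s).isOpen.measurableSet)
  · exact (measurable_hit ((isClopen_cylinder s).isOpen.prod
      (isClopen_apply_eq k a).compl.isOpen)).comp (measurable_arrowGraph.comp measurable_fst)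

lemma continuous_app (f : Arrow (GrCat Gr)) : Continuous fun x : f.left.grp => app f x := by
  have : Continuous fun y : f.left.grp =>
      ((show f.left.grp ≃ₜ* f.right.grp from f.hom) y : Equiv.Perm ℕ) :=
    continuous_subtype_val.comp (show f.left.grp ≃ₜ* f.right.grp from f.hom).continuous_toFun
  exact this.congr fun y => (app_of_mem f y.2).symm

/-- The graph points over the dense sequence are dense in the graph, so an open set meets the graph
only if it contains one of them. -/
lemma measurable_to_arrow {Ω : Type*} [MeasurableSpace Ω] {F : Ω → Arrow (GrCat Gr)}
    (hl : Measurable fun ω => (F ω).left) (hr : Measurable fun ω => (F ω).right)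
    (h : ∀ n, Measurable fun ω => app (F ω) (dense n (F ω).left.grp)) : Measurable F := by
  refine measurable_comap_iff.2 (hl.prodMk (hr.prodMk (measurable_generateFrom ?_)))
  rintro _ ⟨O, hO, rfl⟩
  have : (fun ω => arrowGraph (F ω)) ⁻¹'
      {Γ | ((Γ : Set (Equiv.Perm ℕ × Equiv.Perm ℕ)) ∩ O).Nonempty} =
      ⋃ n, {ω | (dense n (F ω).left.grp, app (F ω) (dense n (F ω).left.grp)) ∈ O} := by
    ext ω
    simp only [mem_preimage, mem_ofPred_eq, mem_iUnion]
    constructor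
    · rintro ⟨t, ht, htO⟩
      rw [SetLike.mem_coe, mem_arrowGraph] at ht
      have hc : Continuous fun x : (F ω).left.grp => ((x : Equiv.Perm ℕ), app (F ω) x) :=
        continuous_subtype_val.prodMk (continuous_app (F ω))
      refine exists_dense_mem (F ω).left.grp (hO.preimage hc) ⟨⟨t.1, ht.1⟩, ?_⟩
      change ((t.1, app (F ω) t.1) : Equiv.Perm ℕ × Equiv.Perm ℕ) ∈ O
      rw [ht.2]
      exact htO
    · rintro ⟨n, hn⟩
      exact ⟨_, (mem_arrowGraph _ _).2 ⟨dense_mem _ _, rfl⟩, hn⟩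
  change MeasurableSet ((fun ω => arrowGraph (F ω)) ⁻¹' _)
  rw [this]
  exact .iUnion fun n => (((measurable_dense n).comp (measurable_grp.comp hl)).prodMk (h n))
    hO.measurableSet

lemma measurable_ident : Measurable fun X : GrCat Gr => Arrow.mk (𝟙 X) := by
  refine measurable_to_arrow measurable_id measurable_id fun n => ?_
  have : (fun X : GrCat Gr => app (Arrow.mk (𝟙 X)) (dense n X.grp)) = fun X => dense n X.grp := by
    ext1 X
    exact app_of_mem (Arrow.mk (𝟙 X)) (dense_mem n X.grp)
  exact this ▸ (measurable_dense n).comp measurable_grp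

/-- Continuous maps into a Hausdorff space that agree on the dense sequence are equal; this leaves a
countable condition. -/
lemma arrow_comp_iff (t : Arrow (GrCat Gr) × Arrow (GrCat Gr) × Arrow (GrCat Gr)) :
    (∃ (X Y Z : GrCat Gr) (f : X ⟶ Y) (g : Y ⟶ Z),
      t = (Arrow.mk f, Arrow.mk g, Arrow.mk (f ≫ g))) ↔
    t.1.right = t.2.1.left ∧ t.2.2.left = t.1.left ∧ t.2.2.right = t.2.1.right ∧
      ∀ n, app t.2.2 (dense n t.1.left.grp) = app t.2.1 (app t.1 (dense n t.1.left.grp)) := by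
  constructor
  · rintro ⟨X, Y, Z, f, g, rfl⟩
    refine ⟨rfl, rfl, rfl, fun n => ?_⟩
    have hm : dense n X.grp ∈ X.grp := dense_mem n X.grp
    change app (Arrow.mk (f ≫ g)) (dense n X.grp) =
      app (Arrow.mk g) (app (Arrow.mk f) (dense n X.grp))
    rw [app_of_mem (Arrow.mk g) (app_mem (Arrow.mk f) _), app_of_mem (Arrow.mk (f ≫ g)) hm]
    refine congrArg Subtype.val (congrArg (show Y.grp ≃ₜ* Z.grp from g) ?_)
    exact Subtype.ext (app_of_mem (Arrow.mk f) hm).symm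
  · obtain ⟨⟨X, Y, f⟩, ⟨Y', Z, g⟩, ⟨X', Z', h⟩⟩ := t
    rintro ⟨h1, h2, h3, h4⟩
    dsimp only at h1 h2 h3 h4
    subst h1 h2 h3
    refine ⟨X', Y, Z', f, g, ?_⟩
    have : h = f ≫ g := by
      have hT2 : T2Space (Equiv.Perm ℕ) := inferInstance
      refine ContinuousMulEquiv.ext fun x => Subtype.ext ?_
      have hc1 := continuous_app (Arrow.mk h)
      have hc2 := continuous_app (Arrow.mk (f ≫ g))
      by_contra hne
      have hO : IsOpen {x : X'.grp | app (Arrow.mk h) x ≠ app (Arrow.mk (f ≫ g)) x} :=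
        isOpen_ne_fun hc1 hc2
      obtain ⟨n, hn⟩ := exists_dense_mem X'.grp hO ⟨x, by
        rw [mem_ofPred_eq, app_of_mem (Arrow.mk h) x.2, app_of_mem (Arrow.mk (f ≫ g)) x.2]
        exact hne⟩
      refine hn ((h4 n).trans ?_)
      have hm : dense n X'.grp ∈ X'.grp := dense_mem n X'.grp
      change app (Arrow.mk g) (app (Arrow.mk f) (dense n X'.grp)) = _
      rw [app_of_mem (Arrow.mk g) (app_mem (Arrow.mk f) _), app_of_mem (Arrow.mk (f ≫ g)) hm]
      refine congrArg Subtype.val (congrArg (show Y.grp ≃ₜ* Z'.grp from g) ?_)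
      exact Subtype.ext (app_of_mem (Arrow.mk f) hm)
    rw [this]
    rfl

/-! ### Closed subgroups of `Sym(ℕ)²` which are graphs of isomorphisms -/

/-- The domain of a closed subgroup of `Sym(ℕ)²` which is a continuous relation is closed. -/
lemma exists_mem_graph {Γ : Set (Equiv.Perm ℕ × Equiv.Perm ℕ)} (hΓ : IsClosed Γ)
    (hmul : ∀ x ∈ Γ, ∀ y ∈ Γ, x⁻¹ * y ∈ Γ) (h1 : 1 ∈ Γ)
    (hcont : ∀ k : ℕ, ∃ s, 1 ∈ cylinder s ∧ ¬ (Γ ∩ (cylinder s ×ˢ {y | y k ≠ k})).Nonempty)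
    {x : Equiv.Perm ℕ} (hx : ∀ s, x ∈ cylinder s → (Γ ∩ (cylinder s ×ˢ univ)).Nonempty) :
    ∃ y, (x, y) ∈ Γ := by
  -- Pairs in `Γ` whose first coordinate approaches `x`; their second coordinates will be shown to
  -- converge.
  let l : Filter (Equiv.Perm ℕ × Equiv.Perm ℕ) := Filter.comap Prod.fst (𝓝 x) ⊓ Filter.principal Γ
  have hl : l.NeBot := by
    rw [Filter.inf_principal_neBot_iff]
    rintro U ⟨V, hV, hVU⟩
    obtain ⟨s, hs, hsV⟩ := exists_cylinder isOpen_interior (mem_interior_iff_mem_nhds.2 hV)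
    obtain ⟨t, ht, hts, -⟩ := hx s hs
    exact ⟨t, hVU (show t.1 ∈ V from interior_subset (hsV hts)), ht⟩
  have hfst : Filter.Tendsto Prod.fst l (𝓝 x) := Filter.tendsto_comap.mono_left inf_le_left
  have hmem : ∀ᶠ t in l, t ∈ Γ := Filter.mem_inf_of_right (Filter.mem_principal_self Γ)
  have hinv : ∀ t ∈ Γ, t⁻¹ ∈ Γ := fun t ht => by simpa using hmul t ht 1 h1
  obtain ⟨y, hy⟩ : ∃ y, Filter.Tendsto Prod.snd l (𝓝 y) := by
    refine exists_tendsto_perm (fun k => ?_) fun k => ?_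
    · obtain ⟨s, hs, hsn⟩ := hcont k
      -- If `t₀` and `t` in `Γ` have first coordinates near `x`, then `t₀⁻¹ * t` has first
      -- coordinate near `1`, so its second coordinate fixes `k`: the second coordinates of `t₀` and
      -- `t` agree at `k`.
      have hU : {p : Equiv.Perm ℕ × Equiv.Perm ℕ | p.1⁻¹ * p.2 ∈ cylinder s} ∈ 𝓝 (x, x) :=
        ((isClopen_cylinder s).isOpen.preimage
          (continuous_fst.inv.mul continuous_snd)).mem_nhds (by simpa using hs)
      obtain ⟨V, hV, hVU⟩ := Filter.mem_prod_same_iff.1 (nhds_prod_eq (x := x) (y := x) ▸ hU)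
      obtain ⟨t₀, ht₀, ht₀V⟩ := (hmem.and (hfst hV)).exists
      refine ⟨t₀.2 k, ?_⟩
      filter_upwards [hmem, hfst hV] with t ht htV
      by_contra hne
      refine hsn ⟨t₀⁻¹ * t, hmul _ ht₀ _ ht, hVU (mk_mem_prod ht₀V htV), fun he => hne ?_⟩
      have he' : t₀.2⁻¹ (t.2 k) = k := he
      rw [Equiv.Perm.inv_eq_iff_eq] at he'
      exact he'
    · obtain ⟨s, hs, hsn⟩ := hcont k
      -- The quotients on the other side control the inverses of the second coordinates.
      have hU : {p : Equiv.Perm ℕ × Equiv.Perm ℕ | p.1 * p.2⁻¹ ∈ cylinder s} ∈ 𝓝 (x, x) :=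
        ((isClopen_cylinder s).isOpen.preimage
          (continuous_fst.mul continuous_snd.inv)).mem_nhds (by simpa using hs)
      obtain ⟨V, hV, hVU⟩ := Filter.mem_prod_same_iff.1 (nhds_prod_eq (x := x) (y := x) ▸ hU)
      obtain ⟨t₀, ht₀, ht₀V⟩ := (hmem.and (hfst hV)).exists
      refine ⟨t₀.2⁻¹ k, ?_⟩
      filter_upwards [hmem, hfst hV] with t ht htV
      by_contra hne
      refine hsn ⟨t₀ * t⁻¹, by simpa using hmul _ (hinv _ ht₀) _ (hinv _ ht),
        hVU (mk_mem_prod ht₀V htV), fun he => hne ?_⟩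
      exact Equiv.Perm.eq_inv_iff_eq.2 he
  exact ⟨y, hΓ.mem_of_tendsto (hfst.prodMk_nhds hy) hmem⟩

instance (G : ClosedSubgroup (Equiv.Perm ℕ)) : IsTopologicalGroup G :=
  inferInstanceAs (IsTopologicalGroup G.toSubgroup)

/-- A homomorphism between groups of permutations is continuous if it is so at the identity. -/
lemma continuous_hom_of_cylinder {G H : ClosedSubgroup (Equiv.Perm ℕ)} (φ : G →* H)
    (h : ∀ k, ∃ s, 1 ∈ cylinder s ∧ ∀ x : G, (x : Equiv.Perm ℕ) ∈ cylinder s →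
      (φ x : Equiv.Perm ℕ) k = k) : Continuous φ := by
  refine continuous_of_continuousAt_one φ ?_
  rw [ContinuousAt, tendsto_subtype_rng, map_one]
  refine tendsto_perm_iff.2 fun k => ?_
  obtain ⟨s, hs, hsφ⟩ := h k
  have : ∀ᶠ x : G in 𝓝 1, (x : Equiv.Perm ℕ) ∈ cylinder s :=
    continuous_subtype_val.continuousAt ((isClopen_cylinder s).isOpen.mem_nhds hs)
  filter_upwards [this] with x hx
  exact hsφ x hx

/-- `Γ` is the graph of a topological isomorphism from `G` to `H`; these are Borel conditions. -/
structure IsIsoGraph (G H : ClosedSubgroup (Equiv.Perm ℕ))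
    (Γ : Set (Equiv.Perm ℕ × Equiv.Perm ℕ)) : Prop where
  one : 1 ∈ Γ
  div : ∀ x ∈ Γ, ∀ y ∈ Γ, x⁻¹ * y ∈ Γ
  fst : ∀ t ∈ Γ, t.1 ∈ G
  snd : ∀ t ∈ Γ, t.2 ∈ H
  dense_fst : ∀ s, ((G : Set (Equiv.Perm ℕ)) ∩ cylinder s).Nonempty →
    (Γ ∩ (cylinder s ×ˢ univ)).Nonempty
  dense_snd : ∀ s, ((H : Set (Equiv.Perm ℕ)) ∩ cylinder s).Nonempty →
    (Γ ∩ (univ ×ˢ cylinder s)).Nonempty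
  cont : ∀ k : ℕ, ∃ s, 1 ∈ cylinder s ∧ ¬ (Γ ∩ (cylinder s ×ˢ {y | y k ≠ k})).Nonempty
  cont_symm : ∀ k : ℕ, ∃ s, 1 ∈ cylinder s ∧ ¬ (Γ ∩ ({y | y k ≠ k} ×ˢ cylinder s)).Nonempty

lemma IsIsoGraph.swap {G H : ClosedSubgroup (Equiv.Perm ℕ)}
    {Γ : Set (Equiv.Perm ℕ × Equiv.Perm ℕ)} (h : IsIsoGraph G H Γ) :
    IsIsoGraph H G (Prod.swap ⁻¹' Γ) where
  one := h.one
  div x hx y hy := h.div _ hx _ hy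
  fst t ht := h.snd _ ht
  snd t ht := h.fst _ ht
  dense_fst s hs := by
    obtain ⟨t, ht, -, ht'⟩ := h.dense_snd s hs
    exact ⟨t.swap, ht, ht', trivial⟩
  dense_snd s hs := by
    obtain ⟨t, ht, ht', -⟩ := h.dense_fst s hs
    exact ⟨t.swap, ht, trivial, ht'⟩
  cont k := by
    obtain ⟨s, hs, hn⟩ := h.cont_symm k
    exact ⟨s, hs, fun ⟨t, ht, h1, h2⟩ => hn ⟨t.swap, ht, h2, h1⟩⟩
  cont_symm k := by
    obtain ⟨s, hs, hn⟩ := h.cont k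
    exact ⟨s, hs, fun ⟨t, ht, h1, h2⟩ => hn ⟨t.swap, ht, h2, h1⟩⟩

/-- Existence: the domain is dense in `G` and closed. Uniqueness: two values over `x` have a
quotient lying over `1`, and continuity at the identity forces it to be trivial. -/
lemma IsIsoGraph.existsUnique {G H : ClosedSubgroup (Equiv.Perm ℕ)}
    {Γ : Set (Equiv.Perm ℕ × Equiv.Perm ℕ)} (h : IsIsoGraph G H Γ) (hΓ : IsClosed Γ)
    {x : Equiv.Perm ℕ} (hx : x ∈ G) : ∃! y, (x, y) ∈ Γ := by
  obtain ⟨y, hy⟩ := exists_mem_graph hΓ h.div h.one h.cont fun s hs => h.dense_fst s ⟨x, hx, hs⟩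
  refine ⟨y, hy, fun z hz => ?_⟩
  have h1 : y⁻¹ * z = 1 := by
    ext k
    by_contra hne
    obtain ⟨s, hs, hn⟩ := h.cont k
    refine hn ⟨_, h.div _ hy _ hz, ?_, hne⟩
    change x⁻¹ * x ∈ cylinder s
    rwa [inv_mul_cancel]
  exact (inv_mul_eq_one.1 h1).symm

lemma IsIsoGraph.exists_iso {G H : ClosedSubgroup (Equiv.Perm ℕ)}
    {Γ : Set (Equiv.Perm ℕ × Equiv.Perm ℕ)} (h : IsIsoGraph G H Γ) (hΓ : IsClosed Γ) :
    ∃ α : G ≃ₜ* H, (isoGraph α : Set (Equiv.Perm ℕ × Equiv.Perm ℕ)) = Γ := by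
  have hΓ' : IsClosed (Prod.swap ⁻¹' Γ) := hΓ.preimage continuous_swap
  have hinv : ∀ t ∈ Γ, t⁻¹ ∈ Γ := fun t ht => by simpa using h.div t ht 1 h.one
  have hmul : ∀ t ∈ Γ, ∀ u ∈ Γ, t * u ∈ Γ := fun t ht u hu => by
    simpa using h.div _ (hinv t ht) _ hu
  choose f hf hf' using fun x : G => h.existsUnique hΓ x.2
  choose g hg hg' using fun x : H => h.swap.existsUnique hΓ' x.2
  simp only at hf hf' hg hg'
  let e : G ≃* H :=
    { toFun := fun x => ⟨f x, h.snd _ (hf x)⟩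
      invFun := fun y => ⟨g y, h.fst _ (hg y)⟩
      left_inv := fun x => Subtype.ext (hg' ⟨f x, h.snd _ (hf x)⟩ x (hf x)).symm
      right_inv := fun y => Subtype.ext (hf' ⟨g y, h.fst _ (hg y)⟩ y (hg y)).symm
      map_mul' := fun x y => Subtype.ext (hf' (x * y) _ (hmul _ (hf x) _ (hf y))).symm }
  have hgr : ∀ x : G, ((x : Equiv.Perm ℕ), (e x : Equiv.Perm ℕ)) ∈ Γ := hf
  refine ⟨⟨e, ?_, ?_⟩, ?_⟩
  · refine continuous_hom_of_cylinder e.toMonoidHom fun k => ?_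
    obtain ⟨s, hs, hn⟩ := h.cont k
    refine ⟨s, hs, fun x hx => ?_⟩
    by_contra hne
    exact hn ⟨_, hgr x, hx, hne⟩
  · refine continuous_hom_of_cylinder e.symm.toMonoidHom fun k => ?_
    obtain ⟨s, hs, hn⟩ := h.cont_symm k
    refine ⟨s, hs, fun x hx => ?_⟩
    by_contra hne
    exact hn ⟨_, hg x, hne, hx⟩
  · ext ⟨x, y⟩
    constructor
    · rintro ⟨z, hz⟩
      rw [← hz]
      exact hgr z
    · intro hxy
      exact ⟨⟨x, h.fst _ hxy⟩, Prod.ext rfl (hf' ⟨x, h.fst _ hxy⟩ y hxy).symm⟩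

lemma isIsoGraph_isoGraph {G H : ClosedSubgroup (Equiv.Perm ℕ)} (α : G ≃ₜ* H) :
    IsIsoGraph G H (isoGraph α : Set (Equiv.Perm ℕ × Equiv.Perm ℕ)) where
  one := ⟨1, by simp⟩
  div := by
    rintro _ ⟨x, rfl⟩ _ ⟨y, rfl⟩
    exact ⟨x⁻¹ * y, by simp⟩
  fst := by
    rintro _ ⟨x, rfl⟩
    exact x.2
  snd := by
    rintro _ ⟨x, rfl⟩
    exact (α x).2
  dense_fst := by
    rintro s ⟨x, hx, hxs⟩
    exact ⟨_, ⟨⟨x, hx⟩, rfl⟩, hxs, trivial⟩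
  dense_snd := by
    rintro s ⟨y, hy, hys⟩
    refine ⟨_, ⟨α.symm ⟨y, hy⟩, rfl⟩, trivial, ?_⟩
    simpa using hys
  cont k := by
    obtain ⟨O, hO, hOe⟩ := (isClopen_apply_eq k k).isOpen.preimage
      (continuous_subtype_val.comp α.continuous)
    obtain ⟨s, hs, hsO⟩ := exists_cylinder hO
      (show (1 : G) ∈ Subtype.val ⁻¹' O by rw [hOe]; simp)
    refine ⟨s, hs, ?_⟩
    rintro ⟨_, ⟨x, rfl⟩, hx, hne⟩
    have : x ∈ Subtype.val ⁻¹' O := hsO hx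
    rw [hOe] at this
    exact hne this
  cont_symm k := by
    obtain ⟨O, hO, hOe⟩ := (isClopen_apply_eq k k).isOpen.preimage
      (continuous_subtype_val.comp α.symm.continuous)
    obtain ⟨s, hs, hsO⟩ := exists_cylinder hO
      (show (1 : H) ∈ Subtype.val ⁻¹' O by rw [hOe]; simp)
    refine ⟨s, hs, ?_⟩
    rintro ⟨_, ⟨x, rfl⟩, hne, hx⟩
    have : α x ∈ Subtype.val ⁻¹' O := hsO hx
    rw [hOe] at this
    have hx' : (α.symm (α x) : Equiv.Perm ℕ) k = k := this
    rw [α.symm_apply_apply] at hx'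
    exact hne hx'

/-- Since the groups and `Γ` are closed, quantifiers over `Γ` may be restricted to a dense sequence
depending on `Γ` in a Borel way; the other clauses only ask whether open sets are met. -/
lemma measurable_isIsoGraph : Measurable fun t : ClosedSubgroup (Equiv.Perm ℕ) ×
    ClosedSubgroup (Equiv.Perm ℕ) × Closeds (Equiv.Perm ℕ × Equiv.Perm ℕ) =>
      IsIsoGraph t.1 t.2.1 (t.2.2 : Set (Equiv.Perm ℕ × Equiv.Perm ℕ)) := by
  obtain ⟨d, hd, hdF⟩ := exists_dense_selectors (X := Equiv.Perm ℕ × Equiv.Perm ℕ)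
  have hiff : ∀ t : ClosedSubgroup (Equiv.Perm ℕ) ×
      ClosedSubgroup (Equiv.Perm ℕ) × Closeds (Equiv.Perm ℕ × Equiv.Perm ℕ),
      IsIsoGraph t.1 t.2.1 (t.2.2 : Set (Equiv.Perm ℕ × Equiv.Perm ℕ)) ↔
      1 ∈ t.2.2 ∧ (∀ n m, (d n t.2.2)⁻¹ * d m t.2.2 ∈ t.2.2) ∧ (∀ n, (d n t.2.2).1 ∈ t.1) ∧
      (∀ n, (d n t.2.2).2 ∈ t.2.1) ∧
      (∀ s, ((t.1 : Set (Equiv.Perm ℕ)) ∩ cylinder s).Nonempty →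
        ((t.2.2 : Set (Equiv.Perm ℕ × Equiv.Perm ℕ)) ∩ (cylinder s ×ˢ univ)).Nonempty) ∧
      (∀ s, ((t.2.1 : Set (Equiv.Perm ℕ)) ∩ cylinder s).Nonempty →
        ((t.2.2 : Set (Equiv.Perm ℕ × Equiv.Perm ℕ)) ∩ (univ ×ˢ cylinder s)).Nonempty) ∧
      (∀ k : ℕ, ∃ s, 1 ∈ cylinder s ∧ ¬ ((t.2.2 : Set (Equiv.Perm ℕ × Equiv.Perm ℕ)) ∩
        (cylinder s ×ˢ {y | y k ≠ k})).Nonempty) ∧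
      (∀ k : ℕ, ∃ s, 1 ∈ cylinder s ∧ ¬ ((t.2.2 : Set (Equiv.Perm ℕ × Equiv.Perm ℕ)) ∩
        ({y | y k ≠ k} ×ˢ cylinder s)).Nonempty) := by
    rintro ⟨G, H, Γ⟩
    constructor
    · intro h
      have hm := (hdF Γ ⟨1, h.one⟩).1
      exact ⟨h.one, fun n m => h.div _ (hm n) _ (hm m), fun n => h.fst _ (hm n),
        fun n => h.snd _ (hm n), h.dense_fst, h.dense_snd, h.cont, h.cont_symm⟩
    · rintro ⟨h1, h2, h3, h4, h5, h6, h7, h8⟩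
      have hcl := (hdF Γ ⟨1, h1⟩).2
      refine ⟨h1, fun x hx y hy => div_mem_of_dense Γ.isClosed hcl h2 hx hy, fun t ht => ?_,
        fun t ht => ?_, h5, h6, h7, h8⟩
      · have : closure (range fun n => d n Γ) ⊆ Prod.fst ⁻¹' (G : Set (Equiv.Perm ℕ)) :=
          closure_minimal (by rintro _ ⟨n, rfl⟩; exact h3 n) (G.isClosed'.preimage continuous_fst)
        exact this (hcl ht)
      · have : closure (range fun n => d n Γ) ⊆ Prod.snd ⁻¹' (H : Set (Equiv.Perm ℕ)) :=
          closure_minimal (by rintro _ ⟨n, rfl⟩; exact h4 n) (H.isClosed'.preimage continuous_snd)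
        exact this (hcl ht)
  simp only [hiff]
  have hΓ : Measurable fun t : ClosedSubgroup (Equiv.Perm ℕ) × ClosedSubgroup (Equiv.Perm ℕ) ×
    Closeds (Equiv.Perm ℕ × Equiv.Perm ℕ) => t.2.2 := measurable_snd.comp measurable_snd
  have hH : Measurable fun t : ClosedSubgroup (Equiv.Perm ℕ) × ClosedSubgroup (Equiv.Perm ℕ) ×
    Closeds (Equiv.Perm ℕ × Equiv.Perm ℕ) => t.2.1 := measurable_fst.comp measurable_snd
  have hdn := fun n => (hd n).comp hΓ
  have hcyl := fun s => (isClopen_cylinder s).isOpen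
  refine .and ?_ (.and ?_ (.and ?_ (.and ?_ (.and ?_ (.and ?_ (.and ?_ ?_))))))
  · exact measurable_mem_closeds.comp (measurable_const.prodMk hΓ)
  · exact .forall fun n => .forall fun m =>
      measurable_mem_closeds.comp (((hdn n).inv.mul (hdn m)).prodMk hΓ)
  · exact .forall fun n => measurable_mem_subgroup.comp
      ((measurable_fst.comp (hdn n)).prodMk measurable_fst)
  · exact .forall fun n => measurable_mem_subgroup.comp
      ((measurable_snd.comp (hdn n)).prodMk hH)
  · exact .forall fun s => ((measurable_subgroup_hit (hcyl s)).comp measurable_fst).imp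
      ((measurable_hit ((hcyl s).prod isOpen_univ)).comp hΓ)
  · exact .forall fun s => ((measurable_subgroup_hit (hcyl s)).comp hH).imp
      ((measurable_hit (isOpen_univ.prod (hcyl s))).comp hΓ)
  · exact .forall fun k => .exists fun s => measurable_const.and
      ((measurable_hit ((hcyl s).prod (isClopen_apply_eq k k).compl.isOpen)).comp hΓ).not
  · exact .forall fun k => .exists fun s => measurable_const.and
      ((measurable_hit ((isClopen_apply_eq k k).compl.isOpen.prod (hcyl s))).comp hΓ).not

theorem isBorelCategory_grCat (hGr : MeasurableSet Gr) : IsBorelCategory (GrCat Gr) where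
  objects := standardBorelSpace_grCat hGr
  morphisms := by
    have h1 := standardBorelSpace_grCat hGr
    have h2 : StandardBorelSpace (Closeds (Equiv.Perm ℕ × Equiv.Perm ℕ)) :=
      standardBorelSpace_closeds
    refine standardBorelSpace_of_injective (f := fun f : Arrow (GrCat Gr) =>
      ((f.left : GrCat Gr), (f.right : GrCat Gr), arrowGraph f)) ?_ rfl ?_
    · rintro ⟨X, Y, f⟩ ⟨X', Y', f'⟩ h
      obtain ⟨rfl, h'⟩ := Prod.mk.inj h
      obtain ⟨rfl, h''⟩ := Prod.mk.inj h'
      have : f = f' := by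
        refine ContinuousMulEquiv.ext fun x => Subtype.ext ?_
        have hx : ((x : Equiv.Perm ℕ), app (Arrow.mk f) x) ∈ arrowGraph (Arrow.mk f) :=
          (mem_arrowGraph _ _).2 ⟨x.2, rfl⟩
        have hx' : ((x : Equiv.Perm ℕ), app (Arrow.mk f) x) ∈ arrowGraph (Arrow.mk f') := h'' ▸ hx
        have := ((mem_arrowGraph _ _).1 hx').2
        rw [app_of_mem (Arrow.mk f) x.2, app_of_mem (Arrow.mk f') x.2] at this
        exact this.symm
      rw [this]
    · have : range (fun f : Arrow (GrCat Gr) =>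
          ((f.left : GrCat Gr), (f.right : GrCat Gr), arrowGraph f)) =
          {t | IsIsoGraph t.1.grp t.2.1.grp (t.2.2 : Set (Equiv.Perm ℕ × Equiv.Perm ℕ))} := by
        ext ⟨X, Y, Γ⟩
        constructor
        · rintro ⟨f, hf⟩
          rw [← hf]
          exact isIsoGraph_isoGraph _
        · intro h
          obtain ⟨α, hα⟩ := h.exists_iso Γ.isClosed
          refine ⟨Arrow.mk (show X ⟶ Y from α), ?_⟩
          have : arrowGraph (Arrow.mk (show X ⟶ Y from α)) = Γ := SetLike.coe_injective hα
          exact Prod.ext rfl (Prod.ext rfl this)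
      rw [this]
      exact measurableSet_setOfPred.2 (measurable_isIsoGraph.comp
        ((measurable_grp.comp measurable_fst).prodMk
          ((measurable_grp.comp (measurable_fst.comp measurable_snd)).prodMk
            (measurable_snd.comp measurable_snd))))
  dom := measurable_arrow_left
  cod := measurable_arrow_right
  ident := measurable_ident
  comp := by
    have h1 := standardBorelSpace_grCat hGr
    simp only [arrow_comp_iff]
    have m1 : Measurable fun t : Arrow (GrCat Gr) × Arrow (GrCat Gr) × Arrow (GrCat Gr) => t.1 :=
      measurable_fst
    have m2 : Measurable fun t : Arrow (GrCat Gr) × Arrow (GrCat Gr) × Arrow (GrCat Gr) =>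
      t.2.1 := measurable_fst.comp measurable_snd
    have m3 : Measurable fun t : Arrow (GrCat Gr) × Arrow (GrCat Gr) × Arrow (GrCat Gr) =>
      t.2.2 := measurable_snd.comp measurable_snd
    have md := fun n => (measurable_dense n).comp (measurable_grp.comp
      (measurable_arrow_left.comp m1))
    refine (measurableSet_eq_fun (measurable_arrow_right.comp m1)
      (measurable_arrow_left.comp m2)).inter
      ((measurableSet_eq_fun (measurable_arrow_left.comp m3) (measurable_arrow_left.comp m1)).inter
      ((measurableSet_eq_fun (measurable_arrow_right.comp m3)
        (measurable_arrow_right.comp m2)).inter ?_))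
    refine measurableSet_setOfPred.2 (.forall fun n => measurableSet_setOfPred.1
      (measurableSet_eq_fun (measurable_app.comp (m3.prodMk (md n)))
        (measurable_app.comp (m2.prodMk (measurable_app.comp (m1.prodMk (md n)))))))

end BorelDuality

namespace BorelDuality

/-! ### Full meet groupoids -/

namespace MGOps

variable {M : Type} {s : MGOps M}

/-- The source `A⁻¹ · A` of an element. -/
def src (s : MGOps M) (A : M) : M := (s.mul (s.inv A) A).getD s.bot

/-- The target `A · A⁻¹` of an element. -/
def tgt (s : MGOps M) (A : M) : M := (s.mul A (s.inv A)).getD s.bot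

namespace IsMeetGroupoid

variable (h : s.IsMeetGroupoid)
include h

lemma assoc_some {A B C X Y : M} (hX : s.mul A B = some X) (hY : s.mul B C = some Y) :
    s.mul X C = s.mul A Y := by
  have := h.assoc A B C
  rwa [hX, hY, Option.bind_some, Option.bind_some] at this

lemma assoc_left {A B C X Z : M} (hX : s.mul A B = some X) (hZ : s.mul X C = some Z) :
    ∃ Y, s.mul B C = some Y ∧ s.mul A Y = some Z := by
  have := h.assoc A B C
  rw [hX, Option.bind_some, hZ, eq_comm, Option.bind_eq_some_iff] at this
  exact this

lemma assoc_right {A B C Y Z : M} (hY : s.mul B C = some Y) (hZ : s.mul A Y = some Z) :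
    ∃ X, s.mul A B = some X ∧ s.mul X C = some Z := by
  have := h.assoc A B C
  rw [hY, Option.bind_some, hZ, Option.bind_eq_some_iff] at this
  exact this

lemma inv_mul (A : M) : s.mul (s.inv A) A = some (s.src A) := by
  obtain ⟨X, hX⟩ := Option.isSome_iff_exists.1 (h.inv_mul_defined A)
  rw [src, hX, Option.getD_some]

lemma mul_inv (A : M) : s.mul A (s.inv A) = some (s.tgt A) := by
  obtain ⟨X, hX⟩ := Option.isSome_iff_exists.1 (h.mul_inv_defined A)
  rw [tgt, hX, Option.getD_some]

lemma mul_src (A : M) : s.mul A (s.src A) = some A := by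
  have h1 := h.cancel_right _ _ _ (h.mul_inv A)
  -- Here `Y` is `A⁻¹ · (A⁻¹)⁻¹` and satisfies `A · Y = A`; left cancellation identifies it with
  -- `A⁻¹ · A`.
  obtain ⟨Y, hY, hAY⟩ := h.assoc_left (h.mul_inv A) h1
  have h2 := h.cancel_left _ _ _ hAY
  rw [h.inv_mul A, Option.some_inj] at h2
  rwa [h2]

lemma inv_inv (A : M) : s.inv (s.inv A) = A := by
  have h1 := h.cancel_right _ _ _ (h.mul_inv A)
  obtain ⟨Y, hY, hAY⟩ := h.assoc_left (h.mul_inv A) h1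
  have h2 := h.cancel_left _ _ _ hAY
  rw [h.inv_mul A, Option.some_inj] at h2
  subst h2
  have h3 := h.cancel_left _ _ _ hY
  rw [h.cancel_left _ _ _ (h.inv_mul A), Option.some_inj] at h3
  exact h3.symm

lemma src_inv (A : M) : s.src (s.inv A) = s.tgt A := by
  rw [src, tgt, h.inv_inv]

lemma tgt_inv (A : M) : s.tgt (s.inv A) = s.src A := by
  rw [src, tgt, h.inv_inv]

lemma tgt_mul (A : M) : s.mul (s.tgt A) A = some A := by
  have := h.cancel_right _ _ _ (h.mul_inv A)
  rwa [h.inv_inv] at this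

lemma src_eq_of_mul {A U : M} (hU : s.mul A U = some A) : s.src A = U := by
  have := h.cancel_left _ _ _ hU
  rwa [h.inv_mul, Option.some_inj] at this

lemma tgt_eq_of_mul {A U : M} (hU : s.mul U A = some A) : s.tgt A = U := by
  have := h.cancel_right _ _ _ hU
  rwa [h.mul_inv, Option.some_inj] at this

lemma src_mul_src (A : M) : s.mul (s.src A) (s.src A) = some (s.src A) := by
  rw [h.assoc_some (h.inv_mul A) (h.mul_src A), h.inv_mul]

lemma src_src (A : M) : s.src (s.src A) = s.src A := h.src_eq_of_mul (h.src_mul_src A)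

lemma tgt_src (A : M) : s.tgt (s.src A) = s.src A := h.tgt_eq_of_mul (h.src_mul_src A)

/-- Both sides are the idempotent `B · B⁻¹`, because `A · B · B⁻¹ = A`. Together with `exists_mul`
this shows that definedness of products is governed by sources and targets, as in a category. -/
lemma src_of_mul {A B C : M} (hC : s.mul A B = some C) : s.src A = s.tgt B := by
  have h1 := h.cancel_right _ _ _ hC
  obtain ⟨Y, hY, hAY⟩ := h.assoc_left hC h1
  rw [h.mul_inv, Option.some_inj] at hY
  rw [hY]
  exact h.src_eq_of_mul hAY

lemma exists_mul {A B : M} (hAB : s.src A = s.tgt B) : ∃ C, s.mul A B = some C := by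
  have h1 := h.mul_src A
  rw [hAB] at h1
  obtain ⟨X, hX, -⟩ := h.assoc_right (h.mul_inv B) h1
  exact ⟨X, hX⟩

lemma src_mul {A B C : M} (hC : s.mul A B = some C) : s.src C = s.src B := by
  refine h.src_eq_of_mul ?_
  rw [h.assoc_some hC (h.mul_src B), hC]

lemma tgt_of_mul {A B C : M} (hC : s.mul A B = some C) : s.tgt C = s.tgt A := by
  refine h.tgt_eq_of_mul ?_
  rw [← h.assoc_some (h.tgt_mul A) hC, hC]

lemma src_bot : s.src s.bot = s.bot := h.src_eq_of_mul h.bot_mul_bot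

lemma src_eq_bot {A : M} : s.src A = s.bot ↔ A = s.bot := by
  constructor
  · intro hA
    by_contra hne
    have := h.mul_src A
    rw [hA, h.mul_bot A hne] at this
    cases this
  · rintro rfl
    exact h.src_bot

lemma inv_eq_bot {A : M} : s.inv A = s.bot ↔ A = s.bot := by
  constructor
  · intro hA
    rw [← h.inv_inv A, hA, h.inv_bot]
  · rintro rfl
    exact h.inv_bot

lemma tgt_eq_bot {A : M} : s.tgt A = s.bot ↔ A = s.bot := by
  rw [← h.src_inv, h.src_eq_bot, h.inv_eq_bot]

lemma isIdem_src {A : M} (hA : A ≠ s.bot) : s.IsIdem (s.src A) :=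
  ⟨fun h' => hA (h.src_eq_bot.1 h'), h.src_mul_src A⟩

lemma isIdem_tgt {A : M} (hA : A ≠ s.bot) : s.IsIdem (s.tgt A) :=
  h.src_inv A ▸ h.isIdem_src fun h' => hA (h.inv_eq_bot.1 h')

lemma src_of_isIdem {U : M} (hU : s.IsIdem U) : s.src U = U := h.src_eq_of_mul hU.2

lemma tgt_of_isIdem {U : M} (hU : s.IsIdem U) : s.tgt U = U := h.tgt_eq_of_mul hU.2

lemma le_refl (A : M) : s.Le A A := h.inf_idem A

lemma le_trans {A B C : M} (h1 : s.Le A B) (h2 : s.Le B C) : s.Le A C := by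
  unfold Le at *
  rw [← h1, h.inf_assoc, h2]

lemma le_antisymm {A B : M} (h1 : s.Le A B) (h2 : s.Le B A) : A = B := by
  unfold Le at *
  rw [← h1, h.inf_comm, h2]

lemma inf_le_left (A B : M) : s.Le (s.inf A B) A := by
  unfold Le
  rw [h.inf_comm, ← h.inf_assoc, h.inf_idem]

lemma inf_le_right (A B : M) : s.Le (s.inf A B) B := by
  rw [h.inf_comm]
  exact h.inf_le_left B A

lemma le_inf {A B C : M} (h1 : s.Le C A) (h2 : s.Le C B) : s.Le C (s.inf A B) := by
  unfold Le at *
  rw [← h.inf_assoc, h1, h2]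

lemma le_bot {A : M} (hA : s.Le A s.bot) : A = s.bot := h.le_antisymm hA (h.bot_le A)

lemma ne_bot_of_le {A B : M} (hAB : s.Le A B) (hA : A ≠ s.bot) : B ≠ s.bot := by
  rintro rfl
  exact hA (h.le_bot hAB)

lemma inv_inf (A B : M) : s.inv (s.inf A B) = s.inf (s.inv A) (s.inv B) := by
  refine h.le_antisymm (h.le_inf ((h.inv_le_inv _ _).1 (h.inf_le_left A B))
    ((h.inv_le_inv _ _).1 (h.inf_le_right A B))) ?_
  rw [h.inv_le_inv, h.inv_inv]
  refine h.le_inf ?_ ?_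
  · rw [h.inv_le_inv, h.inv_inv]
    exact h.inf_le_left _ _
  · rw [h.inv_le_inv, h.inv_inv]
    exact h.inf_le_right _ _

/-- The axiom on products of meets, applied to `A⁻¹ · A` and `B⁻¹ · B`. -/
lemma src_inf {A B : M} (hAB : s.inf A B ≠ s.bot) :
    s.src (s.inf A B) = s.inf (s.src A) (s.src B) := by
  have h1 := h.inf_mul_inf _ _ _ _ _ _ (h.inv_mul A) (h.inv_mul B)
    (by rw [← h.inv_inf]; exact fun h' => hAB (h.inv_eq_bot.1 h')) hAB
  rwa [← h.inv_inf, h.inv_mul, Option.some_inj] at h1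

lemma src_le_src {A B : M} (hA : A ≠ s.bot) (hAB : s.Le A B) : s.Le (s.src A) (s.src B) := by
  have := h.src_inf (A := A) (B := B) (by rw [hAB]; exact hA)
  rw [hAB] at this
  exact this.symm

lemma isIdem_inf {U V : M} (hU : s.IsIdem U) (hV : s.IsIdem V) : s.IsIdem (s.inf U V) :=
  ⟨h.idem_inf U V hU hV, h.inf_mul_inf _ _ _ _ _ _ hU.2 hV.2 (h.idem_inf U V hU hV)
    (h.idem_inf U V hU hV)⟩

end IsMeetGroupoid

namespace IsFull

variable (h : s.IsFull)
include h

/-- Two elements with the same source which have a common nonempty lower bound are equal. -/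
lemma eq_of_src_eq {A B C : M} (hC : C ≠ s.bot) (hCA : s.Le C A) (hCB : s.Le C B)
    (hAB : s.src A = s.src B) : A = B := by
  have hA := h.ne_bot_of_le hCA hC
  refine (h.up_left (s.src C) (s.src A) C (h.isIdem_src hC) (h.isIdem_src hA)
    (h.src_le_src hC hCA) (h.mul_src C)).unique ⟨h.mul_src A, hCA⟩ ⟨?_, hCB⟩
  rw [hAB]
  exact h.mul_src B

lemma exists_ge_src {A V : M} (hA : A ≠ s.bot) (hV : s.IsIdem V) (hAV : s.Le (s.src A) V) :
    ∃ B, s.src B = V ∧ s.Le A B := by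
  obtain ⟨B, ⟨hB, hAB⟩, -⟩ := h.up_left (s.src A) V A (h.isIdem_src hA) hV hAV (h.mul_src A)
  exact ⟨B, h.src_eq_of_mul hB, hAB⟩

lemma exists_ge_tgt {A V : M} (hA : A ≠ s.bot) (hV : s.IsIdem V) (hAV : s.Le (s.tgt A) V) :
    ∃ B, s.tgt B = V ∧ s.Le A B := by
  obtain ⟨B, ⟨hB, hAB⟩, -⟩ := h.up_right (s.tgt A) V A (h.isIdem_tgt hA) hV hAV (h.tgt_mul A)
  exact ⟨B, h.tgt_eq_of_mul hB, hAB⟩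

lemma exists_le_src {A U : M} (hA : A ≠ s.bot) (hU : s.IsIdem U) (hUA : s.Le U (s.src A)) :
    ∃ B, s.src B = U ∧ s.Le B A := by
  by_cases hne : U = s.src A
  · exact ⟨A, hne.symm, h.le_refl A⟩
  · obtain ⟨B, -, -, hB, -, hBA, -⟩ := h.down_left U (s.src A) A hU (h.isIdem_src hA) hUA hne
      (h.mul_src A)
    exact ⟨B, h.src_eq_of_mul hB, hBA⟩

lemma exists_le_tgt {A U : M} (hA : A ≠ s.bot) (hU : s.IsIdem U) (hUA : s.Le U (s.tgt A)) :
    ∃ B, s.tgt B = U ∧ s.Le B A := by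
  by_cases hne : U = s.tgt A
  · exact ⟨A, hne.symm, h.le_refl A⟩
  · obtain ⟨B, -, -, hB, -, hBA, -⟩ := h.down_right U (s.tgt A) A hU (h.isIdem_tgt hA) hUA hne
      (h.tgt_mul A)
    exact ⟨B, h.tgt_eq_of_mul hB, hBA⟩

/-- Below every nonempty element there is one with small source and target. -/
lemma exists_le_src_tgt {A U : M} (hA : A ≠ s.bot) (hU : s.IsIdem U) :
    ∃ B, B ≠ s.bot ∧ s.Le B A ∧ s.Le (s.src B) U ∧ s.Le (s.tgt B) U := by
  have hU1 := h.isIdem_inf hU (h.isIdem_src hA)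
  obtain ⟨B, hB, hBA⟩ := h.exists_le_src hA hU1 (h.inf_le_right _ _)
  have hB0 : B ≠ s.bot := fun h' => hU1.1 (hB ▸ h.src_eq_bot.2 h')
  have hU2 := h.isIdem_inf hU (h.isIdem_tgt hB0)
  obtain ⟨C, hC, hCB⟩ := h.exists_le_tgt hB0 hU2 (h.inf_le_right _ _)
  have hC0 : C ≠ s.bot := fun h' => hU2.1 (hC ▸ h.tgt_eq_bot.2 h')
  refine ⟨C, hC0, h.le_trans hCB hBA, h.le_trans (h.src_le_src hC0 hCB) ?_, ?_⟩
  · rw [hB]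
    exact h.inf_le_left _ _
  · rw [hC]
    exact h.inf_le_left _ _

end IsFull

/-- A full filter: it contains one left and one right *coset of every nonempty idempotent. -/
structure IsFullFilter (s : MGOps M) (R : Set M) : Prop where
  bot : s.bot ∉ R
  inf : ∀ A ∈ R, ∀ B ∈ R, s.inf A B ∈ R
  src : ∀ U, s.IsIdem U → ∃ A ∈ R, s.src A = U
  tgt : ∀ U, s.IsIdem U → ∃ A ∈ R, s.tgt A = U

/-- Countability permits a generic construction: a descending sequence below `A` whose step `n`
brings source and target below the `n`-th element of `M`, if that is an idempotent. The upward
closure of the sequence is the filter. -/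
lemma IsFull.exists_isFullFilter [Countable M] (h : s.IsFull) {A : M} (hA : A ≠ s.bot) :
    ∃ R, s.IsFullFilter R ∧ A ∈ R := by
  have : Nonempty M := ⟨A⟩
  obtain ⟨e, he⟩ := exists_surjective_nat M
  have hstep : ∀ (n : ℕ) (B : M), ∃ C, B ≠ s.bot → C ≠ s.bot ∧ s.Le C B ∧
      (s.IsIdem (e n) → s.Le (s.src C) (e n) ∧ s.Le (s.tgt C) (e n)) := by
    intro n B
    by_cases hU : s.IsIdem (e n)
    · by_cases hB : B = s.bot
      · exact ⟨B, fun h' => (h' hB).elim⟩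
      · obtain ⟨C, h1, h2, h3, h4⟩ := h.exists_le_src_tgt hB hU
        exact ⟨C, fun _ => ⟨h1, h2, fun _ => ⟨h3, h4⟩⟩⟩
    · exact ⟨B, fun h' => ⟨h', h.le_refl B, fun h'' => (hU h'').elim⟩⟩
  choose next hnext using hstep
  let a : ℕ → M := fun n => Nat.rec A next n
  have ha0 : ∀ n, a n ≠ s.bot := by
    intro n
    induction n with
    | zero => exact hA
    | succ n ih => exact (hnext n (a n) ih).1
  have hanti : ∀ n m, n ≤ m → s.Le (a m) (a n) := by
    intro n m hnm
    induction m, hnm using Nat.le_induction with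
    | base => exact h.le_refl _
    | succ m _ ih => exact h.le_trans (hnext m (a m) (ha0 m)).2.1 ih
  refine ⟨{B | ∃ n, s.Le (a n) B}, ⟨?_, ?_, ?_, ?_⟩, 0, h.le_refl A⟩
  · rintro ⟨n, hn⟩
    exact ha0 n (h.le_bot hn)
  · rintro B ⟨n, hn⟩ C ⟨m, hm⟩
    exact ⟨max n m, h.le_inf (h.le_trans (hanti _ _ (le_max_left n m)) hn)
      (h.le_trans (hanti _ _ (le_max_right n m)) hm)⟩
  · intro U hU
    obtain ⟨n, rfl⟩ := he U
    obtain ⟨B, hB, hB'⟩ := h.exists_ge_src (ha0 (n + 1)) hU ((hnext n (a n) (ha0 n)).2.2 hU).1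
    exact ⟨B, ⟨n + 1, hB'⟩, hB⟩
  · intro U hU
    obtain ⟨n, rfl⟩ := he U
    obtain ⟨B, hB, hB'⟩ := h.exists_ge_tgt (ha0 (n + 1)) hU ((hnext n (a n) (ha0 n)).2.2 hU).2
    exact ⟨B, ⟨n + 1, hB'⟩, hB⟩

/-- Left multiplication by the inverse filter will undo left multiplication by `R`. -/
lemma IsFullFilter.inv {R : Set M} (h : s.IsFull) (hR : s.IsFullFilter R) :
    s.IsFullFilter {A | s.inv A ∈ R} where
  bot := by
    rw [mem_ofPred_eq, h.inv_bot]
    exact hR.bot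
  inf A hA B hB := by
    rw [mem_ofPred_eq, h.inv_inf]
    exact hR.inf _ hA _ hB
  src U hU := by
    obtain ⟨A, hA, hAU⟩ := hR.tgt U hU
    exact ⟨s.inv A, by rwa [mem_ofPred_eq, h.inv_inv], by rwa [h.src_inv]⟩
  tgt U hU := by
    obtain ⟨A, hA, hAU⟩ := hR.src U hU
    exact ⟨s.inv A, by rwa [mem_ofPred_eq, h.inv_inv], by rwa [h.tgt_inv]⟩

lemma IsFullFilter.eq_of_src_eq {R : Set M} (h : s.IsFull) (hR : s.IsFullFilter R) {A B : M}
    (hA : A ∈ R) (hB : B ∈ R) (hAB : s.src A = s.src B) : A = B :=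
  h.eq_of_src_eq (fun h' => hR.bot (h' ▸ hR.inf A hA B hB)) (h.inf_le_left A B)
    (h.inf_le_right A B) hAB

lemma IsFullFilter.exists_mul {R : Set M} (h : s.IsFull) (hR : s.IsFullFilter R) (B : M) :
    ∃ C, (B = s.bot → C = s.bot) ∧ (B ≠ s.bot → ∃ A ∈ R, s.mul A B = some C) := by
  by_cases hB : B = s.bot
  · exact ⟨s.bot, fun _ => rfl, fun h' => (h' hB).elim⟩
  · obtain ⟨A, hA, hAB⟩ := hR.src _ (h.isIdem_tgt hB)
    obtain ⟨C, hC⟩ := h.exists_mul hAB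
    exact ⟨C, fun h' => (hB h').elim, fun _ => ⟨A, hA, hC⟩⟩

/-- The filter acts by left multiplication: `B ≠ ∅` goes to `A · B`, where `A` is the only member of
`R` composable with `B`, and `∅` is fixed. -/
lemma IsFullFilter.exists_leftAut {R : Set M} (h : s.IsFull) (hR : s.IsFullFilter R) :
    ∃ p ∈ s.leftAut, ∀ A ∈ R, p (s.src A) = A := by
  choose f hf0 hf using hR.exists_mul h
  choose g hg0 hg using (hR.inv h).exists_mul h
  have hfne : ∀ B, B ≠ s.bot → f B ≠ s.bot := by
    intro B hB h0
    obtain ⟨A, hA, hC⟩ := hf B hB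
    have := h.src_mul hC
    rw [h0, h.src_bot, eq_comm, h.src_eq_bot] at this
    exact hB this
  have hgne : ∀ B, B ≠ s.bot → g B ≠ s.bot := by
    intro B hB h0
    obtain ⟨A, hA, hC⟩ := hg B hB
    have := h.src_mul hC
    rw [h0, h.src_bot, eq_comm, h.src_eq_bot] at this
    exact hB this
  have hgf : ∀ B, g (f B) = B := by
    intro B
    by_cases hB : B = s.bot
    · rw [hf0 B hB, hg0 _ rfl, hB]
    · obtain ⟨A, hA, hC⟩ := hf B hB
      obtain ⟨A', hA', hC'⟩ := hg (f B) (hfne B hB)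
      have h1 : s.src A' = s.src (s.inv A) := by
        rw [h.src_of_mul hC', h.tgt_of_mul hC, h.src_inv]
      have h2 := (hR.inv h).eq_of_src_eq h hA' (by rwa [mem_ofPred_eq, h.inv_inv]) h1
      rw [h2, h.cancel_left _ _ _ hC, Option.some_inj] at hC'
      exact hC'.symm
  have hfg : ∀ B, f (g B) = B := by
    intro B
    by_cases hB : B = s.bot
    · rw [hg0 B hB, hf0 _ rfl, hB]
    · obtain ⟨A, hA, hC⟩ := hg B hB
      obtain ⟨A', hA', hC'⟩ := hf (g B) (hgne B hB)
      have h1 : s.src A' = s.src (s.inv A) := by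
        rw [h.src_of_mul hC', h.tgt_of_mul hC, h.src_inv]
      have h2 := hR.eq_of_src_eq h hA' hA h1
      rw [h2, h.cancel_left _ _ _ hC, Option.some_inj] at hC'
      exact hC'.symm
  -- Stated for an arbitrary full filter because it is also needed for the inverse filter.
  have key : ∀ {R : Set M}, s.IsFullFilter R → ∀ {f : M → M},
      (∀ B, B ≠ s.bot → ∃ A ∈ R, s.mul A B = some (f B)) →
      ∀ B B', s.inf B B' ≠ s.bot → f (s.inf B B') = s.inf (f B) (f B') := by
    intro R hR f hf B B' hD
    obtain ⟨A, hA, hC⟩ := hf B (h.ne_bot_of_le (h.inf_le_left B B') hD)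
    obtain ⟨A', hA', hC'⟩ := hf B' (h.ne_bot_of_le (h.inf_le_right B B') hD)
    obtain ⟨A'', hA'', hC''⟩ := hf _ hD
    have h1 := h.inf_mul_inf _ _ _ _ _ _ hC hC' (fun h' => hR.bot (h' ▸ hR.inf A hA A' hA')) hD
    have h2 := hR.eq_of_src_eq h (hR.inf A hA A' hA') hA''
      (by rw [h.src_of_mul h1, h.src_of_mul hC''])
    rw [h2, hC'', Option.some_inj] at h1
    exact h1
  have hinf : ∀ B B', f (s.inf B B') = s.inf (f B) (f B') := by
    intro B B'
    by_cases hD : s.inf B B' = s.bot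
    · rw [hf0 _ hD]
      -- If the images had a nonempty meet, the inverse map would send it to the meet of `B` and
      -- `B'`, which is empty.
      by_contra hne
      have h1 := key (hR.inv h) hg (f B) (f B') (Ne.symm hne)
      rw [hgf, hgf, hD] at h1
      exact hgne _ (Ne.symm hne) h1
    · exact key hR hf B B' hD
  refine ⟨⟨f, g, hgf, hfg⟩, ⟨hinf, fun B C => ?_⟩, fun A hA => ?_⟩
  · change s.mul (f B) C = (s.mul B C).map f
    by_cases hB : B = s.bot
    · rw [hf0 B hB, hB]
      by_cases hC : C = s.bot
      · rw [hC, h.bot_mul_bot, Option.map_some, hf0 _ rfl]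
      · rw [h.bot_mul C hC, Option.map_none]
    · obtain ⟨A, hA, hfB⟩ := hf B hB
      cases hD : s.mul B C with
      | none =>
        rw [Option.map_none]
        by_contra hne
        obtain ⟨E, hE⟩ := Option.ne_none_iff_exists'.1 hne
        obtain ⟨Y, hY, -⟩ := h.assoc_left hfB hE
        rw [hD] at hY
        cases hY
      | some D =>
        have hD0 : D ≠ s.bot := fun h' => hB (h.tgt_eq_bot.1 (by
          rw [← h.tgt_of_mul hD, h', h.tgt_eq_bot]))
        obtain ⟨A', hA', hfD⟩ := hf D hD0
        have h1 := hR.eq_of_src_eq h hA hA' (by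
          rw [h.src_of_mul hfB, h.src_of_mul hfD, h.tgt_of_mul hD])
        rw [Option.map_some, h.assoc_some hfB hD, h1, hfD]
  · change f (s.src A) = A
    have hA0 : A ≠ s.bot := fun h' => hR.bot (h' ▸ hA)
    obtain ⟨A', hA', hC⟩ := hf (s.src A) (h.isIdem_src hA0).1
    have h1 := hR.eq_of_src_eq h hA' hA (by rw [h.src_of_mul hC, h.tgt_src])
    rw [h1, h.mul_src, Option.some_inj] at hC
    exact hC.symm

/-- For every nonempty `A` there is a left automorphism mapping the idempotent `A⁻¹ · A` to `A`. -/
theorem IsFull.exists_leftAut [Countable M] (h : s.IsFull) {A : M} (hA : A ≠ s.bot) :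
    ∃ p ∈ s.leftAut, p (s.src A) = A := by
  obtain ⟨R, hR, hAR⟩ := h.exists_isFullFilter hA
  obtain ⟨p, hp, hpR⟩ := hR.exists_leftAut h
  exact ⟨p, hp, hpR A hAR⟩

/-! ### Elementary properties of left automorphisms -/

section LeftAut

variable {p : Equiv.Perm M} (h : s.IsMeetGroupoid) (hp : p ∈ s.leftAut)

include hp in
lemma leftAut_le {A B : M} (hAB : s.Le A B) : s.Le (p A) (p B) := by
  rw [Le, ← hp.1, hAB]

include hp in
lemma leftAut_mul {A B C : M} (hC : s.mul A B = some C) : s.mul (p A) B = some (p C) := by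
  rw [hp.2, hC, Option.map_some]

include h hp

lemma leftAut_bot : p s.bot = s.bot := by
  have h1 := leftAut_le hp (h.bot_le (p⁻¹ s.bot))
  refine h.le_bot ?_
  have h2 : p (p⁻¹ s.bot) = s.bot := p.apply_symm_apply _
  rwa [h2] at h1

lemma leftAut_ne_bot {A : M} (hA : A ≠ s.bot) : p A ≠ s.bot := fun h' =>
  hA (p.injective (h'.trans (leftAut_bot h hp).symm))

lemma leftAut_src (A : M) : s.src (p A) = s.src A :=
  h.src_eq_of_mul (leftAut_mul hp (h.mul_src A))

lemma leftAut_tgt (A : M) : s.mul (p (s.tgt A)) A = some (p A) := leftAut_mul hp (h.tgt_mul A)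

end LeftAut

end MGOps

end BorelDuality

namespace BorelDuality

/-! ### Cosets -/

section Cosets

variable {G : Type} [Group G] {U V : Subgroup G} {A B : Set G}

lemma isLeftCoset_iff : IsLeftCoset U A ↔ ∃ g, ∀ x, x ∈ A ↔ g⁻¹ * x ∈ U := by
  refine exists_congr fun g => ?_
  rw [Set.ext_iff]
  refine forall_congr' fun x => iff_congr Iff.rfl ?_
  exact ⟨by rintro ⟨u, hu, rfl⟩; simpa using hu, fun h => ⟨_, h, by simp⟩⟩

lemma isRightCoset_iff : IsRightCoset U A ↔ ∃ g, ∀ x, x ∈ A ↔ x * g⁻¹ ∈ U := by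
  refine exists_congr fun g => ?_
  rw [Set.ext_iff]
  refine forall_congr' fun x => iff_congr Iff.rfl ?_
  exact ⟨by rintro ⟨u, hu, rfl⟩; simpa using hu, fun h => ⟨_, h, by simp⟩⟩

lemma isLeftCoset_iff_forall :
    IsLeftCoset U A ↔ A.Nonempty ∧ ∀ g ∈ A, ∀ x, x ∈ A ↔ g⁻¹ * x ∈ U := by
  rw [isLeftCoset_iff]
  constructor
  · rintro ⟨g, hg⟩
    refine ⟨⟨g, by simp [hg]⟩, fun y hy x => ?_⟩
    rw [hg] at hy ⊢
    have h1 : y⁻¹ * x = (g⁻¹ * y)⁻¹ * (g⁻¹ * x) := by group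
    rw [h1, U.mul_mem_cancel_left (U.inv_mem hy)]
  · rintro ⟨⟨g, hg⟩, h⟩
    exact ⟨g, h g hg⟩

lemma isRightCoset_iff_forall :
    IsRightCoset U A ↔ A.Nonempty ∧ ∀ g ∈ A, ∀ x, x ∈ A ↔ x * g⁻¹ ∈ U := by
  rw [isRightCoset_iff]
  constructor
  · rintro ⟨g, hg⟩
    refine ⟨⟨g, by simp [hg]⟩, fun y hy x => ?_⟩
    rw [hg] at hy ⊢
    have h1 : x * y⁻¹ = (x * g⁻¹) * (y * g⁻¹)⁻¹ := by group
    rw [h1, U.mul_mem_cancel_right (U.inv_mem hy)]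
  · rintro ⟨⟨g, hg⟩, h⟩
    exact ⟨g, h g hg⟩

lemma IsLeftCoset.nonempty (h : IsLeftCoset U A) : A.Nonempty := (isLeftCoset_iff_forall.1 h).1

lemma IsRightCoset.nonempty (h : IsRightCoset U A) : A.Nonempty := (isRightCoset_iff_forall.1 h).1

lemma IsLeftCoset.mem_iff (h : IsLeftCoset U A) {g : G} (hg : g ∈ A) (x : G) :
    x ∈ A ↔ g⁻¹ * x ∈ U := (isLeftCoset_iff_forall.1 h).2 g hg x

lemma IsRightCoset.mem_iff (h : IsRightCoset U A) {g : G} (hg : g ∈ A) (x : G) :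
    x ∈ A ↔ x * g⁻¹ ∈ U := (isRightCoset_iff_forall.1 h).2 g hg x

/-- The subgroup is recovered as `g⁻¹ A` for any `g` in `A`. -/
lemma IsLeftCoset.subgroup_unique (h : IsLeftCoset U A) (h' : IsLeftCoset V A) : U = V := by
  obtain ⟨g, hg⟩ := h.nonempty
  ext x
  have h1 := h.mem_iff hg (g * x)
  have h2 := h'.mem_iff hg (g * x)
  rw [inv_mul_cancel_left] at h1 h2
  rw [← h1, h2]

lemma IsRightCoset.subgroup_unique (h : IsRightCoset U A) (h' : IsRightCoset V A) : U = V := by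
  obtain ⟨g, hg⟩ := h.nonempty
  ext x
  have h1 := h.mem_iff hg (x * g)
  have h2 := h'.mem_iff hg (x * g)
  rw [mul_inv_cancel_right] at h1 h2
  rw [← h1, h2]

end Cosets

namespace MGOps

/-! ### Representing a full meet groupoid by cosets of its left automorphism group -/

section Hat

open scoped Pointwise

variable {M : Type} {s : MGOps M} {G : Type} [Group G] (e : G ≃* s.leftAut)

/-- The set of all `q` which map the idempotent `A⁻¹ · A` to `A`. -/
def hat (A : M) : Set G := {q | A ≠ s.bot ∧ (e q : Equiv.Perm M) (s.src A) = A}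

variable {e}

lemma mem_hat {A : M} (hA : A ≠ s.bot) {q : G} :
    q ∈ hat e A ↔ (e q : Equiv.Perm M) (s.src A) = A := and_iff_right hA

lemma hat_bot : hat e s.bot = ∅ := by
  simp [hat]

lemma coe_mul_apply (p q : G) (A : M) :
    (e (p * q) : Equiv.Perm M) A = (e p : Equiv.Perm M) ((e q : Equiv.Perm M) A) := by
  rw [map_mul]
  rfl

lemma coe_inv_apply_eq {p : G} {A B : M} :
    (e p⁻¹ : Equiv.Perm M) A = B ↔ A = (e p : Equiv.Perm M) B := by
  rw [map_inv]
  exact Equiv.Perm.inv_eq_iff_eq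

variable [Countable M] (h : s.IsFull)
include h

lemma IsFull.hat_nonempty {A : M} (hA : A ≠ s.bot) : (hat e A).Nonempty := by
  obtain ⟨p, hp, hpA⟩ := h.exists_leftAut hA
  refine ⟨e.symm ⟨p, hp⟩, hA, ?_⟩
  rwa [e.apply_symm_apply]

lemma IsFull.hat_eq_empty {A : M} : hat e A = ∅ ↔ A = s.bot := by
  constructor
  · intro hA
    by_contra hne
    exact (h.hat_nonempty hne).ne_empty hA
  · rintro rfl
    exact hat_bot

omit [Countable M] in
/-- An element of `hat A` maps every idempotent above `A⁻¹ · A` to the *coset above `A`. -/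
lemma IsFull.mem_hat_of_le {A B : M} (hAB : s.Le A B) {q : G} (hq : q ∈ hat e A) : q ∈ hat e B := by
  have hA := hq.1
  have hB := h.ne_bot_of_le hAB hA
  refine (mem_hat hB).2 (h.eq_of_src_eq (C := A) hA ?_ hAB ?_)
  · have := leftAut_le (e q).2 (h.src_le_src hA hAB)
    rwa [(mem_hat hA).1 hq] at this
  · rw [leftAut_src h.toIsMeetGroupoid (e q).2, h.src_src]

/-- Otherwise `W = U ∩ V` is strictly below `V`, and fullness gives two *cosets of `W` below `V`.
Any `q` taking `W` to one of these fixes `V`, hence `U` by the inclusion, hence their meet `W`; so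
both *cosets equal `W`. -/
lemma IsFull.le_of_hat_subset {U V : M} (hU : s.IsIdem U) (hV : s.IsIdem V)
    (hUV : hat e V ⊆ hat e U) : s.Le V U := by
  have hW := h.isIdem_inf hU hV
  by_contra hne
  have hne' : s.inf U V ≠ V := fun h' => hne (by rw [Le, h.inf_comm]; exact h')
  obtain ⟨A, A', hAA, hA, hA', hAV, hAV'⟩ := h.down_left _ V V hW hV (h.inf_le_right U V) hne' hV.2
  have key : ∀ A, s.mul A (s.inf U V) = some A → s.Le A V → A = s.inf U V := by
    intro A hA hAV
    have hsrc := h.src_eq_of_mul hA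
    have hA0 : A ≠ s.bot := fun h' => hW.1 (by rw [← hsrc, h', h.src_bot])
    obtain ⟨q, hq⟩ := h.hat_nonempty (e := e) hA0
    have h1 := h.mem_hat_of_le hAV hq
    have h2 := (mem_hat hU.1).1 (hUV h1)
    have h3 := (mem_hat hV.1).1 h1
    have h4 := (mem_hat hA0).1 hq
    rw [h.src_of_isIdem hU] at h2
    rw [h.src_of_isIdem hV] at h3
    rw [hsrc, (e q).2.1, h2, h3] at h4
    exact h4.symm
  exact hAA ((key A hA hAV).trans (key A' hA' hAV').symm)

lemma IsFull.hat_injOn_isIdem {U V : M} (hU : s.IsIdem U) (hV : s.IsIdem V)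
    (hUV : hat e U = hat e V) : U = V :=
  h.le_antisymm (h.le_of_hat_subset hV hU hUV.subset) (h.le_of_hat_subset hU hV hUV.symm.subset)

omit [Countable M] in
-- Once `g` carries the source of `A` to `A`, another element `x` does so exactly when `g⁻¹ x` fixes
-- the source.
lemma IsFull.isLeftCoset_hat {A : M} (hA : (hat e A).Nonempty) {V : Subgroup G}
    (hV : (V : Set G) = hat e (s.src A)) : IsLeftCoset V (hat e A) := by
  obtain ⟨g, hg⟩ := hA
  have hA0 := hg.1
  refine isLeftCoset_iff.2 ⟨g, fun x => ?_⟩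
  rw [← SetLike.mem_coe, hV, mem_hat hA0, mem_hat (h.isIdem_src hA0).1, h.src_src,
    coe_mul_apply, coe_inv_apply_eq, (mem_hat hA0).1 hg]

omit [Countable M] in
-- From `q (A · A⁻¹) · A = q A`: the first factor is `A⁻¹` exactly when the product is `A⁻¹ · A`.
lemma IsFull.mem_hat_inv {A : M} {q : G} : q ∈ hat e (s.inv A) ↔ q⁻¹ ∈ hat e A := by
  by_cases hA : A = s.bot
  · simp [hA, h.inv_bot, hat_bot]
  rw [mem_hat (fun h' => hA (h.inv_eq_bot.1 h')), mem_hat hA, coe_inv_apply_eq, h.src_inv]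
  have h1 := leftAut_tgt h.toIsMeetGroupoid (e q).2 A
  constructor
  · intro h2
    rw [h2, h.inv_mul, Option.some_inj] at h1
    exact h1
  · intro h2
    have h3 := leftAut_mul (e q).2 (h.mul_inv A)
    have h4 := h.tgt_mul (s.inv A)
    rw [h.tgt_inv, h2, h3, Option.some_inj] at h4
    exact h4

omit [Countable M] in
lemma IsFull.isRightCoset_hat {A : M} (hA : (hat e A).Nonempty) {V : Subgroup G}
    (hV : (V : Set G) = hat e (s.tgt A)) : IsRightCoset V (hat e A) := by
  obtain ⟨g, hg⟩ := hA
  have hg' : g⁻¹ ∈ hat e (s.inv A) := by rwa [h.mem_hat_inv, inv_inv]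
  have hc : IsLeftCoset V (hat e (s.inv A)) :=
    h.isLeftCoset_hat ⟨_, hg'⟩ (by rw [hV, h.src_inv])
  refine isRightCoset_iff.2 ⟨g, fun x => ?_⟩
  have h1 := hc.mem_iff hg' x⁻¹
  rw [h.mem_hat_inv, inv_inv] at h1
  rw [h1, ← V.inv_mem_iff]
  simp

/-- An element of `hat e A` takes `A⁻¹ · A = B · B⁻¹` to `A`, hence `B` to `A · B`. Composing it
with an element of `hat e B` therefore carries the source of `B`, which is that of the product, to
the product. -/
lemma IsFull.hat_mul {A B C : M} (hC : s.mul A B = some C) : hat e C = hat e A * hat e B := by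
  by_cases hA : A = s.bot
  · have hC0 : C = s.bot := by rw [← h.tgt_eq_bot, h.tgt_of_mul hC, h.tgt_eq_bot, hA]
    rw [hA, hC0, hat_bot, Set.empty_mul]
  have hC0 : C ≠ s.bot := fun h' => hA (by
    rw [← h.tgt_eq_bot, ← h.tgt_of_mul hC, h.tgt_eq_bot, h'])
  have hB0 : B ≠ s.bot := fun h' => hC0 (by
    rw [← h.src_eq_bot, h.src_mul hC, h.src_eq_bot, h'])
  have key : ∀ p ∈ hat e A, (e p : Equiv.Perm M) B = C := by
    intro p hp
    have h1 := leftAut_tgt h.toIsMeetGroupoid (e p).2 B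
    rw [← h.src_of_mul hC, (mem_hat hA).1 hp, hC, Option.some_inj] at h1
    exact h1.symm
  ext r
  rw [Set.mem_mul]
  constructor
  · intro hr
    obtain ⟨p, hp⟩ := h.hat_nonempty (e := e) hA
    refine ⟨p, hp, p⁻¹ * r, (mem_hat hB0).2 ?_, by simp⟩
    rw [coe_mul_apply, ← h.src_mul hC, (mem_hat hC0).1 hr, coe_inv_apply_eq, key p hp]
  · rintro ⟨p, hp, q, hq, rfl⟩
    rw [mem_hat hC0, coe_mul_apply, h.src_mul hC, (mem_hat hB0).1 hq, key p hp]

omit [Countable M] in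
-- A common element carries the meet of the two sources to the meet of `A` and `B`, which is
-- therefore nonempty and has that meet of sources as its source.
lemma IsFull.hat_inf (A B : M) : hat e (s.inf A B) = hat e A ∩ hat e B := by
  refine subset_antisymm (fun q hq => ⟨h.mem_hat_of_le (h.inf_le_left A B) hq,
    h.mem_hat_of_le (h.inf_le_right A B) hq⟩) ?_
  rintro q ⟨hA, hB⟩
  have h1 : (e q : Equiv.Perm M) (s.inf (s.src A) (s.src B)) = s.inf A B := by
    rw [(e q).2.1, (mem_hat hA.1).1 hA, (mem_hat hB.1).1 hB]
  have h2 : s.inf A B ≠ s.bot := h1 ▸ leftAut_ne_bot h.toIsMeetGroupoid (e q).2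
    (h.isIdem_inf (h.isIdem_src hA.1) (h.isIdem_src hB.1)).1
  rw [mem_hat h2, h.src_inf h2, h1]

/-- If the stabilizers of the nonempty idempotents are the members of `interClosure T`, then the
meet groupoid is identified with the coset meet groupoid of its group of left automorphisms. -/
theorem IsFull.isCosetMeetGroupoid_hat {T : Set (Subgroup G)}
    (hT : ∀ V : Subgroup G, V ∈ interClosure T ↔
      ∃ U, s.IsIdem U ∧ (V : Set G) = {q | (e q : Equiv.Perm M) U = U}) :
    IsCosetMeetGroupoid T s (hat e) := by
  have hstab : ∀ {U}, s.IsIdem U → {q | (e q : Equiv.Perm M) U = U} = hat e U := by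
    intro U hU
    ext q
    rw [mem_hat hU.1, h.src_of_isIdem hU]
    rfl
  have hex : ∀ {U}, s.IsIdem U → ∃ V ∈ interClosure T, (V : Set G) = hat e U := by
    intro U hU
    have hle : ({q | (e q : Equiv.Perm M) U = U} : Set G) =
        ((MulAction.stabilizer (Equiv.Perm M) U).comap (s.leftAut.subtype.comp e.toMonoidHom) :
          Subgroup G) := by
      ext q
      rfl
    exact ⟨_, (hT _).2 ⟨U, hU, hle.symm⟩, by rw [← hle, hstab hU]⟩
  have hex' : ∀ {V : Subgroup G}, V ∈ interClosure T → ∃ U, s.IsIdem U ∧ (V : Set G) = hat e U := by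
    intro V hV
    obtain ⟨U, hU, hVU⟩ := (hT V).1 hV
    exact ⟨U, hU, by rw [hVU, hstab hU]⟩
  -- The coset determines its subgroup, the subgroup its idempotent, and any point of the coset then
  -- carries this idempotent to the element itself.
  have hinj : Function.Injective (hat e) := by
    intro A B hAB
    by_cases hA : A = s.bot
    · have : hat e B = ∅ := by rw [← hAB, hA, hat_bot]
      rw [hA, h.hat_eq_empty.1 this]
    · have hne := h.hat_nonempty (e := e) hA
      have hneB : (hat e B).Nonempty := hAB ▸ hne
      obtain ⟨q, hq⟩ := hneB
      obtain ⟨V, -, hV⟩ := hex (h.isIdem_src hA)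
      obtain ⟨V', -, hV'⟩ := hex (h.isIdem_src hq.1)
      have h1 := h.isLeftCoset_hat hne hV
      have h2 := h.isLeftCoset_hat ⟨q, hq⟩ hV'
      rw [hAB] at h1
      have h3 := h.hat_injOn_isIdem (e := e) (h.isIdem_src hA) (h.isIdem_src hq.1) (by
        rw [← hV, ← hV', h1.subgroup_unique h2])
      rw [← (mem_hat hA).1 (hAB ▸ hq), h3, (mem_hat hq.1).1 hq]
  have hmul : ∀ A B C, s.mul A B = some C → ((hat e A = ∅ ∧ hat e B = ∅) ∨
      ∃ U ∈ interClosure T, IsLeftCoset U (hat e A) ∧ IsRightCoset U (hat e B)) := by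
    intro A B C hC
    by_cases hA : A = s.bot
    · left
      have hB : B = s.bot := by rw [← h.tgt_eq_bot, ← h.src_of_mul hC, h.src_eq_bot, hA]
      rw [hA, hB, hat_bot]
      exact ⟨rfl, rfl⟩
    · right
      have hB : B ≠ s.bot := fun h' => hA (by
        rw [← h.src_eq_bot, h.src_of_mul hC, h.tgt_eq_bot, h'])
      obtain ⟨V, hVT, hV⟩ := hex (h.isIdem_src hA)
      exact ⟨V, hVT, h.isLeftCoset_hat (h.hat_nonempty hA) hV,
        h.isRightCoset_hat (h.hat_nonempty hB) (by rw [hV, h.src_of_mul hC])⟩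
  refine ⟨hinj, ?_, fun A B C => ⟨fun hC => ⟨hmul A B C hC, h.hat_mul hC⟩, ?_⟩, fun A => ?_,
    h.hat_inf, hat_bot⟩
  · ext X
    constructor
    · rintro ⟨A, rfl⟩
      by_cases hA : A = s.bot
      · exact Or.inl (h.hat_eq_empty.2 hA)
      · obtain ⟨V, hVT, hV⟩ := hex (h.isIdem_src hA)
        exact Or.inr ⟨V, hVT, h.isLeftCoset_hat (h.hat_nonempty hA) hV⟩
    · rintro (rfl | ⟨V, hVT, hX⟩)
      · exact ⟨s.bot, hat_bot⟩
      · obtain ⟨U, hU, hV⟩ := hex' hVT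
        obtain ⟨g, hg⟩ := hX.nonempty
        have hsrc : s.src ((e g : Equiv.Perm M) U) = U := by
          rw [leftAut_src h.toIsMeetGroupoid (e g).2, h.src_of_isIdem hU]
        have hne := leftAut_ne_bot h.toIsMeetGroupoid (e g).2 hU.1
        -- The coset `g V`, with `V` the stabilizer of `U`, comes from the image of `U` under `g`.
        refine ⟨(e g : Equiv.Perm M) U, ?_⟩
        ext x
        rw [hX.mem_iff hg, ← SetLike.mem_coe, hV, mem_hat hne, mem_hat hU.1, hsrc,
          h.src_of_isIdem hU, coe_mul_apply, coe_inv_apply_eq]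
  · rintro ⟨hcond, hABC⟩
    -- A coset has only one subgroup on each side, so composability of the cosets forces source and
    -- target to have the same stabilizer, hence to be equal.
    have hdef : s.src A = s.tgt B := by
      rcases hcond with ⟨hA, hB⟩ | ⟨V, hVT, hA, hB⟩
      · rw [h.hat_eq_empty.1 hA, h.hat_eq_empty.1 hB, h.src_bot, h.tgt_eq_bot.2 rfl]
      · have hA0 := hA.nonempty.some_mem.1
        have hB0 := hB.nonempty.some_mem.1
        obtain ⟨V₁, -, hV₁⟩ := hex (h.isIdem_src hA0)
        obtain ⟨V₂, -, hV₂⟩ := hex (h.isIdem_tgt hB0)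
        refine h.hat_injOn_isIdem (e := e) (h.isIdem_src hA0) (h.isIdem_tgt hB0) ?_
        rw [← hV₁, ← hV₂, (h.isLeftCoset_hat hA.nonempty hV₁).subgroup_unique hA,
          (h.isRightCoset_hat hB.nonempty hV₂).subgroup_unique hB]
    obtain ⟨C', hC'⟩ := h.exists_mul hdef
    rw [hC', hinj ((h.hat_mul hC').trans hABC.symm)]
  · ext q
    exact h.mem_hat_inv

end Hat

end MGOps

end BorelDuality

namespace BorelDuality

open scoped Pointwise

/-! ### The coset meet groupoid is full -/

section CosetLemmas

variable {G : Type} [Group G] {U V W : Subgroup G} {A B : Set G}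

lemma isLeftCoset_self (U : Subgroup G) : IsLeftCoset U (U : Set G) :=
  isLeftCoset_iff.2 ⟨1, by simp⟩

lemma isRightCoset_self (U : Subgroup G) : IsRightCoset U (U : Set G) :=
  isRightCoset_iff.2 ⟨1, by simp⟩

lemma exists_isLeftCoset (U : Subgroup G) (g : G) : ∃ A : Set G, IsLeftCoset U A ∧ g ∈ A :=
  ⟨{x | g⁻¹ * x ∈ U}, isLeftCoset_iff.2 ⟨g, fun _ => Iff.rfl⟩, by simp⟩

lemma exists_isRightCoset (U : Subgroup G) (g : G) : ∃ A : Set G, IsRightCoset U A ∧ g ∈ A :=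
  ⟨{x | x * g⁻¹ ∈ U}, isRightCoset_iff.2 ⟨g, fun _ => Iff.rfl⟩, by simp⟩

lemma IsLeftCoset.eq_of_mem (hA : IsLeftCoset U A) (hB : IsLeftCoset U B) {g : G} (hgA : g ∈ A)
    (hgB : g ∈ B) : A = B := by
  ext x
  rw [hA.mem_iff hgA, hB.mem_iff hgB]

lemma IsRightCoset.eq_of_mem (hA : IsRightCoset U A) (hB : IsRightCoset U B) {g : G} (hgA : g ∈ A)
    (hgB : g ∈ B) : A = B := by
  ext x
  rw [hA.mem_iff hgA, hB.mem_iff hgB]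

lemma IsLeftCoset.subset_of_mem (hA : IsLeftCoset U A) (hB : IsLeftCoset V B) (hUV : U ≤ V) {g : G}
    (hgA : g ∈ A) (hgB : g ∈ B) : A ⊆ B := fun x hx =>
  (hB.mem_iff hgB x).2 (hUV ((hA.mem_iff hgA x).1 hx))

lemma IsRightCoset.subset_of_mem (hA : IsRightCoset U A) (hB : IsRightCoset V B) (hUV : U ≤ V)
    {g : G} (hgA : g ∈ A) (hgB : g ∈ B) : A ⊆ B := fun x hx =>
  (hB.mem_iff hgB x).2 (hUV ((hA.mem_iff hgA x).1 hx))

lemma IsLeftCoset.inv (hA : IsLeftCoset U A) : IsRightCoset U A⁻¹ := by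
  obtain ⟨g, hg⟩ := isLeftCoset_iff.1 hA
  refine isRightCoset_iff.2 ⟨g⁻¹, fun x => ?_⟩
  rw [Set.mem_inv, hg, ← U.inv_mem_iff]
  simp

lemma IsRightCoset.inv (hA : IsRightCoset U A) : IsLeftCoset U A⁻¹ := by
  obtain ⟨g, hg⟩ := isRightCoset_iff.1 hA
  refine isLeftCoset_iff.2 ⟨g⁻¹, fun x => ?_⟩
  rw [Set.mem_inv, hg, ← U.inv_mem_iff]
  simp

lemma IsLeftCoset.inter (hA : IsLeftCoset U A) (hB : IsLeftCoset V B) (h : (A ∩ B).Nonempty) :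
    IsLeftCoset (U ⊓ V) (A ∩ B) := by
  obtain ⟨g, hgA, hgB⟩ := h
  refine isLeftCoset_iff.2 ⟨g, fun x => ?_⟩
  rw [Set.mem_inter_iff, hA.mem_iff hgA, hB.mem_iff hgB, Subgroup.mem_inf]

lemma IsRightCoset.inter (hA : IsRightCoset U A) (hB : IsRightCoset V B) (h : (A ∩ B).Nonempty) :
    IsRightCoset (U ⊓ V) (A ∩ B) := by
  obtain ⟨g, hgA, hgB⟩ := h
  refine isRightCoset_iff.2 ⟨g, fun x => ?_⟩
  rw [Set.mem_inter_iff, hA.mem_iff hgA, hB.mem_iff hgB, Subgroup.mem_inf]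

/-- If `A` is a left and `B` a right coset of `U`, then `A B` consists of all `x` with
`a⁻¹ x ∈ B`. -/
lemma mem_mul_iff_left (hA : IsLeftCoset U A) (hB : IsRightCoset U B) {a : G} (ha : a ∈ A) (x : G) :
    x ∈ A * B ↔ a⁻¹ * x ∈ B := by
  constructor
  · rintro ⟨a', ha', b, hb, rfl⟩
    rw [hB.mem_iff hb]
    simpa [mul_assoc] using (hA.mem_iff ha a').1 ha'
  · intro hx
    exact ⟨a, ha, _, hx, by simp⟩

lemma mem_mul_iff_right (hA : IsLeftCoset U A) (hB : IsRightCoset U B) {b : G} (hb : b ∈ B)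
    (x : G) : x ∈ A * B ↔ x * b⁻¹ ∈ A := by
  constructor
  · rintro ⟨a, ha, b', hb', rfl⟩
    rw [hA.mem_iff ha]
    simpa [mul_assoc] using (hB.mem_iff hb b').1 hb'
  · intro hx
    exact ⟨_, hx, b, hb, by simp⟩

lemma IsLeftCoset.mul (hA : IsLeftCoset U A) (hB : IsRightCoset U B) (hB' : IsLeftCoset V B) :
    IsLeftCoset V (A * B) := by
  obtain ⟨a, ha⟩ := hA.nonempty
  obtain ⟨b, hb⟩ := hB.nonempty
  refine isLeftCoset_iff.2 ⟨a * b, fun x => ?_⟩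
  rw [mem_mul_iff_left hA hB ha, hB'.mem_iff hb, mul_inv_rev, mul_assoc]

lemma IsRightCoset.mul (hA' : IsRightCoset V A) (hA : IsLeftCoset U A) (hB : IsRightCoset U B) :
    IsRightCoset V (A * B) := by
  obtain ⟨a, ha⟩ := hA.nonempty
  obtain ⟨b, hb⟩ := hB.nonempty
  refine isRightCoset_iff.2 ⟨a * b, fun x => ?_⟩
  rw [mem_mul_iff_right hA hB hb, hA'.mem_iff ha, mul_inv_rev, mul_assoc]

lemma mul_inv_mul_cancel (hA : IsLeftCoset U A) (hB : IsRightCoset U B) : A * B * B⁻¹ = A := by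
  obtain ⟨b, hb⟩ := hB.nonempty
  ext x
  constructor
  · rintro ⟨y, hy, b', hb', rfl⟩
    rw [Set.mem_inv] at hb'
    simpa using (mem_mul_iff_right hA hB hb' y).1 hy
  · intro hx
    exact ⟨x * b, ⟨x, hx, b, hb, rfl⟩, b⁻¹, by simpa using hb, by simp⟩

lemma inv_mul_mul_cancel (hA : IsLeftCoset U A) (hB : IsRightCoset U B) : A⁻¹ * (A * B) = B := by
  obtain ⟨a, ha⟩ := hA.nonempty
  ext x
  constructor
  · rintro ⟨a', ha', y, hy, rfl⟩
    rw [Set.mem_inv] at ha'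
    simpa using (mem_mul_iff_left hA hB ha' y).1 hy
  · intro hx
    exact ⟨a⁻¹, by simpa using ha, a * x, ⟨a, ha, x, hx, rfl⟩, by simp⟩

lemma inf_mem_interClosure {T : Set (Subgroup G)} (hU : U ∈ interClosure T)
    (hV : V ∈ interClosure T) : U ⊓ V ∈ interClosure T := by
  classical
  obtain ⟨F, hF, hFT, rfl⟩ := hU
  obtain ⟨F', hF', hFT', rfl⟩ := hV
  refine ⟨F ∪ F', hF.mono Finset.subset_union_left, ?_, ?_⟩
  · rw [Finset.coe_union]
    exact union_subset hFT hFT'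
  · rw [Finset.coe_union, sInf_union]

lemma subset_interClosure {T : Set (Subgroup G)} : T ⊆ interClosure T := fun U hU =>
  ⟨{U}, Finset.singleton_nonempty U, by simpa using hU, by simp⟩

end CosetLemmas

/-- The finite intersections of members of `T` are closed under conjugation, and there is one. -/
structure IsConjClosed {G : Type} [Group G] (T : Set (Subgroup G)) : Prop where
  nonempty : (interClosure T).Nonempty
  conj : ∀ U ∈ interClosure T, ∀ g : G, ∃ V ∈ interClosure T, ∀ x, x ∈ V ↔ g⁻¹ * x * g ∈ U

section CosetStructure

variable {G : Type} [Group G] {T : Set (Subgroup G)}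

/-- Because `g U = (g U g⁻¹) g`. -/
lemma IsConjClosed.exists_right (hT : IsConjClosed T) {U : Subgroup G} (hU : U ∈ interClosure T)
    {A : Set G} (hA : IsLeftCoset U A) : ∃ V ∈ interClosure T, IsRightCoset V A := by
  obtain ⟨g, hg⟩ := isLeftCoset_iff.1 hA
  obtain ⟨V, hV, hVU⟩ := hT.conj U hU g
  refine ⟨V, hV, isRightCoset_iff.2 ⟨g, fun x => ?_⟩⟩
  rw [hg, hVU]
  simp [mul_assoc]

lemma IsConjClosed.exists_left (hT : IsConjClosed T) {U : Subgroup G} (hU : U ∈ interClosure T)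
    {A : Set G} (hA : IsRightCoset U A) : ∃ V ∈ interClosure T, IsLeftCoset V A := by
  obtain ⟨V, hV, hVA⟩ := hT.exists_right hU hA.inv.inv.inv
  exact ⟨V, hV, by simpa using hVA.inv⟩

namespace IsCosetMeetGroupoid

variable {M : Type} {s : MGOps M} {c : M → Set G} (hc : IsCosetMeetGroupoid T s c)

/-- The product of the cosets is defined. -/
def Composable (T : Set (Subgroup G)) (A B : Set G) : Prop :=
  (A = ∅ ∧ B = ∅) ∨ ∃ U ∈ interClosure T, IsLeftCoset U A ∧ IsRightCoset U B

include hc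

lemma mul_eq_some {A B C : M} : s.mul A B = some C ↔ Composable T (c A) (c B) ∧ c C = c A * c B :=
  hc.mul A B C

lemma exists_of_isLeftCoset {U : Subgroup G} (hU : U ∈ interClosure T) {X : Set G}
    (hX : IsLeftCoset U X) : ∃ A, c A = X := by
  have : X ∈ Set.range c := by
    rw [hc.range]
    exact Or.inr ⟨U, hU, hX⟩
  exact this

lemma exists_isLeftCoset {A : M} (hA : (c A).Nonempty) :
    ∃ U ∈ interClosure T, IsLeftCoset U (c A) := by
  have : c A ∈ Set.range c := mem_range_self A
  rw [hc.range] at this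
  exact this.resolve_left hA.ne_empty

lemma eq_empty_iff {A : M} : c A = ∅ ↔ A = s.bot :=
  ⟨fun h => hc.injective (h.trans hc.bot.symm), fun h => h ▸ hc.bot⟩

lemma nonempty_iff {A : M} : (c A).Nonempty ↔ A ≠ s.bot := by
  rw [nonempty_iff_ne_empty, Ne, hc.eq_empty_iff]

lemma le_iff {A B : M} : s.Le A B ↔ c A ⊆ c B := by
  rw [MGOps.Le, ← hc.injective.eq_iff, hc.inf, inter_eq_left]

/-- If `g U` is idempotent then `g² ∈ g U`, so `g ∈ U` and the coset is `U`. -/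
lemma isIdem_iff {U : M} : s.IsIdem U ↔ ∃ V ∈ interClosure T, c U = (V : Set G) := by
  constructor
  · rintro ⟨hU, hUU⟩
    obtain ⟨⟨h, -⟩ | ⟨V, hV, hL, hR⟩, hm⟩ := hc.mul_eq_some.1 hUU
    · exact (hU (hc.eq_empty_iff.1 h)).elim
    · obtain ⟨g, hg⟩ := hL.nonempty
      have h1 : g * g ∈ c U := hm ▸ Set.mul_mem_mul hg hg
      rw [hL.mem_iff hg, inv_mul_cancel_left] at h1
      refine ⟨V, hV, hL.eq_of_mem (isLeftCoset_self V) hg h1⟩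
  · rintro ⟨V, hV, hVU⟩
    refine ⟨fun h => ?_, hc.mul_eq_some.2 ⟨Or.inr ⟨V, hV, ?_, ?_⟩, ?_⟩⟩
    · have : (1 : G) ∈ c U := hVU ▸ V.one_mem
      rw [hc.eq_empty_iff.2 h] at this
      exact this
    · exact hVU ▸ isLeftCoset_self V
    · exact hVU ▸ isRightCoset_self V
    · rw [hVU]
      exact (coe_mul_coe V).symm

lemma mul_idem_iff {A U : M} {V : Subgroup G} (hV : V ∈ interClosure T) (hU : c U = (V : Set G)) :
    s.mul A U = some A ↔ IsLeftCoset V (c A) := by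
  rw [hc.mul_eq_some, hU]
  constructor
  · rintro ⟨⟨-, h⟩ | ⟨W, -, hL, hR⟩, -⟩
    · exact (h.subset V.one_mem).elim
    · rwa [(isRightCoset_self V).subgroup_unique hR]
  · intro h
    refine ⟨Or.inr ⟨V, hV, h, isRightCoset_self V⟩, ?_⟩
    ext x
    rw [mem_mul_iff_right h (isRightCoset_self V) (SetLike.mem_coe.2 V.one_mem)]
    simp

lemma idem_mul_iff {A U : M} {V : Subgroup G} (hV : V ∈ interClosure T) (hU : c U = (V : Set G)) :
    s.mul U A = some A ↔ IsRightCoset V (c A) := by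
  rw [hc.mul_eq_some, hU]
  constructor
  · rintro ⟨⟨h, -⟩ | ⟨W, -, hL, hR⟩, -⟩
    · exact (h.subset V.one_mem).elim
    · rwa [(isLeftCoset_self V).subgroup_unique hL]
  · intro h
    refine ⟨Or.inr ⟨V, hV, isLeftCoset_self V, h⟩, ?_⟩
    ext x
    rw [mem_mul_iff_left (isLeftCoset_self V) h (SetLike.mem_coe.2 V.one_mem)]
    simp

variable (hT : IsConjClosed T)

lemma exists_mul {A B : M} (h : Composable T (c A) (c B)) : ∃ C, s.mul A B = some C := by
  suffices ∃ C, c C = c A * c B from this.imp fun C hC => hc.mul_eq_some.2 ⟨h, hC⟩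
  rcases h with ⟨hA, hB⟩ | ⟨U, hU, hA, hB⟩
  · exact ⟨s.bot, by rw [hc.bot, hA, Set.empty_mul]⟩
  · obtain ⟨V, hV, hB'⟩ := hc.exists_isLeftCoset hB.nonempty
    exact hc.exists_of_isLeftCoset hV (hA.mul hB hB')

/-- Definedness propagates because `A B` is a left coset of the same subgroup as `B`, and `B C` a
right coset of the same subgroup as `B`. -/
lemma assoc_left {A B C X Z : M} (hX : s.mul A B = some X) (hZ : s.mul X C = some Z) :
    ∃ Y, s.mul B C = some Y ∧ s.mul A Y = some Z := by
  obtain ⟨hAB, hX'⟩ := hc.mul_eq_some.1 hX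
  obtain ⟨hXC, hZ'⟩ := hc.mul_eq_some.1 hZ
  rcases hAB with ⟨hA, hB⟩ | ⟨U, hU, hA, hB⟩
  · rw [hA, Set.empty_mul] at hX'
    rcases hXC with ⟨-, hC⟩ | ⟨V, -, hXV, -⟩
    · obtain ⟨Y, hY⟩ := hc.exists_mul (A := B) (B := C) (Or.inl ⟨hB, hC⟩)
      refine ⟨Y, hY, hc.mul_eq_some.2 ⟨Or.inl ⟨hA, ?_⟩, ?_⟩⟩
      · rw [(hc.mul_eq_some.1 hY).2, hB, Set.empty_mul]
      · rw [hZ', hX', hA, Set.empty_mul, Set.empty_mul]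
    · exact (hXV.nonempty.ne_empty hX').elim
  · obtain ⟨V, hV, hB'⟩ := hc.exists_isLeftCoset hB.nonempty
    have hXL := hA.mul hB hB'
    rw [← hX'] at hXL
    rcases hXC with ⟨h, -⟩ | ⟨V', hV', hXV', hC⟩
    · exact (hXL.nonempty.ne_empty h).elim
    · obtain rfl := hXL.subgroup_unique hXV'
      obtain ⟨Y, hY⟩ := hc.exists_mul (Or.inr ⟨V, hV, hB', hC⟩)
      refine ⟨Y, hY, hc.mul_eq_some.2 ⟨Or.inr ⟨U, hU, hA, ?_⟩, ?_⟩⟩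
      · rw [(hc.mul_eq_some.1 hY).2]
        exact hB.mul hB' hC
      · rw [(hc.mul_eq_some.1 hY).2, hZ', hX', mul_assoc]

include hT

lemma exists_isRightCoset {A : M} (hA : (c A).Nonempty) :
    ∃ U ∈ interClosure T, IsRightCoset U (c A) := by
  obtain ⟨U, hU, h⟩ := hc.exists_isLeftCoset hA
  exact hT.exists_right hU h

lemma assoc_right {A B C Y Z : M} (hY : s.mul B C = some Y) (hZ : s.mul A Y = some Z) :
    ∃ X, s.mul A B = some X ∧ s.mul X C = some Z := by
  obtain ⟨hBC, hY'⟩ := hc.mul_eq_some.1 hY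
  obtain ⟨hAY, hZ'⟩ := hc.mul_eq_some.1 hZ
  rcases hBC with ⟨hB, hC⟩ | ⟨V, hV, hB, hC⟩
  · rw [hB, Set.empty_mul] at hY'
    rcases hAY with ⟨hA, -⟩ | ⟨V, -, -, hYV⟩
    · obtain ⟨X, hX⟩ := hc.exists_mul (A := A) (B := B) (Or.inl ⟨hA, hB⟩)
      refine ⟨X, hX, hc.mul_eq_some.2 ⟨Or.inl ⟨?_, hC⟩, ?_⟩⟩
      · rw [(hc.mul_eq_some.1 hX).2, hA, Set.empty_mul]
      · rw [hZ', hY', hC, Set.mul_empty, Set.mul_empty]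
    · exact (hYV.nonempty.ne_empty hY').elim
  · obtain ⟨U, hU, hB'⟩ := hc.exists_isRightCoset hT hB.nonempty
    have hYR := hB'.mul hB hC
    rw [← hY'] at hYR
    rcases hAY with ⟨-, h⟩ | ⟨U', hU', hA, hYU'⟩
    · exact (hYR.nonempty.ne_empty h).elim
    · obtain rfl := hYR.subgroup_unique hYU'
      obtain ⟨X, hX⟩ := hc.exists_mul (Or.inr ⟨U, hU, hA, hB'⟩)
      refine ⟨X, hX, hc.mul_eq_some.2 ⟨Or.inr ⟨V, hV, ?_, hC⟩, ?_⟩⟩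
      · rw [(hc.mul_eq_some.1 hX).2]
        exact hA.mul hB' hB
      · rw [(hc.mul_eq_some.1 hX).2, hZ', hY', mul_assoc]

theorem isMeetGroupoid : s.IsMeetGroupoid where
  assoc A B C := by
    refine Option.ext fun Z => ?_
    simp only [Option.bind_eq_some_iff]
    constructor
    · rintro ⟨X, hX, hZ⟩
      exact hc.assoc_left hX hZ
    · rintro ⟨Y, hY, hZ⟩
      exact hc.assoc_right hT hY hZ
  mul_inv_defined A := by
    refine Option.isSome_iff_exists.2 (hc.exists_mul ?_)
    rw [hc.inv]
    rcases eq_empty_or_nonempty (c A) with h | h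
    · exact Or.inl ⟨h, by rw [h, Set.inv_empty]⟩
    · obtain ⟨U, hU, hA⟩ := hc.exists_isLeftCoset h
      exact Or.inr ⟨U, hU, hA, hA.inv⟩
  inv_mul_defined A := by
    refine Option.isSome_iff_exists.2 (hc.exists_mul ?_)
    rw [hc.inv]
    rcases eq_empty_or_nonempty (c A) with h | h
    · exact Or.inl ⟨by rw [h, Set.inv_empty], h⟩
    · obtain ⟨U, hU, hA⟩ := hc.exists_isRightCoset hT h
      exact Or.inr ⟨U, hU, hA.inv, hA⟩
  cancel_right A B C hC := by
    obtain ⟨hAB, hC'⟩ := hc.mul_eq_some.1 hC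
    rw [hc.mul_eq_some, hc.inv, hC']
    rcases hAB with ⟨hA, hB⟩ | ⟨U, hU, hA, hB⟩
    · rw [hA, hB]
      exact ⟨Or.inl ⟨by simp, by simp⟩, by simp⟩
    · obtain ⟨V, hV, hB'⟩ := hc.exists_isLeftCoset hB.nonempty
      exact ⟨Or.inr ⟨V, hV, hA.mul hB hB', hB'.inv⟩, (mul_inv_mul_cancel hA hB).symm⟩
  cancel_left A B C hC := by
    obtain ⟨hAB, hC'⟩ := hc.mul_eq_some.1 hC
    rw [hc.mul_eq_some, hc.inv, hC']
    rcases hAB with ⟨hA, hB⟩ | ⟨U, hU, hA, hB⟩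
    · rw [hA, hB]
      exact ⟨Or.inl ⟨by simp, by simp⟩, by simp⟩
    · obtain ⟨V, hV, hA'⟩ := hc.exists_isRightCoset hT hA.nonempty
      exact ⟨Or.inr ⟨V, hV, hA'.inv, hA'.mul hA hB⟩, (inv_mul_mul_cancel hA hB).symm⟩
  inf_assoc A B C := hc.injective (by simp only [hc.inf, inter_assoc])
  inf_comm A B := hc.injective (by simp only [hc.inf, inter_comm])
  inf_idem A := hc.injective (by simp only [hc.inf, inter_self])
  bot_le A := hc.le_iff.2 (by rw [hc.bot]; exact empty_subset _)
  inv_bot := hc.injective (by rw [hc.inv, hc.bot, Set.inv_empty])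
  bot_mul_bot := hc.mul_eq_some.2 ⟨Or.inl ⟨hc.bot, hc.bot⟩, by rw [hc.bot, Set.empty_mul]⟩
  bot_mul A hA := by
    by_contra hne
    obtain ⟨C, hC⟩ := Option.ne_none_iff_exists'.1 hne
    obtain ⟨⟨-, h⟩ | ⟨U, -, h, -⟩, -⟩ := hc.mul_eq_some.1 hC
    · exact hA (hc.eq_empty_iff.1 h)
    · exact h.nonempty.ne_empty hc.bot
  mul_bot A hA := by
    by_contra hne
    obtain ⟨C, hC⟩ := Option.ne_none_iff_exists'.1 hne
    obtain ⟨⟨h, -⟩ | ⟨U, -, -, h⟩, -⟩ := hc.mul_eq_some.1 hC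
    · exact hA (hc.eq_empty_iff.1 h)
    · exact h.nonempty.ne_empty hc.bot
  idem_inf U V hU hV := by
    obtain ⟨U', -, hU'⟩ := hc.isIdem_iff.1 hU
    obtain ⟨V', -, hV'⟩ := hc.isIdem_iff.1 hV
    rw [← hc.nonempty_iff, hc.inf, hU', hV']
    exact ⟨1, U'.one_mem, V'.one_mem⟩
  inv_le_inv A B := by
    rw [hc.le_iff, hc.le_iff, hc.inv, hc.inv, Set.inv_subset_inv]
  inf_mul_inf A₀ A₁ B₀ B₁ C₀ C₁ h₀ h₁ hA hB := by
    rw [← hc.nonempty_iff, hc.inf] at hA hB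
    obtain ⟨⟨h, -⟩ | ⟨U, hU, hA₀, hB₀⟩, hC₀⟩ := hc.mul_eq_some.1 h₀
    · exact (hA.left.ne_empty h).elim
    obtain ⟨⟨h, -⟩ | ⟨V, hV, hA₁, hB₁⟩, hC₁⟩ := hc.mul_eq_some.1 h₁
    · exact (hA.right.ne_empty h).elim
    have hL := hA₀.inter hA₁ hA
    have hR := hB₀.inter hB₁ hB
    rw [hc.mul_eq_some, hc.inf, hc.inf, hc.inf]
    refine ⟨Or.inr ⟨_, inf_mem_interClosure hU hV, hL, hR⟩, ?_⟩
    obtain ⟨a, ha⟩ := hA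
    ext x
    rw [mem_mul_iff_left hL hR ha, hC₀, hC₁, Set.mem_inter_iff, mem_mul_iff_left hA₀ hB₀ ha.1,
      mem_mul_iff_left hA₁ hB₁ ha.2, Set.mem_inter_iff]

theorem isFull : s.IsFull where
  toIsMeetGroupoid := hc.isMeetGroupoid hT
  up_left U V A hU hV hUV hA := by
    obtain ⟨U', hU', hUe⟩ := hc.isIdem_iff.1 hU
    obtain ⟨V', hV', hVe⟩ := hc.isIdem_iff.1 hV
    rw [hc.le_iff, hUe, hVe, SetLike.coe_subset_coe] at hUV
    rw [hc.mul_idem_iff hU' hUe] at hA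
    obtain ⟨g, hg⟩ := hA.nonempty
    obtain ⟨X, hX, hgX⟩ := BorelDuality.exists_isLeftCoset V' g
    obtain ⟨B, rfl⟩ := hc.exists_of_isLeftCoset hV' hX
    simp only [hc.mul_idem_iff hV' hVe, hc.le_iff]
    exact ⟨B, ⟨hX, hA.subset_of_mem hX hUV hg hgX⟩, fun C hC =>
      hc.injective (hC.1.eq_of_mem hX (hC.2 hg) hgX)⟩
  up_right U V A hU hV hUV hA := by
    obtain ⟨U', hU', hUe⟩ := hc.isIdem_iff.1 hU
    obtain ⟨V', hV', hVe⟩ := hc.isIdem_iff.1 hV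
    rw [hc.le_iff, hUe, hVe, SetLike.coe_subset_coe] at hUV
    rw [hc.idem_mul_iff hU' hUe] at hA
    obtain ⟨g, hg⟩ := hA.nonempty
    obtain ⟨X, hX, hgX⟩ := BorelDuality.exists_isRightCoset V' g
    -- The elements of `M` are listed as left cosets, so the right coset has to be recognised as a
    -- left coset of a conjugate.
    obtain ⟨W, hW, hXW⟩ := hT.exists_left hV' hX
    obtain ⟨B, rfl⟩ := hc.exists_of_isLeftCoset hW hXW
    simp only [hc.idem_mul_iff hV' hVe, hc.le_iff]
    exact ⟨B, ⟨hX, hA.subset_of_mem hX hUV hg hgX⟩, fun C hC =>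
      hc.injective (hC.1.eq_of_mem hX (hC.2 hg) hgX)⟩
  down_left U V B hU hV hUV hne hB := by
    obtain ⟨U', hU', hUe⟩ := hc.isIdem_iff.1 hU
    obtain ⟨V', hV', hVe⟩ := hc.isIdem_iff.1 hV
    have hne' : U' ≠ V' := fun h => hne (hc.injective (by rw [hUe, hVe, h]))
    rw [hc.le_iff, hUe, hVe, SetLike.coe_subset_coe] at hUV
    rw [hc.mul_idem_iff hV' hVe] at hB
    -- For `v` in `V'` but not in `U'`, the cosets `b U'` and `b v U'` are distinct and both lie in
    -- `b V'`.
    obtain ⟨v, hv, hvU⟩ := SetLike.exists_of_lt (lt_of_le_of_ne hUV hne')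
    obtain ⟨b, hb⟩ := hB.nonempty
    have hbv : b * v ∈ c B := (hB.mem_iff hb _).2 (by simpa using hv)
    obtain ⟨X, hX, hbX⟩ := BorelDuality.exists_isLeftCoset U' b
    obtain ⟨Y, hY, hbY⟩ := BorelDuality.exists_isLeftCoset U' (b * v)
    obtain ⟨A, rfl⟩ := hc.exists_of_isLeftCoset hU' hX
    obtain ⟨A', rfl⟩ := hc.exists_of_isLeftCoset hU' hY
    simp only [hc.mul_idem_iff hU' hUe, hc.le_iff]
    refine ⟨A, A', fun h => hvU ?_, hX, hY, hX.subset_of_mem hB hUV hbX hb,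
      hY.subset_of_mem hB hUV hbY hbv⟩
    have := (hX.mem_iff hbX (b * v)).1 (h ▸ hbY)
    simpa using this
  down_right U V B hU hV hUV hne hB := by
    obtain ⟨U', hU', hUe⟩ := hc.isIdem_iff.1 hU
    obtain ⟨V', hV', hVe⟩ := hc.isIdem_iff.1 hV
    have hne' : U' ≠ V' := fun h => hne (hc.injective (by rw [hUe, hVe, h]))
    rw [hc.le_iff, hUe, hVe, SetLike.coe_subset_coe] at hUV
    rw [hc.idem_mul_iff hV' hVe] at hB
    obtain ⟨v, hv, hvU⟩ := SetLike.exists_of_lt (lt_of_le_of_ne hUV hne')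
    obtain ⟨b, hb⟩ := hB.nonempty
    have hbv : v * b ∈ c B := (hB.mem_iff hb _).2 (by simpa using hv)
    obtain ⟨X, hX, hbX⟩ := BorelDuality.exists_isRightCoset U' b
    obtain ⟨Y, hY, hbY⟩ := BorelDuality.exists_isRightCoset U' (v * b)
    obtain ⟨W, hW, hXW⟩ := hT.exists_left hU' hX
    obtain ⟨W', hW', hYW⟩ := hT.exists_left hU' hY
    obtain ⟨A, rfl⟩ := hc.exists_of_isLeftCoset hW hXW
    obtain ⟨A', rfl⟩ := hc.exists_of_isLeftCoset hW' hYW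
    simp only [hc.idem_mul_iff hU' hUe, hc.le_iff]
    refine ⟨A, A', fun h => hvU ?_, hX, hY, hX.subset_of_mem hB hUV hbX hb,
      hY.subset_of_mem hB hUV hbY hbv⟩
    have := (hX.mem_iff hbX (v * b)).1 (h ▸ hbY)
    simpa using this

end IsCosetMeetGroupoid

end CosetStructure

end BorelDuality

namespace BorelDuality

open scoped Pointwise

/-! ### Isomorphisms of coset meet groupoids -/

section IsoOfEquiv

variable {G H : Type} [Group G] [Group H] (α : G ≃* H)

variable {α} in
lemma mem_map_coe {U : Subgroup G} {x : H} : x ∈ U.map (α : G →* H) ↔ α.symm x ∈ U :=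
  Subgroup.mem_map_equiv

lemma map_mem_interClosure {T : Set (Subgroup G)} {T' : Set (Subgroup H)}
    (hT : ∀ U ∈ T, U.map (α : G →* H) ∈ T') {U : Subgroup G} (hU : U ∈ interClosure T) :
    U.map (α : G →* H) ∈ interClosure T' := by
  classical
  obtain ⟨F, hF, hFT, rfl⟩ := hU
  refine ⟨F.image fun V => V.map (α : G →* H), hF.image _, ?_, ?_⟩
  · rw [Finset.coe_image]
    rintro _ ⟨V, hV, rfl⟩
    exact hT V (hFT hV)
  · ext x
    rw [mem_map_coe, Subgroup.mem_sInf, Subgroup.mem_sInf, Finset.coe_image,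
      forall_mem_image]
    exact forall₂_congr fun V _ => mem_map_coe.symm

lemma map_symm_map (U : Subgroup G) : (U.map (α : G →* H)).map (α.symm : H →* G) = U := by
  ext x
  rw [mem_map_coe, mem_map_coe]
  simp

lemma map_map_symm (U : Subgroup H) : (U.map (α.symm : H →* G)).map (α : G →* H) = U := by
  ext x
  rw [mem_map_coe, mem_map_coe]
  simp

lemma map_mem_interClosure_iff {T : Set (Subgroup G)} {T' : Set (Subgroup H)}
    (hT : ∀ U, U ∈ T ↔ U.map (α : G →* H) ∈ T') (U : Subgroup G) :
    U ∈ interClosure T ↔ U.map (α : G →* H) ∈ interClosure T' := by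
  refine ⟨map_mem_interClosure α fun U => (hT U).1, fun h => ?_⟩
  rw [← map_symm_map α U]
  refine map_mem_interClosure α.symm (fun V hV => ?_) h
  rw [hT, map_map_symm]
  exact hV

variable {α}

lemma IsLeftCoset.image {U : Subgroup G} {A : Set G} (hA : IsLeftCoset U A) :
    IsLeftCoset (U.map (α : G →* H)) (α '' A) := by
  obtain ⟨g, hg⟩ := isLeftCoset_iff.1 hA
  refine isLeftCoset_iff.2 ⟨α g, fun x => ?_⟩
  obtain ⟨y, rfl⟩ := α.surjective x
  rw [mem_map_coe, α.injective.mem_set_image, hg]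
  simp

lemma IsRightCoset.image {U : Subgroup G} {A : Set G} (hA : IsRightCoset U A) :
    IsRightCoset (U.map (α : G →* H)) (α '' A) := by
  obtain ⟨g, hg⟩ := isRightCoset_iff.1 hA
  refine isRightCoset_iff.2 ⟨α g, fun x => ?_⟩
  obtain ⟨y, rfl⟩ := α.surjective x
  rw [mem_map_coe, α.injective.mem_set_image, hg]
  simp

lemma IsCosetMeetGroupoid.Composable.image {T : Set (Subgroup G)} {T' : Set (Subgroup H)}
    (hT : ∀ U ∈ interClosure T, U.map (α : G →* H) ∈ interClosure T') {A B : Set G}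
    (h : Composable T A B) : Composable T' (α '' A) (α '' B) := by
  rcases h with ⟨hA, hB⟩ | ⟨U, hU, hA, hB⟩
  · exact Or.inl ⟨by rw [hA, image_empty], by rw [hB, image_empty]⟩
  · exact Or.inr ⟨_, hT U hU, hA.image, hB.image⟩

/-- Products, inverses and intersections of sets commute with `α`; the correspondence of subgroups
is needed only for the domains to match and for definedness of products to be preserved in both
directions. -/
theorem IsCosetMeetGroupoid.exists_iso {T : Set (Subgroup G)} {T' : Set (Subgroup H)} {M N : Type}
    {s : MGOps M} {t : MGOps N} {c : M → Set G} {d : N → Set H} (hc : IsCosetMeetGroupoid T s c)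
    (hd : IsCosetMeetGroupoid T' t d) (α : G ≃* H)
    (hα : ∀ U, U ∈ interClosure T ↔ U.map (α : G →* H) ∈ interClosure T') :
    ∃ e : MGOps.Iso s t, ∀ A, d (e.equiv A) = α '' c A := by
  have hα' : ∀ U ∈ interClosure T', U.map (α.symm : H →* G) ∈ interClosure T := fun U hU => by
    rw [hα, map_map_symm]
    exact hU
  have hcomp : ∀ A B : Set G, Composable T' (α '' A) (α '' B) ↔ Composable T A B := by
    refine fun A B => ⟨fun h => ?_, fun h => h.image fun U => (hα U).1⟩
    have := h.image (α := α.symm) hα'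
    simpa [image_image] using this
  have hex : ∀ A, ∃ B, d B = α '' c A := by
    intro A
    rcases eq_empty_or_nonempty (c A) with h | h
    · exact ⟨t.bot, by rw [hd.bot, h, image_empty]⟩
    · obtain ⟨U, hU, hA⟩ := hc.exists_isLeftCoset h
      exact hd.exists_of_isLeftCoset ((hα U).1 hU) hA.image
  choose f hf using hex
  have hbij : Function.Bijective f := by
    constructor
    · intro A B hAB
      have : α '' c A = α '' c B := by rw [← hf, ← hf, hAB]
      exact hc.injective (α.injective.image_injective this)
    · intro B
      have hex : ∃ A, c A = α.symm '' d B := by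
        rcases eq_empty_or_nonempty (d B) with h | h
        · exact ⟨s.bot, by rw [hc.bot, h, image_empty]⟩
        · obtain ⟨U, hU, hB⟩ := hd.exists_isLeftCoset h
          exact hc.exists_of_isLeftCoset (hα' U hU) hB.image
      obtain ⟨A, hA⟩ := hex
      refine ⟨A, hd.injective ?_⟩
      rw [hf, hA, image_image]
      simp
  refine ⟨⟨Equiv.ofBijective f hbij, fun A B => ?_, fun A => ?_, fun A B => ?_⟩, hf⟩
  · refine Option.ext fun D => ?_
    obtain ⟨C, rfl⟩ := hbij.2 D
    have h1 : (s.mul A B).map (Equiv.ofBijective f hbij) = some (f C) ↔ s.mul A B = some C := by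
      rw [Option.map_eq_some_iff]
      constructor
      · rintro ⟨C', hC', hC⟩
        rwa [← hbij.1 hC]
      · exact fun h => ⟨C, h, rfl⟩
    change t.mul (f A) (f B) = some (f C) ↔ _
    rw [h1, hd.mul_eq_some, hc.mul_eq_some, hf, hf, hf, hcomp, ← image_mul α,
      α.injective.image_injective.eq_iff]
  · refine hd.injective ?_
    change d (f (s.inv A)) = d (t.inv (f A))
    rw [hf, hc.inv, hd.inv, hf]
    exact Set.image_inv α (c A)
  · refine hd.injective ?_
    change d (f (s.inf A B)) = d (t.inf (f A) (f B))
    rw [hf, hc.inf, hd.inf, hf, hf, image_inter α.injective]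

end IsoOfEquiv

/-! ### Left translations -/

section Translate

variable {G : Type} [Group G] {T : Set (Subgroup G)} {M : Type} {s : MGOps M} {c : M → Set G}

lemma IsLeftCoset.smul {U : Subgroup G} {A : Set G} (hA : IsLeftCoset U A) (g : G) :
    IsLeftCoset U (g • A) := by
  obtain ⟨a, ha⟩ := isLeftCoset_iff.1 hA
  refine isLeftCoset_iff.2 ⟨g * a, fun x => ?_⟩
  rw [Set.mem_smul_set_iff_inv_smul_mem, ha, smul_eq_mul, mul_inv_rev, mul_assoc]

namespace IsCosetMeetGroupoid

variable (hc : IsCosetMeetGroupoid T s c)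
include hc

lemma exists_translate (g : G) (A : M) : ∃ B, c B = g • c A := by
  rcases eq_empty_or_nonempty (c A) with h | h
  · exact ⟨s.bot, by rw [hc.bot, h, Set.smul_set_empty]⟩
  · obtain ⟨U, hU, hA⟩ := hc.exists_isLeftCoset h
    exact hc.exists_of_isLeftCoset hU (hA.smul g)

/-- Every element of the group acts on the coset meet groupoid by left translation. -/
theorem exists_translateHom : ∃ f : G →* s.leftAut, ∀ g A, c ((f g : Equiv.Perm M) A) = g • c A := by
  choose f hf using hc.exists_translate
  have hmul : ∀ g h A, f (g * h) A = f g (f h A) := fun g h A =>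
    hc.injective (by rw [hf, hf, hf, mul_smul])
  have hone : ∀ A, f 1 A = A := fun A => hc.injective (by rw [hf, one_smul])
  let p : G → Equiv.Perm M := fun g => ⟨f g, f g⁻¹, fun A => by rw [← hmul, inv_mul_cancel, hone],
    fun A => by rw [← hmul, mul_inv_cancel, hone]⟩
  have hcomp : ∀ g A B, Composable T (c (f g A)) (c B) ↔ Composable T (c A) (c B) := by
    have key : ∀ g A B, Composable T (c A) (c B) → Composable T (c (f g A)) (c B) := by
      rintro g A B (⟨hA, hB⟩ | ⟨U, hU, hA, hB⟩)
      · exact Or.inl ⟨by rw [hf, hA, Set.smul_set_empty], hB⟩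
      · exact Or.inr ⟨U, hU, by rw [hf]; exact hA.smul g, hB⟩
    refine fun g A B => ⟨fun h => ?_, key g A B⟩
    have := key g⁻¹ _ _ h
    rwa [← hmul, inv_mul_cancel, hone] at this
  have hp : ∀ g, p g ∈ s.leftAut := by
    refine fun g => ⟨fun A B => hc.injective ?_, fun A B => Option.ext fun D => ?_⟩
    · change c (f g _) = c (s.inf (f g A) (f g B))
      rw [hc.inf, hf, hf, hf, hc.inf, Set.smul_set_inter]
    · obtain ⟨C, rfl⟩ := (p g).surjective D
      have h1 : (s.mul A B).map (p g) = some (p g C) ↔ s.mul A B = some C := by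
        rw [Option.map_eq_some_iff]
        constructor
        · rintro ⟨C', hC', hC⟩
          rwa [← (p g).injective hC]
        · exact fun h => ⟨C, h, rfl⟩
      rw [h1]
      change s.mul (f g A) B = some (f g C) ↔ _
      rw [hc.mul_eq_some, hc.mul_eq_some, hcomp, hf, hf, smul_mul_assoc,
        (MulAction.injective g).eq_iff]
  exact ⟨{ toFun := fun g => ⟨p g, hp g⟩
           map_one' := Subtype.ext (Equiv.ext hone)
           map_mul' := fun g h => Subtype.ext (Equiv.ext (hmul g h)) }, hf⟩

/-- Applying `p` to `u · u = u` gives `p u · u = p u`. -/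
lemma isLeftCoset_leftAut {p : Equiv.Perm M} (hp : p ∈ s.leftAut) {u : M} {U : Subgroup G}
    (hU : U ∈ interClosure T) (hu : c u = (U : Set G)) : IsLeftCoset U (c (p u)) := by
  rw [← hc.mul_idem_iff hU hu]
  exact MGOps.leftAut_mul hp ((hc.mul_idem_iff hU hu).2 (hu ▸ isLeftCoset_self U))

variable (hT : IsConjClosed T)
include hT

/-- With `w` the idempotent for `W`, take `u` to be the target of `p⁻¹ w`. Then `p u · p⁻¹ w = w`,
so `p u` has target `w`. These right cosets control inverses in the limit argument for
`exists_common_point`. -/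
lemma exists_isRightCoset_leftAut {p : Equiv.Perm M} (hp : p ∈ s.leftAut) {W : Subgroup G}
    (hW : W ∈ interClosure T) : ∃ u, s.IsIdem u ∧ IsRightCoset W (c (p u)) := by
  have hm := hc.isMeetGroupoid hT
  obtain ⟨w, hw⟩ := hc.exists_of_isLeftCoset hW (isLeftCoset_self W)
  have hwi : s.IsIdem w := hc.isIdem_iff.2 ⟨W, hW, hw⟩
  have hpB : p (p⁻¹ w) = w := p.apply_symm_apply w
  have hB : p⁻¹ w ≠ s.bot := fun h => hwi.1 (by rw [← hpB, h, MGOps.leftAut_bot hm hp])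
  refine ⟨s.tgt (p⁻¹ w), hm.isIdem_tgt hB, ?_⟩
  have h1 := MGOps.leftAut_tgt hm hp (p⁻¹ w)
  rw [hpB] at h1
  have h2 := hm.tgt_of_mul h1
  rw [hm.tgt_of_isIdem hwi] at h2
  rw [← hc.idem_mul_iff hW hw]
  have h3 := hm.tgt_mul (p (s.tgt (p⁻¹ w)))
  rwa [← h2] at h3

/-- A left automorphism whose values at the idempotents have a common point `g` is the translation
by `g`. -/
lemma leftAut_eq_smul {p : Equiv.Perm M} (hp : p ∈ s.leftAut) {g : G}
    (hg : ∀ u, s.IsIdem u → g ∈ c (p u)) (B : M) : c (p B) = g • c B := by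
  have hm := hc.isMeetGroupoid hT
  by_cases hB : B = s.bot
  · rw [hB, MGOps.leftAut_bot hm hp, hc.bot, Set.smul_set_empty]
  · have h1 := MGOps.leftAut_tgt hm hp B
    have hgB := hg _ (hm.isIdem_tgt hB)
    obtain ⟨⟨h, -⟩ | ⟨U, hU, hL, hR⟩, h2⟩ := hc.mul_eq_some.1 h1
    · exact (h.subset hgB).elim
    · ext x
      rw [h2, mem_mul_iff_left hL hR hgB, Set.mem_smul_set_iff_inv_smul_mem, smul_eq_mul]

end IsCosetMeetGroupoid

end Translate

/-! ### The group is recovered from its coset meet groupoid -/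

/-- `𝒢(M)` as the group of left automorphisms. -/
noncomputable def autEquiv (M : CountableMG) : M.autGroup ≃* M.ops.leftAut :=
  (M.ops.leftAut.equivMapOfInjective M.extendPerm M.extendPerm_injective).symm

lemma autEquiv_apply (M : CountableMG) (q : M.autGroup) (A : M.carrier) :
    ((autEquiv M q : Equiv.Perm M.carrier) A : ℕ) = (q : Equiv.Perm ℕ) A := by
  have h := (M.ops.leftAut.equivMapOfInjective M.extendPerm
    M.extendPerm_injective).apply_symm_apply q
  rw [← congrArg Subtype.val h]
  exact (M.extendPerm_coe _ A).symm

lemma autGroup_apply_of_notMem (M : CountableMG) (q : M.autGroup) {n : ℕ} (hn : n ∉ M.carrier) :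
    (q : Equiv.Perm ℕ) n = n := by
  obtain ⟨p, -, hp⟩ := q.2
  rw [← hp]
  exact M.extendPerm_of_notMem p hn

lemma IsLeftCoset.isClopen {G : Type} [Group G] [TopologicalSpace G] [IsTopologicalGroup G]
    {U : Subgroup G} (hU : IsOpen (U : Set G)) {A : Set G} (hA : IsLeftCoset U A) :
    IsClopen A := by
  obtain ⟨g, hg⟩ := isLeftCoset_iff.1 hA
  have : A = (fun x => g⁻¹ * x) ⁻¹' (U : Set G) := Set.ext hg
  rw [this]
  exact IsClopen.preimage ⟨U.isClosed_of_isOpen hU, hU⟩ (continuous_const.mul continuous_id)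

/-- The finite intersections of members of `T` are open and form a neighbourhood basis of the
identity. -/
structure IsOpenBasis {G : Type} [Group G] [TopologicalSpace G] (T : Set (Subgroup G)) : Prop where
  isOpen : ∀ U ∈ interClosure T, IsOpen (U : Set G)
  basis : ∀ O : Set G, IsOpen O → 1 ∈ O → ∃ U ∈ interClosure T, (U : Set G) ⊆ O

section Duality

variable {G : ClosedSubgroup (Equiv.Perm ℕ)} {T : Set (Subgroup G)}

lemma IsOpenBasis.exists_fixing (hO : IsOpenBasis T) (k : ℕ) :
    ∃ U ∈ interClosure T, ∀ x ∈ U, (x : Equiv.Perm ℕ) k = k := by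
  obtain ⟨U, hU, hUk⟩ := hO.basis {x | (x : Equiv.Perm ℕ) k = k}
    ((isClopen_apply_eq k k).isOpen.preimage continuous_subtype_val) (by simp)
  exact ⟨U, hU, fun x hx => hUk hx⟩

/-- The cosets `c (p u)` generate a filter along which both the permutations and their inverses
stabilise at every number, so it converges in `Sym(ℕ)`. The limit is in `G` since `G` is closed, and
in each coset since cosets are clopen. -/
theorem IsCosetMeetGroupoid.exists_common_point {M : Type} {s : MGOps M} {c : M → Set G}
    (hc : IsCosetMeetGroupoid T s c) (hT : IsConjClosed T) (hO : IsOpenBasis T)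
    {p : Equiv.Perm M} (hp : p ∈ s.leftAut) : ∃ g, ∀ u, s.IsIdem u → g ∈ c (p u) := by
  have hm := hc.isMeetGroupoid hT
  let I := {u : M // s.IsIdem u}
  have hidem : ∀ U ∈ interClosure T, ∃ u : I, c u = (U : Set G) := by
    intro U hU
    obtain ⟨u, hu⟩ := hc.exists_of_isLeftCoset hU (isLeftCoset_self U)
    exact ⟨⟨u, hc.isIdem_iff.2 ⟨U, hU, hu⟩⟩, hu⟩
  have hIne : Nonempty I := by
    obtain ⟨U, hU⟩ := hT.nonempty
    exact ⟨(hidem U hU).choose⟩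
  let l : Filter G := ⨅ u : I, Filter.principal (c (p u))
  -- The family is directed because `p` preserves meets.
  have hl : l.NeBot := by
    refine Filter.iInf_neBot_of_directed' (fun u v => ⟨⟨s.inf u v, hm.isIdem_inf u.2 v.2⟩, ?_, ?_⟩)
      fun u => ?_
    · change Filter.principal _ ≤ Filter.principal _
      rw [Filter.principal_mono, hp.1, hc.inf]
      exact inter_subset_left
    · change Filter.principal _ ≤ Filter.principal _
      rw [Filter.principal_mono, hp.1, hc.inf]
      exact inter_subset_right
    · rw [Filter.principal_neBot_iff, hc.nonempty_iff]
      exact MGOps.leftAut_ne_bot hm hp u.2.1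
  have hev : ∀ u, s.IsIdem u → ∀ᶠ x in l, x ∈ c (p u) := fun u hu =>
    Filter.mem_iInf_of_mem (⟨u, hu⟩ : I) (Filter.mem_principal_self _)
  obtain ⟨q, hq⟩ : ∃ q, Filter.Tendsto (fun x : G => (x : Equiv.Perm ℕ)) l (𝓝 q) := by
    refine exists_tendsto_perm (fun k => ?_) fun k => ?_
    -- Points of one left coset of `U` differ on the right by elements fixing `k`, so they agree at
    -- `k`.
    · obtain ⟨U, hU, hUk⟩ := hO.exists_fixing k
      obtain ⟨u, hu⟩ := hidem U hU
      have hL := hc.isLeftCoset_leftAut hp hU hu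
      obtain ⟨g, hg⟩ := hL.nonempty
      refine ⟨(g : Equiv.Perm ℕ) k, ?_⟩
      filter_upwards [hev u u.2] with x hx
      have h1 := hUk _ ((hL.mem_iff hg x).1 hx)
      exact Equiv.Perm.inv_eq_iff_eq.1 h1
    -- Points of one right coset of `W` differ on the left by elements fixing `k`, so their inverses
    -- agree at `k`.
    · obtain ⟨W, hW, hWk⟩ := hO.exists_fixing k
      obtain ⟨u, hu, hR⟩ := hc.exists_isRightCoset_leftAut hT hp hW
      obtain ⟨g, hg⟩ := hR.nonempty
      refine ⟨(g : Equiv.Perm ℕ)⁻¹ k, ?_⟩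
      filter_upwards [hev u hu] with x hx
      have h1 := hWk _ ((hR.mem_iff hx g).1 hg)
      exact Equiv.Perm.eq_inv_iff_eq.2 h1
  have hqG : q ∈ G := G.isClosed'.mem_of_tendsto hq (Filter.Eventually.of_forall fun x => x.2)
  have hlim : Filter.Tendsto id l (𝓝 (⟨q, hqG⟩ : G)) := tendsto_subtype_rng.2 hq
  refine ⟨⟨q, hqG⟩, fun u hu => ?_⟩
  obtain ⟨U, hU, hu'⟩ := hc.isIdem_iff.1 hu
  exact ((hc.isLeftCoset_leftAut hp hU hu').isClopen (hO.isOpen U hU)).isClosed.mem_of_tendsto hlim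
    (hev u hu)

/-- Translation is injective because an element fixing all the basic subgroups as cosets lies in
each of them, and surjective by the common point of a left automorphism. Both directions are
continuous because stabilizers of cosets are open and, conversely, the basic subgroups are such
stabilizers. -/
theorem IsCosetMeetGroupoid.exists_autIso {M : CountableMG} {c : M.carrier → Set G}
    (hc : IsCosetMeetGroupoid T M.ops c) (hT : IsConjClosed T) (hO : IsOpenBasis T) :
    ∃ φ : G ≃ₜ* M.autGroup, ∀ (g : G) (A : M.carrier),
      c ((autEquiv M (φ g) : Equiv.Perm M.carrier) A) = g • c A := by
  obtain ⟨f, hf⟩ := hc.exists_translateHom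
  have hstab : ∀ (g : G) (U : Subgroup G), U ∈ interClosure T → ∀ u, c u = (U : Set G) →
      (f g : Equiv.Perm M.carrier) u = u → g ∈ U := by
    intro g U hU u hu hgu
    have h1 := hf g u
    rw [hgu, hu] at h1
    have h2 : g • (1 : G) ∈ g • (U : Set G) := Set.smul_mem_smul_set U.one_mem
    rw [← h1, smul_eq_mul, mul_one] at h2
    exact h2
  have hfb : Function.Bijective f := by
    constructor
    · rw [injective_iff_map_eq_one]
      intro g hg
      refine Subtype.ext (Equiv.ext fun k => ?_)
      obtain ⟨U, hU, hUk⟩ := hO.exists_fixing k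
      obtain ⟨u, hu⟩ := hc.exists_of_isLeftCoset hU (isLeftCoset_self U)
      exact hUk g (hstab g U hU u hu (by rw [hg]; rfl))
    · intro p
      obtain ⟨g, hg⟩ := hc.exists_common_point hT hO p.2
      refine ⟨g, Subtype.ext (Equiv.ext fun A => hc.injective ?_)⟩
      rw [hf, hc.leftAut_eq_smul hT p.2 hg]
  let e : G ≃* M.autGroup := (MulEquiv.ofBijective f hfb).trans (autEquiv M).symm
  have he : ∀ g, autEquiv M (e g) = f g := fun g => (autEquiv M).apply_symm_apply (f g)
  refine ⟨⟨e, ?_, ?_⟩, fun g A => ?_⟩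
  · refine continuous_hom_of_cylinder e.toMonoidHom fun k => ?_
    by_cases hk : k ∈ M.carrier
    · have hfix : ∃ V ∈ interClosure T, ∀ x ∈ V, c ((f x : Equiv.Perm M.carrier) ⟨k, hk⟩) =
          c ⟨k, hk⟩ := by
        rcases eq_empty_or_nonempty (c ⟨k, hk⟩) with h | h
        · obtain ⟨V, hV⟩ := hT.nonempty
          exact ⟨V, hV, fun x _ => by rw [hf, h, Set.smul_set_empty]⟩
        -- Translations by `V` leave a right coset `V a` unchanged.
        · obtain ⟨V, hV, hR⟩ := hc.exists_isRightCoset hT h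
          obtain ⟨a, ha⟩ := h
          refine ⟨V, hV, fun x hx => ?_⟩
          ext y
          rw [hf, Set.mem_smul_set_iff_inv_smul_mem, hR.mem_iff ha, hR.mem_iff ha, smul_eq_mul,
            mul_assoc, V.mul_mem_cancel_left (V.inv_mem hx)]
      obtain ⟨V, hV, hVk⟩ := hfix
      obtain ⟨O, hOo, hOV⟩ := hO.isOpen V hV
      obtain ⟨s, hs, hsO⟩ := exists_cylinder hOo
        (show (1 : G) ∈ Subtype.val ⁻¹' O by rw [hOV]; exact V.one_mem)
      refine ⟨s, hs, fun x hx => ?_⟩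
      have hxV : x ∈ (V : Set G) := hOV ▸ (hsO hx : x ∈ Subtype.val ⁻¹' O)
      have h1 := hc.injective (hVk x hxV)
      have h2 := autEquiv_apply M (e x) ⟨k, hk⟩
      rw [he, h1] at h2
      exact h2.symm
    · exact ⟨∅, by simp [cylinder], fun x _ => autGroup_apply_of_notMem M (e x) hk⟩
  · refine continuous_hom_of_cylinder e.symm.toMonoidHom fun k => ?_
    obtain ⟨U, hU, hUk⟩ := hO.exists_fixing k
    obtain ⟨u, hu⟩ := hc.exists_of_isLeftCoset hU (isLeftCoset_self U)
    -- A translation fixing the number that names the coset `U` is by an element of `U`, and so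
    -- fixes `k`.
    refine ⟨{((u : ℕ), (u : ℕ))}, by simp [cylinder], fun y hy => ?_⟩
    obtain ⟨x, rfl⟩ := e.surjective y
    have hy' : ((e x : M.autGroup) : Equiv.Perm ℕ) u = u := hy _ (Finset.mem_singleton_self _)
    change (e.symm (e x) : Equiv.Perm ℕ) k = k
    rw [e.symm_apply_apply]
    refine hUk x (hstab x U hU u hu (Subtype.ext ?_))
    rw [← he, autEquiv_apply, hy']
  · change c ((autEquiv M (e g) : Equiv.Perm M.carrier) A) = _
    rw [he, hf]

end Duality

end BorelDuality

namespace BorelDuality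

open scoped Pointwise

/-! ### Enumerating the cosets of a group in a Borel way -/

variable {Gr : Set (ClosedSubgroup (Equiv.Perm ℕ))}
  {S : ∀ G : ClosedSubgroup (Equiv.Perm ℕ), Set (Subgroup G)}

/-- Conjugation by `g` as a topological automorphism. -/
def conjIso {G : ClosedSubgroup (Equiv.Perm ℕ)} (g : G) : G ≃ₜ* G where
  toMulEquiv := MulAut.conj g
  continuous_toFun := (continuous_const.mul continuous_id).mul continuous_const
  continuous_invFun := (continuous_const.mul continuous_id).mul continuous_const

namespace InvariantCountableBasis

variable (hS : InvariantCountableBasis Gr S)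
include hS

/-- Conjugations are topological automorphisms of `G`, so the invariance of `S` applies to them. -/
lemma isConjClosed {G : ClosedSubgroup (Equiv.Perm ℕ)} (hG : G ∈ Gr) : IsConjClosed (S G) where
  nonempty := by
    obtain ⟨U, hU, -⟩ := hS.basis G hG univ isOpen_univ (mem_univ _)
    exact ⟨U, subset_interClosure hU⟩
  conj U hU g := by
    refine ⟨_, map_mem_interClosure (conjIso g).toMulEquiv
      (fun V hV => (hS.invariant G hG G hG (conjIso g) V).1 hV) hU, fun x => ?_⟩
    rw [mem_map_coe]
    rfl

lemma isOpenBasis {G : ClosedSubgroup (Equiv.Perm ℕ)} (hG : G ∈ Gr) : IsOpenBasis (S G) where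
  isOpen := by
    rintro _ ⟨F, -, hF, rfl⟩
    rw [Subgroup.coe_sInf]
    exact F.finite_toSet.isOpen_biInter fun U hU => hS.isOpen G hG U (hF hU)
  basis O hO h1 := by
    obtain ⟨U, hU, hUO⟩ := hS.basis G hG O hO h1
    exact ⟨U, subset_interClosure hU, hUO⟩

lemma map_mem_interClosure_iff {G H : ClosedSubgroup (Equiv.Perm ℕ)} (hG : G ∈ Gr) (hH : H ∈ Gr)
    (α : G ≃ₜ* H) (U : Subgroup G) : U ∈ interClosure (S G) ↔
      U.map (α.toMulEquiv : G →* H) ∈ interClosure (S H) :=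
  BorelDuality.map_mem_interClosure_iff _ (hS.invariant G hG H hH α) U

/-- Lusin–Novikov applied to the relation in the invariant countable basis condition: its sections
are countable by hypothesis, and nonempty because a neighbourhood basis is. -/
lemma exists_basis_enumeration (hGr : MeasurableSet Gr) :
    ∃ V : ℕ → GrCat Gr → ClosedSubgroup (Equiv.Perm ℕ), (∀ n, Measurable (V n)) ∧
      ∀ G : GrCat Gr, {U : ClosedSubgroup (Equiv.Perm ℕ) | ∃ U' ∈ S G.grp,
        (U : Set (Equiv.Perm ℕ)) = Subtype.val '' (U' : Set G.grp)} = range fun n => V n G := by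
  have := standardBorelSpace_grCat hGr
  let P : Set (GrCat Gr × ClosedSubgroup (Equiv.Perm ℕ)) :=
    {t | ∃ U' ∈ S t.1.grp, (t.2 : Set (Equiv.Perm ℕ)) = Subtype.val '' (U' : Set t.1.grp)}
  have hP : MeasurableSet P := by
    have h := ((measurable_grp.comp measurable_fst).prodMk measurable_snd :
      Measurable fun t : GrCat Gr × ClosedSubgroup (Equiv.Perm ℕ) => (t.1.grp, t.2)) hS.borel
    convert h using 1
    ext t
    exact ⟨fun h => ⟨t.1.mem, h⟩, fun h => h.2⟩
  refine exists_measurable_enumeration hP (fun G => ?_) fun G => ?_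
  · have hc : (S G.grp).Countable := hS.countable _ G.mem
    refine (hc.image fun U' : Subgroup G.grp => Subtype.val '' (U' : Set G.grp)).preimage_of_injOn
      (f := fun U : ClosedSubgroup (Equiv.Perm ℕ) => (U : Set (Equiv.Perm ℕ)))
      SetLike.coe_injective.injOn |>.mono ?_
    rintro U ⟨U', hU', h⟩
    exact ⟨U', hU', h.symm⟩
  · obtain ⟨U, hU, -⟩ := hS.basis G.grp G.mem univ isOpen_univ (mem_univ _)
    have hcl : IsClosed (Subtype.val '' (U : Set G.grp)) :=
      G.grp.isClosed'.isClosedEmbedding_subtypeVal.isClosedMap _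
        (U.isClosed_of_isOpen (hS.isOpen _ G.mem U hU))
    exact ⟨⟨U.map G.grp.toSubgroup.subtype, hcl⟩, U, hU, rfl⟩

end InvariantCountableBasis

/-- A family of subsets of the groups in `Gr` which is Borel. -/
def IsMeasurableFamily (A : ∀ G : GrCat Gr, Set G.grp) : Prop :=
  Measurable fun t : GrCat Gr × Equiv.Perm ℕ => t.2 ∈ Subtype.val '' A t.1

lemma IsMeasurableFamily.comp {A : ∀ G : GrCat Gr, Set G.grp} (hA : IsMeasurableFamily A)
    {Ω : Type*} [MeasurableSpace Ω] {X : Ω → GrCat Gr} (hX : Measurable X)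
    {g : ∀ ω, (X ω).grp} (hg : Measurable fun ω => (g ω : Equiv.Perm ℕ)) :
    Measurable fun ω => g ω ∈ A (X ω) := by
  have h := Measurable.comp hA (hX.prodMk hg)
  convert h using 1
  ext ω
  exact (Subtype.val_injective.mem_set_image).symm

/-- The dense sequence, as elements of the group. -/
noncomputable def densePt (n : ℕ) (G : GrCat Gr) : G.grp := ⟨dense n G.grp, dense_mem n G.grp⟩

lemma measurable_densePt {Ω : Type*} [MeasurableSpace Ω] {X : Ω → GrCat Gr} (hX : Measurable X)
    (n : ℕ) : Measurable fun ω => (densePt n (X ω) : Equiv.Perm ℕ) :=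
  (measurable_dense n).comp (measurable_grp.comp hX)

lemma isMeasurableFamily_of_grp {A : ∀ G : GrCat Gr, Set G.grp} {P : GrCat Gr × Equiv.Perm ℕ → Prop}
    (hP : Measurable P) (h : ∀ (G : GrCat Gr) (x : G.grp), x ∈ A G ↔ P (G, x)) :
    IsMeasurableFamily A := by
  have : (fun t : GrCat Gr × Equiv.Perm ℕ => t.2 ∈ Subtype.val '' A t.1) =
      fun t => t.2 ∈ t.1.grp ∧ P t := by
    ext ⟨G, x⟩
    constructor
    · rintro ⟨y, hy, hyx⟩
      exact ⟨hyx ▸ y.2, by rw [← show (y : Equiv.Perm ℕ) = x from hyx]; exact (h G y).1 hy⟩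
    · rintro ⟨hx, hP⟩
      exact ⟨⟨x, hx⟩, (h G ⟨x, hx⟩).2 hP, rfl⟩
  unfold IsMeasurableFamily
  rw [this]
  exact (measurable_mem_subgroup.comp (measurable_snd.prodMk
    (measurable_grp.comp measurable_fst))).and hP

variable (Gr S) in
/-- Borel enumerations of the finite intersections of subgroups in `S G` and of their left
cosets. -/
structure CosetSystem where
  sub : ℕ → ∀ G : GrCat Gr, Subgroup G.grp
  coset : ℕ → ∀ G : GrCat Gr, Set G.grp
  range_sub : ∀ G, (range fun n => sub n G) = interClosure (S G.grp)
  range_coset : ∀ G, (range fun n => coset n G) =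
    {A | A = ∅ ∨ ∃ U ∈ interClosure (S G.grp), IsLeftCoset U A}
  measurable_sub : ∀ n, IsMeasurableFamily fun G => (sub n G : Set G.grp)
  measurable_coset : ∀ n, IsMeasurableFamily (coset n)

/-- Nonempty finite sets of indices enumerate the intersections. Cosets of open subgroups are open,
so each contains a dense point, and pairs of a dense point and a subgroup enumerate the left cosets.
-/
theorem InvariantCountableBasis.nonempty_cosetSystem (hS : InvariantCountableBasis Gr S)
    (hGr : MeasurableSet Gr) : Nonempty (CosetSystem Gr S) := by
  classical
  obtain ⟨V, hV, hVS⟩ := hS.exists_basis_enumeration hGr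
  have hVS' : ∀ (G : GrCat Gr) (U : Subgroup G.grp),
      U ∈ S G.grp ↔ ∃ n, U = (V n G).toSubgroup.subgroupOf G.grp.toSubgroup := by
    intro G U
    have key : ∀ W : ClosedSubgroup (Equiv.Perm ℕ),
        ∀ U' : Subgroup G.grp, (W : Set (Equiv.Perm ℕ)) = Subtype.val '' (U' : Set G.grp) →
        U' = W.toSubgroup.subgroupOf G.grp.toSubgroup := by
      intro W U' h
      ext x
      change _ ↔ (x : Equiv.Perm ℕ) ∈ (W : Set (Equiv.Perm ℕ))
      rw [h, Subtype.val_injective.mem_set_image]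
      rfl
    constructor
    · intro hU
      have hcl : IsClosed (Subtype.val '' (U : Set G.grp)) :=
        G.grp.isClosed'.isClosedEmbedding_subtypeVal.isClosedMap _
          (U.isClosed_of_isOpen (hS.isOpen _ G.mem U hU))
      have hW : (⟨U.map G.grp.toSubgroup.subtype, hcl⟩ : ClosedSubgroup (Equiv.Perm ℕ)) ∈
          range fun n => V n G := by
        rw [← hVS G]
        exact ⟨U, hU, rfl⟩
      obtain ⟨n, hn⟩ := hW
      refine ⟨n, key _ _ ?_⟩
      simp only at hn
      rw [hn]
      rfl
    · rintro ⟨n, rfl⟩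
      obtain ⟨U', hU', h⟩ := (hVS G).superset (mem_range_self n)
      rwa [← key _ _ h]
  have : Nonempty {F : Finset ℕ // F.Nonempty} := ⟨⟨{0}, Finset.singleton_nonempty 0⟩⟩
  obtain ⟨F, hF⟩ := exists_surjective_nat {F : Finset ℕ // F.Nonempty}
  let sub : ℕ → ∀ G : GrCat Gr, Subgroup G.grp := fun i G =>
    ⨅ n ∈ (F i).1, (V n G).toSubgroup.subgroupOf G.grp.toSubgroup
  have hsub : ∀ i G (x : G.grp), x ∈ sub i G ↔ ∀ n ∈ (F i).1, (x : Equiv.Perm ℕ) ∈ V n G := by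
    intro i G x
    simp only [sub, Subgroup.mem_iInf]
    rfl
  have hrange : ∀ G, (range fun n => sub n G) = interClosure (S G.grp) := by
    intro G
    ext U
    constructor
    · rintro ⟨i, rfl⟩
      refine ⟨(F i).1.image fun n => (V n G).toSubgroup.subgroupOf G.grp.toSubgroup,
        (F i).2.image _, ?_, ?_⟩
      · rw [Finset.coe_image]
        rintro _ ⟨n, -, rfl⟩
        exact (hVS' G _).2 ⟨n, rfl⟩
      · ext x
        rw [Subgroup.mem_sInf, Finset.coe_image, forall_mem_image]
        exact hsub i G x
    · rintro ⟨T, hT, hTS, rfl⟩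
      choose! f hf using fun U (hU : U ∈ T) => (hVS' G U).1 (hTS hU)
      obtain ⟨i, hi⟩ := hF ⟨T.image f, hT.image f⟩
      refine ⟨i, ?_⟩
      ext x
      simp only [hsub, hi, Subgroup.mem_sInf, Finset.forall_mem_image]
      refine forall₂_congr fun U hU => ?_
      conv_rhs => rw [hf U hU]
      rfl
  have hsubm : ∀ n, IsMeasurableFamily fun G => (sub n G : Set G.grp) := by
    intro i
    refine isMeasurableFamily_of_grp (P := fun t => ∀ n ∈ (F i).1, t.2 ∈ V n t.1) ?_
      fun G x => hsub i G x
    refine Measurable.forall fun n => Measurable.forall fun _ => ?_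
    exact measurable_mem_subgroup.comp (measurable_snd.prodMk ((hV n).comp measurable_fst))
  -- The value `none` stands for the empty set, which is also an element of the coset meet groupoid.
  obtain ⟨f, hf⟩ := exists_surjective_nat (Option (ℕ × ℕ))
  let E : Option (ℕ × ℕ) → ∀ G : GrCat Gr, Set G.grp := fun o G =>
    o.elim ∅ fun t => {x | (densePt t.1 G)⁻¹ * x ∈ sub t.2 G}
  have hE : ∀ i j G, IsLeftCoset (sub j G) (E (some (i, j)) G) := fun i j G =>
    isLeftCoset_iff.2 ⟨densePt i G, fun x => Iff.rfl⟩
  have hO : ∀ j G, IsOpen (sub j G : Set G.grp) := fun j G =>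
    (hS.isOpenBasis G.mem).isOpen _ ((hrange G).subset (mem_range_self j))
  refine ⟨⟨sub, fun n => E (f n), hrange, fun G => ?_, hsubm, fun n => ?_⟩⟩
  · ext A
    constructor
    · rintro ⟨n, rfl⟩
      rcases h : f n with _ | ⟨i, j⟩
      · exact Or.inl (by simp only [h]; rfl)
      · refine Or.inr ⟨sub j G, (hrange G).subset (mem_range_self j), ?_⟩
        simp only [h]
        exact hE i j G
    · rintro (rfl | ⟨U, hU, hA⟩)
      · obtain ⟨n, hn⟩ := hf none
        exact ⟨n, by simp only [hn]; rfl⟩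
      · obtain ⟨j, rfl⟩ := (hrange G).superset hU
        obtain ⟨i, hi⟩ := exists_dense_mem G.grp (hA.isClopen (hO j G)).isOpen hA.nonempty
        obtain ⟨n, hn⟩ := hf (some (i, j))
        refine ⟨n, ?_⟩
        simp only [hn]
        exact (hE i j G).eq_of_mem hA (g := densePt i G)
          (by change (densePt i G)⁻¹ * densePt i G ∈ sub j G; simp) hi
  · rcases f n with _ | ⟨i, j⟩
    · exact isMeasurableFamily_of_grp (P := fun _ => False) measurable_const fun G x => Iff.rfl
    · refine isMeasurableFamily_of_grp
        (P := fun t => (dense i t.1.grp)⁻¹ * t.2 ∈ Subtype.val '' (sub j t.1 : Set t.1.grp)) ?_ ?_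
      · exact Measurable.comp (hsubm j) (measurable_fst.prodMk (((measurable_dense i).comp
          (measurable_grp.comp measurable_fst)).inv.mul measurable_snd))
      · intro G x
        exact (Subtype.val_injective.mem_set_image (s := (sub j G : Set G.grp))
          (a := (densePt i G)⁻¹ * x)).symm

end BorelDuality

namespace BorelDuality

open scoped Pointwise

/-! ### The coset meet groupoid as an object -/

/-- The operations exist because left cosets, together with the empty set, are closed under
composable products, intersections and, by conjugation, inverses. -/
theorem IsConjClosed.exists_isCosetMeetGroupoid {G : Type} [Group G] {T : Set (Subgroup G)}
    (hT : IsConjClosed T) {M : Type} {c : M → Set G} (hinj : Function.Injective c)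
    (hr : range c = {A | A = ∅ ∨ ∃ U ∈ interClosure T, IsLeftCoset U A}) :
    ∃ s : MGOps M, IsCosetMeetGroupoid T s c := by
  classical
  have hex : ∀ X : Set G, (X.Nonempty → ∃ U ∈ interClosure T, IsLeftCoset U X) →
      ∃ C, c C = X := by
    intro X hX
    have : X ∈ range c := by
      rw [hr]
      exact (eq_empty_or_nonempty X).imp id hX
    exact this
  have hc : ∀ A, (c A).Nonempty → ∃ U ∈ interClosure T, IsLeftCoset U (c A) := fun A hA =>
    (hr.subset (mem_range_self A)).resolve_left hA.ne_empty
  have hmul : ∀ A B, ∃ C, IsCosetMeetGroupoid.Composable T (c A) (c B) → c C = c A * c B := by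
    intro A B
    by_cases h : IsCosetMeetGroupoid.Composable T (c A) (c B)
    · obtain ⟨C, hC⟩ := hex (c A * c B) fun hne => by
        rcases h with ⟨hA, -⟩ | ⟨U, hU, hA, hB⟩
        · rw [hA, Set.empty_mul] at hne
          exact (Set.not_nonempty_empty hne).elim
        · obtain ⟨V, hV, hB'⟩ := hc B hB.nonempty
          exact ⟨V, hV, hA.mul hB hB'⟩
      exact ⟨C, fun _ => hC⟩
    · exact ⟨A, fun h' => (h h').elim⟩
  have hinv : ∀ A, ∃ C, c C = (c A)⁻¹ := fun A => hex _ fun hne => by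
    obtain ⟨U, hU, hA⟩ := hc A (by simpa using hne)
    exact hT.exists_left hU hA.inv
  have hinf : ∀ A B, ∃ C, c C = c A ∩ c B := fun A B => hex _ fun hne => by
    obtain ⟨U, hU, hA⟩ := hc A hne.left
    obtain ⟨V, hV, hB⟩ := hc B hne.right
    exact ⟨_, inf_mem_interClosure hU hV, hA.inter hB hne⟩
  obtain ⟨bot, hbot⟩ := hex ∅ fun h => (Set.not_nonempty_empty h).elim
  choose mul hmul using hmul
  choose inv hinv using hinv
  choose inf hinf using hinf
  refine ⟨⟨fun A B => if IsCosetMeetGroupoid.Composable T (c A) (c B) then some (mul A B) else none,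
    inv, inf, bot⟩, hinj, hr, fun A B C => ?_, hinv, hinf, hbot⟩
  change (if IsCosetMeetGroupoid.Composable T (c A) (c B) then some (mul A B) else none) = some C ↔
    IsCosetMeetGroupoid.Composable T (c A) (c B) ∧ _
  split_ifs with h
  · rw [Option.some_inj, and_iff_right h, ← hmul A B h, hinj.eq_iff, eq_comm]
  · simp [h]

/-- The stabilizer of the coset `W` under left translation is `W` itself, so `φ` takes the
distinguished subgroups of `G` to the stabilizers of the idempotents. This supplies the last
condition on objects of `MCat`. -/
lemma IsCosetMeetGroupoid.mem_interClosure_iff {G : ClosedSubgroup (Equiv.Perm ℕ)}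
    {T : Set (Subgroup G)} {M : CountableMG} {c : M.carrier → Set G}
    (hc : IsCosetMeetGroupoid T M.ops c) {φ : G ≃* M.autGroup}
    (hφ : ∀ g A, c ((autEquiv M (φ g) : Equiv.Perm M.carrier) A) = g • c A)
    {T' : Set (Subgroup M.autGroup)}
    (hT' : ∀ U, U ∈ interClosure T ↔ U.map (φ : G →* M.autGroup) ∈ interClosure T')
    (V : Subgroup M.autGroup) : V ∈ interClosure T' ↔ ∃ U : M.carrier, M.ops.IsIdem U ∧
      (V : Set M.autGroup) = {p : M.autGroup | (p : Equiv.Perm ℕ) U = U} := by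
  have key : ∀ (U : M.carrier) (W : Subgroup G), c U = (W : Set G) →
      ((W.map (φ : G →* M.autGroup) : Subgroup _) : Set M.autGroup) =
        {p : M.autGroup | (p : Equiv.Perm ℕ) U = U} := by
    intro U W hU
    ext p
    obtain ⟨g, rfl⟩ := φ.surjective p
    rw [SetLike.mem_coe, mem_map_coe, φ.symm_apply_apply, mem_ofPred_eq, ← autEquiv_apply,
      Subtype.val_inj, ← hc.injective.eq_iff, hφ, hU]
    constructor
    · intro hg
      ext x
      rw [Set.mem_smul_set_iff_inv_smul_mem, smul_eq_mul, SetLike.mem_coe, SetLike.mem_coe,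
        W.mul_mem_cancel_left (W.inv_mem hg)]
    · intro h
      have := Set.smul_mem_smul_set (a := g) (W.one_mem : (1 : G) ∈ (W : Set G))
      rwa [h, smul_eq_mul, mul_one] at this
  constructor
  · intro hV
    have hW := hV
    rw [← map_map_symm φ V, ← hT'] at hW
    obtain ⟨U, hU⟩ := hc.exists_of_isLeftCoset hW (isLeftCoset_self _)
    refine ⟨U, hc.isIdem_iff.2 ⟨_, hW, hU⟩, ?_⟩
    rw [← key U _ hU, map_map_symm]
  · rintro ⟨U, hU, hV⟩
    obtain ⟨W, hW, hUW⟩ := hc.isIdem_iff.1 hU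
    rw [← key U W hUW] at hV
    rw [SetLike.coe_injective hV]
    exact (hT' W).1 hW

variable {Gr : Set (ClosedSubgroup (Equiv.Perm ℕ))}
  {S : ∀ G : ClosedSubgroup (Equiv.Perm ℕ), Set (Subgroup G)}

namespace CosetSystem

variable (σ : CosetSystem Gr S)

/-- The indices at which a coset is listed for the first time. -/
def carrier (G : GrCat Gr) : Set ℕ := {n | ∀ m < n, σ.coset m G ≠ σ.coset n G}

/-- The coset with a given index. -/
def toCoset (G : GrCat Gr) (a : σ.carrier G) : Set G.grp := σ.coset a G

lemma toCoset_injective (G : GrCat Gr) : Function.Injective (σ.toCoset G) := by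
  rintro ⟨a, ha⟩ ⟨b, hb⟩ h
  rcases lt_trichotomy a b with hab | hab | hab
  · exact (hb a hab h).elim
  · exact Subtype.ext hab
  · exact (ha b hab h.symm).elim

lemma range_toCoset (G : GrCat Gr) : range (σ.toCoset G) =
    {A | A = ∅ ∨ ∃ U ∈ interClosure (S G.grp), IsLeftCoset U A} := by
  classical
  rw [← σ.range_coset]
  ext A
  constructor
  · rintro ⟨a, rfl⟩
    exact mem_range_self (a : ℕ)
  · rintro ⟨n, rfl⟩
    have hex : ∃ m, σ.coset m G = σ.coset n G := ⟨n, rfl⟩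
    have hfind := Nat.find_spec hex
    refine ⟨⟨Nat.find hex, fun m hm h => Nat.find_min hex hm (h.trans hfind)⟩, hfind⟩

variable (hS : InvariantCountableBasis Gr S)

/-- The operations of the coset meet groupoid. -/
noncomputable def ops (G : GrCat Gr) : MGOps (σ.carrier G) :=
  ((hS.isConjClosed G.mem).exists_isCosetMeetGroupoid (σ.toCoset_injective G)
    (σ.range_toCoset G)).choose

/-- The coset meet groupoid as a structure with domain contained in `ℕ`. -/
noncomputable def struct (G : GrCat Gr) : CountableMG := ⟨σ.carrier G, σ.ops hS G⟩

lemma isCosetMeetGroupoid (G : GrCat Gr) :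
    IsCosetMeetGroupoid (S G.grp) (σ.struct hS G).ops (σ.toCoset G) :=
  ((hS.isConjClosed G.mem).exists_isCosetMeetGroupoid (σ.toCoset_injective G)
    (σ.range_toCoset G)).choose_spec

/-- The identification of a group with the group of left automorphisms of its coset meet
groupoid. -/
noncomputable def unitIso (G : GrCat Gr) : G.grp ≃ₜ* (σ.struct hS G).autGroup :=
  ((σ.isCosetMeetGroupoid hS G).exists_autIso (hS.isConjClosed G.mem)
    (hS.isOpenBasis G.mem)).choose

lemma toCoset_unitIso (G : GrCat Gr) (g : G.grp) (A : σ.carrier G) :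
    σ.toCoset G ((autEquiv (σ.struct hS G) (σ.unitIso hS G g) :
      Equiv.Perm (σ.struct hS G).carrier) A) =
      g • σ.toCoset G A :=
  ((σ.isCosetMeetGroupoid hS G).exists_autIso (hS.isConjClosed G.mem)
    (hS.isOpenBasis G.mem)).choose_spec g A

variable (hIso : IsomorphismInvariant Gr)

/-- The coset meet groupoid as an object of the category of meet groupoids. -/
noncomputable def obj (G : GrCat Gr) : MCat Gr S where
  str := σ.struct hS G
  full := (σ.isCosetMeetGroupoid hS G).isFull (hS.isConjClosed G.mem)
  aut_mem := hIso _ _ G.mem ⟨σ.unitIso hS G⟩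
  basis := (σ.isCosetMeetGroupoid hS G).mem_interClosure_iff (σ.toCoset_unitIso hS G)
    (hS.map_mem_interClosure_iff G.mem (hIso _ _ G.mem ⟨σ.unitIso hS G⟩) (σ.unitIso hS G))

lemma exists_map {G H : GrCat Gr} (α : G ⟶ H) :
    ∃ e : MGOps.Iso (σ.obj hS hIso G).str.ops (σ.obj hS hIso H).str.ops,
      ∀ A, σ.toCoset H (e.equiv A) = ContinuousMulEquiv.toMulEquiv α '' σ.toCoset G A :=
  (σ.isCosetMeetGroupoid hS G).exists_iso (σ.isCosetMeetGroupoid hS H)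
    (ContinuousMulEquiv.toMulEquiv α) (hS.map_mem_interClosure_iff G.mem H.mem α)

lemma iso_ext {G H : GrCat Gr}
    {e f : MGOps.Iso (σ.obj hS hIso G).str.ops (σ.obj hS hIso H).str.ops}
    (h : ∀ A, σ.toCoset H (e.equiv A) = σ.toCoset H (f.equiv A)) : e = f :=
  MGOps.Iso.ext (Equiv.ext fun A => σ.toCoset_injective H (h A))

/-- The functor sending a group to its coset meet groupoid. -/
noncomputable def functor : GrCat Gr ⥤ MCat Gr S where
  obj := σ.obj hS hIso
  map α := (σ.exists_map hS hIso α).choose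
  map_id G := by
    refine σ.iso_ext hS hIso fun A => ?_
    rw [(σ.exists_map hS hIso (𝟙 G)).choose_spec]
    exact image_id _
  map_comp {G H K} α β := by
    refine σ.iso_ext hS hIso fun A => ?_
    rw [(σ.exists_map hS hIso (α ≫ β)).choose_spec]
    refine Eq.trans ?_ ((σ.exists_map hS hIso β).choose_spec _).symm
    rw [(σ.exists_map hS hIso α).choose_spec]
    exact image_comp (ContinuousMulEquiv.toMulEquiv β) (ContinuousMulEquiv.toMulEquiv α) _

lemma toCoset_functor_map {G H : GrCat Gr} (α : G ⟶ H) (A : σ.carrier G) :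
    σ.toCoset H (MGOps.Iso.equiv ((σ.functor hS hIso).map α) A) =
      ContinuousMulEquiv.toMulEquiv α '' σ.toCoset G A :=
  (σ.exists_map hS hIso α).choose_spec A

end CosetSystem

end BorelDuality

namespace BorelDuality

/-! ### First-order definable sets of countable structures are Borel -/

namespace CountableMG

/-- The graph of the product. -/
def MulRel (M : CountableMG) (t : ℕ × ℕ × ℕ) : Prop :=
  ∃ ha hb hc, M.ops.mul ⟨t.1, ha⟩ ⟨t.2.1, hb⟩ = some ⟨t.2.2, hc⟩

/-- The graph of the inversion. -/
def InvRel (M : CountableMG) (t : ℕ × ℕ) : Prop := ∃ ha hb, M.ops.inv ⟨t.1, ha⟩ = ⟨t.2, hb⟩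

/-- The graph of the meet. -/
def InfRel (M : CountableMG) (t : ℕ × ℕ × ℕ) : Prop :=
  ∃ ha hb hc, M.ops.inf ⟨t.1, ha⟩ ⟨t.2.1, hb⟩ = ⟨t.2.2, hc⟩

/-- The number which is the least element. -/
def BotRel (M : CountableMG) (a : ℕ) : Prop := ∃ ha, M.ops.bot = ⟨a, ha⟩

lemma measurable_mem_carrier (a : ℕ) : Measurable fun M : CountableMG => a ∈ M.carrier :=
  measurableSet_setOfPred.1 (measurableSet_generateFrom (Or.inl (Or.inl (Or.inl (Or.inl ⟨a, rfl⟩)))))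

lemma measurable_mulRel (t : ℕ × ℕ × ℕ) : Measurable fun M : CountableMG => M.MulRel t :=
  measurableSet_setOfPred.1 (measurableSet_generateFrom
    (Or.inl (Or.inl (Or.inl (Or.inr ⟨t.1, t.2.1, t.2.2, rfl⟩)))))

lemma measurable_invRel (t : ℕ × ℕ) : Measurable fun M : CountableMG => M.InvRel t :=
  measurableSet_setOfPred.1 (measurableSet_generateFrom
    (Or.inl (Or.inl (Or.inr ⟨t.1, t.2, rfl⟩))))

lemma measurable_infRel (t : ℕ × ℕ × ℕ) : Measurable fun M : CountableMG => M.InfRel t :=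
  measurableSet_setOfPred.1 (measurableSet_generateFrom
    (Or.inl (Or.inr ⟨t.1, t.2.1, t.2.2, rfl⟩)))

lemma measurable_botRel (a : ℕ) : Measurable fun M : CountableMG => M.BotRel a :=
  measurableSet_setOfPred.1 (measurableSet_generateFrom (Or.inr ⟨a, rfl⟩))

theorem measurable_of_rel {Ω : Type*} [MeasurableSpace Ω] {X : Ω → CountableMG}
    (h1 : ∀ a, Measurable fun ω => a ∈ (X ω).carrier)
    (h2 : ∀ t, Measurable fun ω => (X ω).MulRel t) (h3 : ∀ t, Measurable fun ω => (X ω).InvRel t)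
    (h4 : ∀ t, Measurable fun ω => (X ω).InfRel t) (h5 : ∀ t, Measurable fun ω => (X ω).BotRel t) :
    Measurable X := by
  refine measurable_generateFrom ?_
  rintro _ ((((⟨a, rfl⟩ | ⟨a, b, c, rfl⟩) | ⟨a, b, rfl⟩) | ⟨a, b, c, rfl⟩) | ⟨a, rfl⟩)
  · exact measurableSet_setOfPred.2 (h1 a)
  · exact measurableSet_setOfPred.2 (h2 (a, b, c))
  · exact measurableSet_setOfPred.2 (h3 (a, b))
  · exact measurableSet_setOfPred.2 (h4 (a, b, c))
  · exact measurableSet_setOfPred.2 (h5 a)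

/-- The atomic relations that hold in a structure. -/
def code (M : CountableMG) : (ℕ → Prop) × (ℕ × ℕ × ℕ → Prop) × (ℕ × ℕ → Prop) ×
    (ℕ × ℕ × ℕ → Prop) × (ℕ → Prop) :=
  (fun a => a ∈ M.carrier, M.MulRel, M.InvRel, M.InfRel, M.BotRel)

lemma measurable_code : Measurable code :=
  (measurable_pi_lambda _ measurable_mem_carrier).prodMk <|
    (measurable_pi_lambda _ measurable_mulRel).prodMk <|
    (measurable_pi_lambda _ measurable_invRel).prodMk <|
    (measurable_pi_lambda _ measurable_infRel).prodMk (measurable_pi_lambda _ measurable_botRel)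

lemma comap_code : (inferInstance : MeasurableSpace CountableMG) =
    MeasurableSpace.comap code inferInstance := by
  refine le_antisymm ?_ measurable_code.comap_le
  have hc : Measurable[MeasurableSpace.comap code inferInstance] code := comap_measurable code
  have hid : @Measurable _ _ (MeasurableSpace.comap code inferInstance) _
      (id : CountableMG → CountableMG) := by
    refine @measurable_of_rel _ (MeasurableSpace.comap code inferInstance) _ ?_ ?_ ?_ ?_ ?_
    · exact fun a => (measurable_pi_apply a).comp (measurable_fst.comp hc)
    · exact fun a => (measurable_pi_apply a).comp (measurable_fst.comp (measurable_snd.comp hc))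
    · exact fun a => (measurable_pi_apply a).comp
        (measurable_fst.comp (measurable_snd.comp (measurable_snd.comp hc)))
    · exact fun a => (measurable_pi_apply a).comp (measurable_fst.comp
        (measurable_snd.comp (measurable_snd.comp (measurable_snd.comp hc))))
    · exact fun a => (measurable_pi_apply a).comp (measurable_snd.comp
        (measurable_snd.comp (measurable_snd.comp (measurable_snd.comp hc))))
  exact fun s hs => hid hs

lemma ext_code {M N : CountableMG} (h : M.code = N.code) : M = N := by
  obtain ⟨A, s⟩ := M
  obtain ⟨B, t⟩ := N
  obtain ⟨h1, h'⟩ := Prod.mk.inj h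
  obtain ⟨h2, h''⟩ := Prod.mk.inj h'
  obtain ⟨h3, h'''⟩ := Prod.mk.inj h''
  obtain ⟨h4, h5⟩ := Prod.mk.inj h'''
  have hAB : A = B := h1
  subst hAB
  congr 1
  obtain ⟨m, i, f, b⟩ := s
  obtain ⟨m', i', f', b'⟩ := t
  have em : m = m' := by
    funext x y
    refine Option.ext fun z => ?_
    have := iff_of_eq (congrFun h2 (x, y, z))
    exact ⟨fun h => (this.1 ⟨x.2, y.2, z.2, h⟩).choose_spec.choose_spec.choose_spec,
      fun h => (this.2 ⟨x.2, y.2, z.2, h⟩).choose_spec.choose_spec.choose_spec⟩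
  have ei : i = i' := by
    funext x
    have := iff_of_eq (congrFun h3 (x, i x))
    exact (this.1 ⟨x.2, (i x).2, rfl⟩).choose_spec.choose_spec.symm
  have ef : f = f' := by
    funext x y
    have := iff_of_eq (congrFun h4 (x, y, f x y))
    exact (this.1 ⟨x.2, y.2, (f x y).2, rfl⟩).choose_spec.choose_spec.choose_spec.symm
  have eb : b = b' := by
    have := iff_of_eq (congrFun h5 b)
    exact (this.1 ⟨b.2, rfl⟩).choose_spec.symm
  rw [em, ei, ef, eb]

/-- All relations must be supported on the domain and functional; totality is required of the
inversion, the meet and the constant, but not of the partial product. -/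
lemma range_code : range code = {t | (∀ x, t.2.1 x → t.1 x.1 ∧ t.1 x.2.1 ∧ t.1 x.2.2) ∧
    (∀ x, t.2.2.1 x → t.1 x.1 ∧ t.1 x.2) ∧
    (∀ x, t.2.2.2.1 x → t.1 x.1 ∧ t.1 x.2.1 ∧ t.1 x.2.2) ∧
    (∀ x, t.2.2.2.2 x → t.1 x) ∧
    (∀ a b c c', t.2.1 (a, b, c) → t.2.1 (a, b, c') → c = c') ∧
    (∀ a, t.1 a → ∃ b, ∀ b', t.2.2.1 (a, b') ↔ b' = b) ∧
    (∀ a b, t.1 a → t.1 b → ∃ c, ∀ c', t.2.2.2.1 (a, b, c') ↔ c' = c) ∧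
    ∃ b, ∀ b', t.2.2.2.2 b' ↔ b' = b} := by
  classical
  ext ⟨A, m, i, f, b⟩
  constructor
  · rintro ⟨M, hM⟩
    rw [← hM]
    refine ⟨fun x ⟨h1, h2, h3, _⟩ => ⟨h1, h2, h3⟩, fun x ⟨h1, h2, _⟩ => ⟨h1, h2⟩,
      fun x ⟨h1, h2, h3, _⟩ => ⟨h1, h2, h3⟩, fun x ⟨h1, _⟩ => h1, ?_, ?_, ?_, ?_⟩
    · rintro a b c c' ⟨_, _, _, h⟩ ⟨_, _, _, h'⟩
      exact congrArg Subtype.val (Option.some_inj.1 (h.symm.trans h'))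
    · refine fun a ha => ⟨M.ops.inv ⟨a, ha⟩, fun b' => ⟨?_, ?_⟩⟩
      · rintro ⟨_, _, h⟩
        exact congrArg Subtype.val h.symm
      · rintro rfl
        exact ⟨ha, Subtype.property _, rfl⟩
    · refine fun a b ha hb => ⟨M.ops.inf ⟨a, ha⟩ ⟨b, hb⟩, fun b' => ⟨?_, ?_⟩⟩
      · rintro ⟨_, _, _, h⟩
        exact congrArg Subtype.val h.symm
      · rintro rfl
        exact ⟨ha, hb, Subtype.property _, rfl⟩
    · refine ⟨M.ops.bot, fun b' => ⟨?_, ?_⟩⟩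
      · rintro ⟨_, h⟩
        exact congrArg Subtype.val h.symm
      · rintro rfl
        exact ⟨Subtype.property _, rfl⟩
  · rintro ⟨h1, h2, h3, h4, hm, hi, hf, b₀, hb⟩
    dsimp only at h1 h2 h3 h4 hm hi hf hb
    choose i₀ hi using hi
    choose f₀ hf using hf
    have hi' : ∀ x : {a | A a}, A (i₀ x x.2) := fun x => (h2 _ ((hi x x.2 _).2 rfl)).2
    have hf' : ∀ x y : {a | A a}, A (f₀ x y x.2 y.2) := fun x y =>
      (h3 _ ((hf x y x.2 y.2 _).2 rfl)).2.2
    let M : CountableMG := ⟨{a | A a},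
      { mul := fun x y => if h : ∃ c, m (x, y, c) then some ⟨h.choose, (h1 _ h.choose_spec).2.2⟩
          else none
        inv := fun x => ⟨i₀ x x.2, hi' x⟩
        inf := fun x y => ⟨f₀ x y x.2 y.2, hf' x y⟩
        bot := ⟨b₀, h4 _ ((hb _).2 rfl)⟩ }⟩
    refine ⟨M, Prod.ext rfl (Prod.ext (funext fun t => propext ?_) (Prod.ext
      (funext fun t => propext ?_) (Prod.ext (funext fun t => propext ?_)
        (funext fun t => propext ?_))))⟩
    · constructor
      · rintro ⟨ha, hb, hc, h⟩
        change (if h : ∃ c, m (t.1, t.2.1, c) then some (⟨h.choose, (h1 _ h.choose_spec).2.2⟩ :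
          {a | A a}) else none) = some ⟨t.2.2, hc⟩ at h
        split_ifs at h with hex
        have h' : hex.choose = t.2.2 := congrArg Subtype.val (Option.some_inj.1 h)
        have := hex.choose_spec
        rwa [h'] at this
      · intro h
        obtain ⟨ha, hb, hc⟩ := h1 _ h
        refine ⟨ha, hb, hc, ?_⟩
        have hex : ∃ c, m (t.1, t.2.1, c) := ⟨_, h⟩
        change (if h : ∃ c, m (t.1, t.2.1, c) then some (⟨h.choose, (h1 _ h.choose_spec).2.2⟩ :
          {a | A a}) else none) = some ⟨t.2.2, hc⟩
        rw [dif_pos hex]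
        exact congrArg some (Subtype.ext (hm _ _ _ _ hex.choose_spec h))
    · constructor
      · rintro ⟨ha, hb, h⟩
        exact (hi _ ha _).2 (congrArg Subtype.val h).symm
      · intro h
        obtain ⟨ha, hb⟩ := h2 _ h
        exact ⟨ha, hb, Subtype.ext ((hi _ ha _).1 h).symm⟩
    · constructor
      · rintro ⟨ha, hb, hc, h⟩
        exact (hf _ _ ha hb _).2 (congrArg Subtype.val h).symm
      · intro h
        obtain ⟨ha, hb, hc⟩ := h3 _ h
        exact ⟨ha, hb, hc, Subtype.ext ((hf _ _ ha hb _).1 h).symm⟩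
    · constructor
      · rintro ⟨ha, h⟩
        exact (hb _).2 (congrArg Subtype.val h).symm
      · intro h
        exact ⟨h4 _ h, Subtype.ext ((hb _).1 h).symm⟩

instance : StandardBorelSpace CountableMG := by
  refine standardBorelSpace_of_injective (f := code) (fun _ _ => ext_code) comap_code ?_
  rw [range_code]
  have m1 : ∀ a, Measurable fun t : (ℕ → Prop) × (ℕ × ℕ × ℕ → Prop) × (ℕ × ℕ → Prop) ×
      (ℕ × ℕ × ℕ → Prop) × (ℕ → Prop) => t.1 a := by fun_prop
  have m2 : ∀ a, Measurable fun t : (ℕ → Prop) × (ℕ × ℕ × ℕ → Prop) × (ℕ × ℕ → Prop) ×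
      (ℕ × ℕ × ℕ → Prop) × (ℕ → Prop) => t.2.1 a := by fun_prop
  have m3 : ∀ a, Measurable fun t : (ℕ → Prop) × (ℕ × ℕ × ℕ → Prop) × (ℕ × ℕ → Prop) ×
      (ℕ × ℕ × ℕ → Prop) × (ℕ → Prop) => t.2.2.1 a := by fun_prop
  have m4 : ∀ a, Measurable fun t : (ℕ → Prop) × (ℕ × ℕ × ℕ → Prop) × (ℕ × ℕ → Prop) ×
      (ℕ × ℕ × ℕ → Prop) × (ℕ → Prop) => t.2.2.2.1 a := by fun_prop
  have m5 : ∀ a, Measurable fun t : (ℕ → Prop) × (ℕ × ℕ × ℕ → Prop) × (ℕ × ℕ → Prop) ×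
      (ℕ × ℕ × ℕ → Prop) × (ℕ → Prop) => t.2.2.2.2 a := by fun_prop
  refine measurableSet_setOfPred.2 (.and ?_ (.and ?_ (.and ?_ (.and ?_ (.and ?_ (.and ?_
    (.and ?_ ?_)))))))
  · exact .forall fun x => (m2 x).imp ((m1 _).and ((m1 _).and (m1 _)))
  · exact .forall fun x => (m3 x).imp ((m1 _).and (m1 _))
  · exact .forall fun x => (m4 x).imp ((m1 _).and ((m1 _).and (m1 _)))
  · exact .forall fun x => (m5 x).imp (m1 _)
  · exact .forall fun a => .forall fun b => .forall fun c => .forall fun c' =>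
      (m2 _).imp ((m2 _).imp measurable_const)
  · exact .forall fun a => (m1 a).imp (.exists fun b => .forall fun b' =>
      (m3 _).iff measurable_const)
  · exact .forall fun a => .forall fun b => (m1 a).imp ((m1 b).imp (.exists fun c => .forall fun c' =>
      (m4 _).iff measurable_const))
  · exact .exists fun b => .forall fun b' => (m5 _).iff measurable_const

end CountableMG

end BorelDuality

namespace BorelDuality

/-! ### Measurable choices of elements -/

lemma measurable_prop_congr {Ω : Type*} [MeasurableSpace Ω] {P Q : Ω → Prop} (hP : Measurable P)
    (h : ∀ ω, Q ω ↔ P ω) : Measurable Q :=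
  (funext fun ω => propext (h ω) : Q = P) ▸ hP

section Sections

variable {Ω : Type*} [MeasurableSpace Ω] {X : Ω → CountableMG}

/-- The element `τ ω` of the structure `X ω` depends on `ω` in a Borel way. -/
def IsMeasurableElt (τ : ∀ ω, (X ω).carrier) : Prop := Measurable fun ω => (τ ω : ℕ)

lemma measurable_countable_param {ι : Type*} [Countable ι] [MeasurableSpace ι]
    [MeasurableSingletonClass ι] {R : CountableMG → ι → Prop}
    (hR : ∀ t, Measurable fun M => R M t) (hX : Measurable X) {f : Ω → ι} (hf : Measurable f) :
    Measurable fun ω => R (X ω) (f ω) := by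
  have : Measurable fun t : CountableMG × ι => R t.1 t.2 :=
    measurable_from_prod_countable_left fun n => hR n
  exact this.comp (hX.prodMk hf)

open Classical in
/-- The element with number `a`, or the least element if there is none. -/
noncomputable def elt (M : CountableMG) (a : ℕ) : M.carrier :=
  if h : a ∈ M.carrier then ⟨a, h⟩ else M.ops.bot

lemma elt_of_mem {M : CountableMG} {a : ℕ} (h : a ∈ M.carrier) : elt M a = ⟨a, h⟩ := dif_pos h

lemma elt_of_notMem {M : CountableMG} {a : ℕ} (h : a ∉ M.carrier) : elt M a = M.ops.bot := dif_neg h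

lemma elt_coe {M : CountableMG} (A : M.carrier) : elt M A = A := elt_of_mem A.2

lemma isMeasurableElt_of_rel {τ : ∀ ω, (X ω).carrier} {R : Ω → ℕ → Prop}
    (hR : ∀ a, Measurable fun ω => R ω a) (h : ∀ ω a, (τ ω : ℕ) = a ↔ R ω a) :
    IsMeasurableElt τ :=
  measurable_to_countable' fun a => measurableSet_setOfPred.2
    (measurable_prop_congr (hR a) fun ω => h ω a)

lemma measurable_forall_elt {P : ∀ ω, (X ω).carrier → Prop}
    (hP : ∀ a, Measurable fun ω => P ω (elt (X ω) a)) : Measurable fun ω => ∀ A, P ω A :=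
  measurable_prop_congr (Measurable.forall hP) fun _ =>
    ⟨fun h _ => h _, fun h A => elt_coe A ▸ h A⟩

lemma measurable_exists_elt {P : ∀ ω, (X ω).carrier → Prop}
    (hP : ∀ a, Measurable fun ω => P ω (elt (X ω) a)) : Measurable fun ω => ∃ A, P ω A :=
  measurable_prop_congr (Measurable.exists hP) fun _ =>
    ⟨fun ⟨A, h⟩ => ⟨A, (elt_coe A).symm ▸ h⟩, fun ⟨_, h⟩ => ⟨_, h⟩⟩

lemma IsMeasurableElt.eq {τ τ' : ∀ ω, (X ω).carrier} (hτ : IsMeasurableElt τ)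
    (hτ' : IsMeasurableElt τ') : Measurable fun ω => τ ω = τ' ω :=
  measurable_prop_congr (measurableSet_setOfPred.1 (measurableSet_eq_fun hτ hτ')) fun _ =>
    Subtype.ext_iff

variable (hX : Measurable X)
include hX

lemma isMeasurableElt_bot : IsMeasurableElt fun ω => (X ω).ops.bot :=
  isMeasurableElt_of_rel (fun a => (CountableMG.measurable_botRel a).comp hX) fun _ _ =>
    ⟨fun h => ⟨h ▸ Subtype.property _, Subtype.ext h⟩, fun ⟨_, h⟩ => congrArg Subtype.val h⟩

lemma isMeasurableElt_elt (a : ℕ) : IsMeasurableElt fun ω => elt (X ω) a := by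
  have hm := (CountableMG.measurable_mem_carrier a).comp hX
  refine isMeasurableElt_of_rel (R := fun ω b => (a ∈ (X ω).carrier ∧ a = b) ∨
    (a ∉ (X ω).carrier ∧ ((X ω).ops.bot : ℕ) = b)) (fun b => (hm.and measurable_const).or
    (hm.not.and ?_)) fun ω b => ?_
  · exact measurableSet_setOfPred.1 (measurableSet_eq_fun (isMeasurableElt_bot hX) measurable_const)
  · by_cases h : a ∈ (X ω).carrier
    · simp [h, elt_of_mem h]
    · simp [h, elt_of_notMem h]

variable {τ τ' τ'' : ∀ ω, (X ω).carrier} (hτ : IsMeasurableElt τ) (hτ' : IsMeasurableElt τ')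
  (hτ'' : IsMeasurableElt τ'')
include hτ

lemma IsMeasurableElt.inv : IsMeasurableElt fun ω => (X ω).ops.inv (τ ω) :=
  isMeasurableElt_of_rel (R := fun ω a => (X ω).InvRel (τ ω, a))
    (fun _ => measurable_countable_param CountableMG.measurable_invRel hX
      (Measurable.prodMk hτ measurable_const)) fun _ _ =>
    ⟨fun h => ⟨(τ _).2, h ▸ Subtype.property _, Subtype.ext h⟩,
      fun ⟨_, _, h⟩ => congrArg Subtype.val h⟩

include hτ'

lemma IsMeasurableElt.inf : IsMeasurableElt fun ω => (X ω).ops.inf (τ ω) (τ' ω) :=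
  isMeasurableElt_of_rel (R := fun ω a => (X ω).InfRel (τ ω, τ' ω, a))
    (fun _ => measurable_countable_param CountableMG.measurable_infRel hX
      (Measurable.prodMk hτ (Measurable.prodMk hτ' measurable_const))) fun _ _ =>
    ⟨fun h => ⟨(τ _).2, (τ' _).2, h ▸ Subtype.property _, Subtype.ext h⟩,
      fun ⟨_, _, _, h⟩ => congrArg Subtype.val h⟩

lemma IsMeasurableElt.le : Measurable fun ω => (X ω).ops.Le (τ ω) (τ' ω) :=
  (hτ.inf hX hτ').eq hτ

include hτ''

lemma IsMeasurableElt.mul : Measurable fun ω => (X ω).ops.mul (τ ω) (τ' ω) = some (τ'' ω) :=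
  measurable_prop_congr (measurable_countable_param CountableMG.measurable_mulRel hX
      (f := fun ω => ((τ ω : ℕ), (τ' ω : ℕ), (τ'' ω : ℕ)))
      (Measurable.prodMk hτ (Measurable.prodMk hτ' hτ''))) fun _ =>
    ⟨fun h => ⟨(τ _).2, (τ' _).2, (τ'' _).2, h⟩, fun ⟨_, _, _, h⟩ => h⟩

omit hτ' hτ''

lemma IsMeasurableElt.isIdem : Measurable fun ω => (X ω).ops.IsIdem (τ ω) :=
  (hτ.eq (isMeasurableElt_bot hX)).not.and (hτ.mul hX hτ hτ)

end Sections

/-- Definedness and iterated partial products become existential quantifiers over values, so that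
the axioms are first-order in the graphs of the operations. -/
lemma MGOps.isMeetGroupoid_iff {M : Type} (s : MGOps M) : s.IsMeetGroupoid ↔
    (∀ A B C Z, (∃ X, s.mul A B = some X ∧ s.mul X C = some Z) ↔
      ∃ Y, s.mul B C = some Y ∧ s.mul A Y = some Z) ∧
    (∀ A, ∃ C, s.mul A (s.inv A) = some C) ∧
    (∀ A, ∃ C, s.mul (s.inv A) A = some C) ∧
    (∀ A B C, s.mul A B = some C → s.mul C (s.inv B) = some A) ∧
    (∀ A B C, s.mul A B = some C → s.mul (s.inv A) C = some B) ∧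
    (∀ A B C, s.inf (s.inf A B) C = s.inf A (s.inf B C)) ∧
    (∀ A B, s.inf A B = s.inf B A) ∧
    (∀ A, s.inf A A = A) ∧
    (∀ A, s.Le s.bot A) ∧
    s.inv s.bot = s.bot ∧
    s.mul s.bot s.bot = some s.bot ∧
    (∀ A, A ≠ s.bot → ∀ C, ¬ s.mul s.bot A = some C) ∧
    (∀ A, A ≠ s.bot → ∀ C, ¬ s.mul A s.bot = some C) ∧
    (∀ U V, s.IsIdem U → s.IsIdem V → s.inf U V ≠ s.bot) ∧
    (∀ A B, s.Le A B ↔ s.Le (s.inv A) (s.inv B)) ∧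
    ∀ A₀ A₁ B₀ B₁ C₀ C₁, s.mul A₀ B₀ = some C₀ → s.mul A₁ B₁ = some C₁ →
      s.inf A₀ A₁ ≠ s.bot → s.inf B₀ B₁ ≠ s.bot →
      s.mul (s.inf A₀ A₁) (s.inf B₀ B₁) = some (s.inf C₀ C₁) := by
  constructor
  · intro h
    refine ⟨fun A B C Z => ?_, fun A => Option.isSome_iff_exists.1 (h.mul_inv_defined A),
      fun A => Option.isSome_iff_exists.1 (h.inv_mul_defined A), h.cancel_right, h.cancel_left,
      h.inf_assoc, h.inf_comm, h.inf_idem, h.bot_le, h.inv_bot, h.bot_mul_bot,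
      fun A hA C => by simp [h.bot_mul A hA], fun A hA C => by simp [h.mul_bot A hA], h.idem_inf,
      h.inv_le_inv, h.inf_mul_inf⟩
    rw [← Option.bind_eq_some_iff, h.assoc A B C, Option.bind_eq_some_iff]
  · rintro ⟨h1, h2, h3, h4, h5, h6, h7, h8, h9, h10, h11, h12, h13, h14, h15, h16⟩
    refine ⟨fun A B C => Option.ext fun Z => ?_, fun A => Option.isSome_iff_exists.2 (h2 A),
      fun A => Option.isSome_iff_exists.2 (h3 A), h4, h5, h6, h7, h8, h9, h10, h11,
      fun A hA => Option.eq_none_iff_forall_ne_some.2 (h12 A hA),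
      fun A hA => Option.eq_none_iff_forall_ne_some.2 (h13 A hA), h14, h15, h16⟩
    rw [Option.bind_eq_some_iff, Option.bind_eq_some_iff, h1]

lemma MGOps.isFull_iff {M : Type} (s : MGOps M) : s.IsFull ↔ s.IsMeetGroupoid ∧
    (∀ U V A, s.IsIdem U → s.IsIdem V → s.Le U V → s.mul A U = some A →
      ∃ B, (s.mul B V = some B ∧ s.Le A B) ∧ ∀ C, s.mul C V = some C ∧ s.Le A C → C = B) ∧
    (∀ U V A, s.IsIdem U → s.IsIdem V → s.Le U V → s.mul U A = some A →
      ∃ B, (s.mul V B = some B ∧ s.Le A B) ∧ ∀ C, s.mul V C = some C ∧ s.Le A C → C = B) ∧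
    (∀ U V B, s.IsIdem U → s.IsIdem V → s.Le U V → U ≠ V → s.mul B V = some B →
      ∃ A A', A ≠ A' ∧ s.mul A U = some A ∧ s.mul A' U = some A' ∧ s.Le A B ∧ s.Le A' B) ∧
    (∀ U V B, s.IsIdem U → s.IsIdem V → s.Le U V → U ≠ V → s.mul V B = some B →
      ∃ A A', A ≠ A' ∧ s.mul U A = some A ∧ s.mul U A' = some A' ∧ s.Le A B ∧ s.Le A' B) :=
  ⟨fun h => ⟨h.1, h.2, h.3, h.4, h.5⟩, fun ⟨h1, h2, h3, h4, h5⟩ => ⟨h1, h2, h3, h4, h5⟩⟩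

theorem measurable_isFull : Measurable fun M : CountableMG => M.ops.IsFull := by
  have hX : Measurable fun M : CountableMG => M := measurable_id
  have he := isMeasurableElt_elt hX
  have hb := isMeasurableElt_bot hX
  simp only [MGOps.isFull_iff, MGOps.isMeetGroupoid_iff]
  -- Recursion along the formula: quantifiers over the countable structure and connectives preserve
  -- Borelness, down to atomic relations between Borel terms.
  repeat' first
    | exact he _
    | exact hb
    | exact isMeasurableElt_elt hX _
    | refine measurable_forall_elt fun _ => ?_
    | refine measurable_exists_elt fun _ => ?_
    | refine Measurable.and ?_ ?_
    | refine Measurable.not ?_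
    | refine Measurable.imp ?_ ?_
    | refine Measurable.iff ?_ ?_
    | refine IsMeasurableElt.isIdem hX ?_
    | refine IsMeasurableElt.le hX ?_ ?_
    | refine IsMeasurableElt.mul hX ?_ ?_ ?_
    | refine IsMeasurableElt.inf hX ?_ ?_
    | refine IsMeasurableElt.inv hX ?_
    | refine IsMeasurableElt.eq ?_ ?_

end BorelDuality

namespace BorelDuality

/-! ### The group of a full meet groupoid depends on it in a Borel way -/

namespace MGOps

variable {M : Type} {s : MGOps M}

/-- If `p` takes the source of `A` to `A`, it takes the source of any `X` above `A` to `X`. Thus one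
value of `p` determines it on every `B` whose target lies above the source of `A`. -/
lemma IsFull.leftAut_eq_of_mul (h : s.IsFull) {p : Equiv.Perm M} (hp : p ∈ s.leftAut) {A B C X : M}
    (hA : A ≠ s.bot) (hpA : p (s.src A) = A) (hAX : s.Le A X) (hC : s.mul X B = some C) :
    p B = C := by
  have hX := h.ne_bot_of_le hAX hA
  have h1 : p (s.src X) = X := by
    refine h.eq_of_src_eq hA ?_ hAX ?_
    · have := leftAut_le hp (h.src_le_src hA hAX)
      rwa [hpA] at this
    · rw [leftAut_src h.toIsMeetGroupoid hp, h.src_src]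
  have h2 := leftAut_tgt h.toIsMeetGroupoid hp B
  rw [← h.src_of_mul hC, h1, hC, Option.some_inj] at h2
  exact h2.symm

lemma IsMeetGroupoid.exists_isIdem_le (h : s.IsMeetGroupoid) {U₀ : M} (hU₀ : s.IsIdem U₀)
    {ι : Type*} (F : Finset ι) (b : ι → M) : ∃ U, s.IsIdem U ∧ ∀ i ∈ F, b i ≠ s.bot →
      s.Le U (s.tgt (b i)) := by
  classical
  induction F using Finset.induction_on with
  | empty => exact ⟨U₀, hU₀, by simp⟩
  | insert i F _ ih =>
    obtain ⟨U, hU, hUF⟩ := ih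
    by_cases hi : b i = s.bot
    · refine ⟨U, hU, fun j hj hbj => ?_⟩
      rcases Finset.mem_insert.1 hj with rfl | hj
      · exact (hbj hi).elim
      · exact hUF j hj hbj
    · refine ⟨_, h.isIdem_inf hU (h.isIdem_tgt hi), fun j hj hbj => ?_⟩
      rcases Finset.mem_insert.1 hj with rfl | hj
      · exact h.inf_le_right _ _
      · exact h.le_trans (h.inf_le_left _ _) (hUF j hj hbj)

end MGOps

/-- The quantifier over permutations is traded for one over elements of `M`. For given `p`, the
element `A` is the image of an idempotent below the targets of all nonempty elements mentioned in
`s`; for given `A`, a left automorphism taking its source to `A` meets all the prescriptions. -/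
lemma autGroup_inter_cylinder_nonempty_iff {M : CountableMG} (h : M.ops.IsFull)
    (s : Finset (ℕ × ℕ)) : ((M.autGroup : Set (Equiv.Perm ℕ)) ∩ cylinder s).Nonempty ↔
      ∃ A : M.carrier, ∀ t ∈ s, (t.1 ∉ M.carrier ∧ t.2 = t.1) ∨
        (t.1 ∈ M.carrier ∧ t.2 ∈ M.carrier ∧
          ((elt M t.1 = M.ops.bot ∧ elt M t.2 = M.ops.bot) ∨
            (A ≠ M.ops.bot ∧ ∃ X, M.ops.Le A X ∧
              M.ops.mul X (elt M t.1) = some (elt M t.2)))) := by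
  have hm := h.toIsMeetGroupoid
  constructor
  · rintro ⟨_, ⟨p, hp, rfl⟩, hs⟩
    have hval : ∀ t ∈ s, ∀ ht : t.1 ∈ M.carrier, (p ⟨t.1, ht⟩ : ℕ) = t.2 := fun t hts ht => by
      rw [← M.extendPerm_coe]
      exact hs t hts
    have hmain : ∃ A, ∀ t ∈ s, ∀ ht : t.1 ∈ M.carrier, (⟨t.1, ht⟩ : M.carrier) ≠ M.ops.bot →
        A ≠ M.ops.bot ∧ ∃ X, M.ops.Le A X ∧ M.ops.mul X ⟨t.1, ht⟩ = some (p ⟨t.1, ht⟩) := by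
      by_cases hne : ∃ B, B ≠ M.ops.bot
      · obtain ⟨B, hB⟩ := hne
        obtain ⟨U, hU, hUs⟩ := hm.exists_isIdem_le (hm.isIdem_src hB) s fun t => elt M t.1
        refine ⟨p U, fun t hts ht hbt => ⟨MGOps.leftAut_ne_bot hm hp hU.1, _, ?_,
          MGOps.leftAut_tgt hm hp _⟩⟩
        have := hUs t hts
        rw [elt_of_mem ht] at this
        exact MGOps.leftAut_le hp (this hbt)
      -- If `∅` is the only element there is nothing to determine and any `A` will do.
      · exact ⟨M.ops.bot, fun t _ _ hbt => (hne ⟨_, hbt⟩).elim⟩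
    obtain ⟨A, hA⟩ := hmain
    refine ⟨A, fun t hts => ?_⟩
    by_cases ht : t.1 ∈ M.carrier
    · have hv := hval t hts ht
      have ht2 : t.2 ∈ M.carrier := hv ▸ Subtype.property _
      have hv' : p ⟨t.1, ht⟩ = ⟨t.2, ht2⟩ := Subtype.ext hv
      refine Or.inr ⟨ht, ht2, ?_⟩
      rw [elt_of_mem ht, elt_of_mem ht2, ← hv']
      by_cases hbt : (⟨t.1, ht⟩ : M.carrier) = M.ops.bot
      · exact Or.inl ⟨hbt, by rw [hbt, MGOps.leftAut_bot hm hp]⟩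
      · exact Or.inr (hA t hts ht hbt)
    · refine Or.inl ⟨ht, ?_⟩
      rw [← show M.extendPerm p t.1 = t.2 from hs t hts, M.extendPerm_of_notMem p ht]
  · rintro ⟨A, hA⟩
    have hp : ∃ p ∈ M.ops.leftAut, A ≠ M.ops.bot → p (M.ops.src A) = A := by
      by_cases h0 : A = M.ops.bot
      · exact ⟨1, one_mem _, fun h' => (h' h0).elim⟩
      · obtain ⟨p, hp, hpA⟩ := h.exists_leftAut h0
        exact ⟨p, hp, fun _ => hpA⟩
    obtain ⟨p, hp, hpA⟩ := hp
    refine ⟨M.extendPerm p, ⟨p, hp, rfl⟩, fun t hts => ?_⟩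
    rcases hA t hts with ⟨ht, hte⟩ | ⟨ht, ht2, h'⟩
    · rw [M.extendPerm_of_notMem p ht, hte]
    · rw [elt_of_mem ht, elt_of_mem ht2] at h'
      have : p ⟨t.1, ht⟩ = ⟨t.2, ht2⟩ := by
        rcases h' with ⟨h1, h2⟩ | ⟨hA0, X, hAX, hX⟩
        · rw [h1, h2, MGOps.leftAut_bot hm hp]
        · exact h.leftAut_eq_of_mul hp hA0 (hpA hA0) hAX hX
      exact (M.extendPerm_coe p ⟨t.1, ht⟩).trans (congrArg Subtype.val this)

theorem measurable_autGroup {Ω : Type*} [MeasurableSpace Ω] {X : Ω → CountableMG}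
    (hX : Measurable X) (hfull : ∀ ω, (X ω).ops.IsFull) : Measurable fun ω => (X ω).autGroup := by
  refine measurable_subgroup_of_cylinder fun s => ?_
  simp only [fun ω => autGroup_inter_cylinder_nonempty_iff (hfull ω) s]
  have hc := fun a => (CountableMG.measurable_mem_carrier a).comp hX
  have he := isMeasurableElt_elt hX
  have hb := isMeasurableElt_bot hX
  refine measurable_exists_elt fun a => .forall fun t => .forall fun _ => .or ?_ ?_
  · exact (hc _).not.and measurable_const
  · refine (hc _).and ((hc _).and (.or ?_ ?_))
    · exact ((he _).eq hb).and ((he _).eq hb)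
    · exact ((he _).eq hb).not.and (measurable_exists_elt fun b =>
        ((he a).le hX (he b)).and ((he b).mul hX (he _) (he _)))

/-! ### The category of meet groupoids is a Borel category -/

variable {Gr : Set (ClosedSubgroup (Equiv.Perm ℕ))}
  {S : ∀ G : ClosedSubgroup (Equiv.Perm ℕ), Set (Subgroup G)}

lemma isClopen_stabilizer (G : ClosedSubgroup (Equiv.Perm ℕ)) (a : ℕ) :
    IsClopen {p : G | (p : Equiv.Perm ℕ) a = a} :=
  (isClopen_apply_eq a a).preimage continuous_subtype_val

lemma CosetSystem.isClopen_sub (σ : CosetSystem Gr S) (hS : InvariantCountableBasis Gr S) (i : ℕ)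
    (G : GrCat Gr) : IsClopen (σ.sub i G : Set G.grp) := by
  have hO := (hS.isOpenBasis G.mem).isOpen _ ((σ.range_sub G).subset (mem_range_self i))
  exact ⟨(σ.sub i G).isClosed_of_isOpen hO, hO⟩

/-- Both the enumerated subgroups and the stabilizers are clopen, so their equality can be tested on
the dense sequence. -/
lemma CosetSystem.basis_iff (σ : CosetSystem Gr S) (hS : InvariantCountableBasis Gr S)
    (M : CountableMG) (hM : M.autGroup ∈ Gr) :
    (∀ V : Subgroup M.autGroup, V ∈ interClosure (S M.autGroup) ↔
      ∃ U : M.carrier, M.ops.IsIdem U ∧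
        (V : Set M.autGroup) = {p : M.autGroup | (p : Equiv.Perm ℕ) U = U}) ↔
    (∀ i, ∃ U : M.carrier, M.ops.IsIdem U ∧ ∀ k, densePt k ⟨M.autGroup, hM⟩ ∈
      (σ.sub i ⟨M.autGroup, hM⟩ : Set M.autGroup) ↔ dense k M.autGroup (U : ℕ) = U) ∧
    ∀ U : M.carrier, M.ops.IsIdem U → ∃ i, ∀ k, densePt k ⟨M.autGroup, hM⟩ ∈
      (σ.sub i ⟨M.autGroup, hM⟩ : Set M.autGroup) ↔ dense k M.autGroup (U : ℕ) = U := by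
  have key : ∀ i (U : M.carrier), (∀ k, densePt k ⟨M.autGroup, hM⟩ ∈
      (σ.sub i ⟨M.autGroup, hM⟩ : Set M.autGroup) ↔ dense k M.autGroup (U : ℕ) = U) ↔
      (σ.sub i ⟨M.autGroup, hM⟩ : Set M.autGroup) =
        {p : M.autGroup | (p : Equiv.Perm ℕ) U = U} := by
    refine fun i U => ⟨fun h => ?_, fun h k => by rw [h]; rfl⟩
    exact eq_of_dense _ (σ.isClopen_sub hS i ⟨M.autGroup, hM⟩) (isClopen_stabilizer _ _) h
  simp only [key]
  have hr := σ.range_sub ⟨M.autGroup, hM⟩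
  constructor
  · refine fun h => ⟨fun i => (h _).1 (hr.subset (mem_range_self i)), fun U hU => ?_⟩
    let V : Subgroup M.autGroup :=
      (MulAction.stabilizer (Equiv.Perm ℕ) (U : ℕ)).subgroupOf M.autGroup.toSubgroup
    obtain ⟨i, hi⟩ := hr.superset ((h V).2 ⟨U, hU, rfl⟩)
    exact ⟨i, congrArg (fun W : Subgroup M.autGroup => (W : Set M.autGroup)) hi⟩
  · rintro ⟨h1, h2⟩ V
    constructor
    · intro hV
      obtain ⟨i, rfl⟩ := hr.superset hV
      exact h1 i
    · rintro ⟨U, hU, hV⟩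
      obtain ⟨i, hi⟩ := h2 U hU
      rw [SetLike.coe_injective (hV.trans hi.symm)]
      exact hr.subset (mem_range_self i)

lemma str_injective : Function.Injective (MCat.str : MCat Gr S → _) := by
  rintro ⟨M, _, _, _⟩ ⟨N, _, _, _⟩ h
  cases h
  rfl

lemma measurable_str : Measurable (MCat.str : MCat Gr S → _) := comap_measurable _

theorem standardBorelSpace_mCat (hGr : MeasurableSet Gr) (hS : InvariantCountableBasis Gr S) :
    StandardBorelSpace (MCat Gr S) := by
  obtain ⟨σ⟩ := hS.nonempty_cosetSystem hGr
  refine standardBorelSpace_of_injective str_injective rfl ?_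
  -- The conditions are imposed on nested subtypes: the group depends on the structure in a Borel
  -- way only once fullness is known, and its subgroups are enumerated only once it lies in `Gr`.
  let F : Set CountableMG := {M | M.ops.IsFull}
  have hF : MeasurableSet F := measurableSet_setOfPred.2 measurable_isFull
  let F' : Set F := {M | M.1.autGroup ∈ Gr}
  have hF' : MeasurableSet F' := measurable_autGroup measurable_subtype_coe (fun M => M.2) hGr
  let X : F' → CountableMG := fun M => M.1.1
  have hX : Measurable X := measurable_subtype_coe.comp measurable_subtype_coe
  let Y : F' → GrCat Gr := fun M => ⟨M.1.1.autGroup, M.2⟩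
  have hY : Measurable Y := measurable_comap_iff.2 (measurable_autGroup hX fun M => M.1.2)
  let F'' : Set F' := {M | (∀ i, ∃ U : (X M).carrier, (X M).ops.IsIdem U ∧ ∀ k, densePt k (Y M) ∈
      (σ.sub i (Y M) : Set (Y M).grp) ↔ dense k (Y M).grp (U : ℕ) = U) ∧
    ∀ U : (X M).carrier, (X M).ops.IsIdem U → ∃ i, ∀ k, densePt k (Y M) ∈
      (σ.sub i (Y M) : Set (Y M).grp) ↔ dense k (Y M).grp (U : ℕ) = U}
  have hF'' : MeasurableSet F'' := by
    have hkey : ∀ i k a, Measurable fun M : F' => densePt k (Y M) ∈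
        (σ.sub i (Y M) : Set (Y M).grp) ↔ dense k (Y M).grp (elt (X M) a : ℕ) = elt (X M) a := by
      intro i k a
      have he : Measurable fun M => (elt (X M) a : ℕ) := isMeasurableElt_elt hX a
      refine ((σ.measurable_sub i).comp hY (measurable_densePt hY k)).iff
        (measurableSet_setOfPred.1 (measurableSet_eq_fun ?_ he))
      exact Measurable.perm_apply ((measurable_dense k).comp (measurable_grp.comp hY)) he
    refine measurableSet_setOfPred.2 (.and (.forall fun i => measurable_exists_elt fun a => ?_)
      (measurable_forall_elt fun a => ?_))
    · exact ((isMeasurableElt_elt hX a).isIdem hX).and (.forall fun k => hkey i k a)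
    · exact ((isMeasurableElt_elt hX a).isIdem hX).imp (.exists fun i => .forall fun k => hkey i k a)
  have hrange : range (MCat.str : MCat Gr S → _) =
      Subtype.val '' (Subtype.val '' F'' : Set F) := by
    ext M
    constructor
    · rintro ⟨N, rfl⟩
      exact ⟨⟨N.str, N.full⟩, ⟨⟨⟨N.str, N.full⟩, N.aut_mem⟩,
        (σ.basis_iff hS _ N.aut_mem).1 N.basis, rfl⟩, rfl⟩
    · rintro ⟨_, ⟨N, hN, rfl⟩, rfl⟩
      exact ⟨⟨N.1.1, N.1.2, N.2, (σ.basis_iff hS _ N.2).2 hN⟩, rfl⟩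
  rw [hrange]
  exact hF.subtype_image (hF'.subtype_image hF'')

end BorelDuality

namespace BorelDuality

variable {Gr : Set (ClosedSubgroup (Equiv.Perm ℕ))}
  {S : ∀ G : ClosedSubgroup (Equiv.Perm ℕ), Set (Subgroup G)}

/-! ### Isomorphisms of meet groupoids -/

lemma measurable_mgArrow_left : Measurable fun f : Arrow (MCat Gr S) => (f.left : MCat Gr S) :=
  measurable_fst.comp (comap_measurable _)

lemma measurable_mgArrow_right : Measurable fun f : Arrow (MCat Gr S) => (f.right : MCat Gr S) :=
  (measurable_fst.comp measurable_snd).comp (comap_measurable _)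

/-- The graph of a morphism. -/
def mgGraph (f : Arrow (MCat Gr S)) : ℕ × ℕ → Prop :=
  mgIsoGraph (show MGOps.Iso f.left.str.ops f.right.str.ops from f.hom)

lemma measurable_mgGraph (t : ℕ × ℕ) : Measurable fun f : Arrow (MCat Gr S) => mgGraph f t :=
  (measurable_pi_apply t).comp
    ((measurable_snd.comp measurable_snd).comp (comap_measurable _))

lemma measurable_to_mgArrow {Ω : Type*} [MeasurableSpace Ω] {F : Ω → Arrow (MCat Gr S)}
    (hl : Measurable fun ω => (F ω).left) (hr : Measurable fun ω => (F ω).right)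
    (h : ∀ t, Measurable fun ω => mgGraph (F ω) t) : Measurable F :=
  measurable_comap_iff.2 (hl.prodMk (hr.prodMk (measurable_pi_lambda _ h)))

lemma mgIsoGraph_iff {M N : CountableMG} (e : MGOps.Iso M.ops N.ops) (A : M.carrier)
    (B : N.carrier) : mgIsoGraph e (A, B) ↔ e.equiv A = B := by
  constructor
  · rintro ⟨A', hA', hB⟩
    rw [← Subtype.val_inj.1 hA']
    exact Subtype.ext hB
  · rintro rfl
    exact ⟨A, rfl, rfl⟩

lemma mgIsoGraph_mem {M N : CountableMG} {e : MGOps.Iso M.ops N.ops} {t : ℕ × ℕ}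
    (h : mgIsoGraph e t) : t.1 ∈ M.carrier ∧ t.2 ∈ N.carrier := by
  obtain ⟨A, hA, hB⟩ := h
  exact ⟨hA ▸ A.2, hB ▸ Subtype.property _⟩

lemma mgIsoGraph_injective {M N : CountableMG} :
    Function.Injective (mgIsoGraph : MGOps.Iso M.ops N.ops → _) := by
  intro e f h
  refine MGOps.Iso.ext (Equiv.ext fun A => ?_)
  rw [← mgIsoGraph_iff e, h, mgIsoGraph_iff]

/-- `R` is the graph of an isomorphism from `M` to `N`. -/
structure IsMGIsoGraph (M N : CountableMG) (R : ℕ × ℕ → Prop) : Prop where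
  mem : ∀ t, R t → t.1 ∈ M.carrier ∧ t.2 ∈ N.carrier
  fst : ∀ A : M.carrier, ∃ B : N.carrier, R (A, B)
  snd : ∀ B : N.carrier, ∃ A : M.carrier, R (A, B)
  right_unique : ∀ a b b', R (a, b) → R (a, b') → b = b'
  left_unique : ∀ a a' b, R (a, b) → R (a', b) → a = a'
  mul : ∀ (A B C : M.carrier) (A' B' C' : N.carrier), R (A, A') → R (B, B') → R (C, C') →
    (M.ops.mul A B = some C ↔ N.ops.mul A' B' = some C')
  inv : ∀ (A : M.carrier) (A' : N.carrier), R (A, A') → R (M.ops.inv A, N.ops.inv A')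
  inf : ∀ (A B : M.carrier) (A' B' : N.carrier), R (A, A') → R (B, B') →
    R (M.ops.inf A B, N.ops.inf A' B')

lemma isMGIsoGraph_mgIsoGraph {M N : CountableMG} (e : MGOps.Iso M.ops N.ops) :
    IsMGIsoGraph M N (mgIsoGraph e) where
  mem _ h := mgIsoGraph_mem h
  fst A := ⟨e.equiv A, (mgIsoGraph_iff e _ _).2 rfl⟩
  snd B := ⟨e.equiv.symm B, (mgIsoGraph_iff e _ _).2 (e.equiv.apply_symm_apply B)⟩
  right_unique := by
    rintro a b b' ⟨A, hA, hB⟩ ⟨A', hA', hB'⟩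
    dsimp only at hA hB hA' hB'
    rw [← hB, ← hB', Subtype.val_inj.1 (hA.trans hA'.symm)]
  left_unique := by
    rintro a a' b ⟨A, hA, hB⟩ ⟨A', hA', hB'⟩
    dsimp only at hA hB hA' hB'
    rw [← hA, ← hA', e.equiv.injective (Subtype.val_inj.1 (hB.trans hB'.symm))]
  mul A B C A' B' C' := by
    simp only [mgIsoGraph_iff]
    rintro rfl rfl rfl
    rw [e.map_mul, Option.map_eq_some_iff]
    simp
  inv A A' := by
    simp only [mgIsoGraph_iff]
    rintro rfl
    exact e.map_inv A
  inf A B A' B' := by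
    simp only [mgIsoGraph_iff]
    rintro rfl rfl
    exact e.map_inf A B

lemma IsMGIsoGraph.exists_iso {M N : CountableMG} {R : ℕ × ℕ → Prop} (h : IsMGIsoGraph M N R) :
    ∃ e : MGOps.Iso M.ops N.ops, mgIsoGraph e = R := by
  choose f hf using h.fst
  choose g hg using h.snd
  let e : M.carrier ≃ N.carrier := ⟨f, g, fun A => Subtype.ext (h.left_unique _ _ _ (hg _) (hf A)),
    fun B => Subtype.ext (h.right_unique _ _ _ (hf _) (hg B))⟩
  refine ⟨⟨e, fun A B => Option.ext fun C' => ?_, fun A => ?_, fun A B => ?_⟩, ?_⟩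
  · obtain ⟨C, rfl⟩ := e.surjective C'
    rw [Option.map_eq_some_iff]
    simp only [e.injective.eq_iff, exists_eq_right]
    exact (h.mul A B C _ _ _ (hf A) (hf B) (hf C)).symm
  · exact Subtype.ext (h.right_unique _ _ _ (hf _) (h.inv _ _ (hf A)))
  · exact Subtype.ext (h.right_unique _ _ _ (hf _) (h.inf _ _ _ _ (hf A) (hf B)))
  · ext ⟨a, b⟩
    constructor
    · rintro ⟨A, hA, hB⟩
      dsimp only at hA hB
      rw [← hA, ← hB]
      exact hf A
    · intro hab
      obtain ⟨ha, hb⟩ := h.mem _ hab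
      exact ⟨⟨a, ha⟩, rfl, h.right_unique _ _ _ (hf ⟨a, ha⟩) hab⟩

lemma IsMeasurableElt.graph {Ω : Type*} [MeasurableSpace Ω] {X Y : Ω → CountableMG}
    {R : Ω → ℕ × ℕ → Prop} (hR : ∀ t, Measurable fun ω => R ω t) {τ : ∀ ω, (X ω).carrier}
    {τ' : ∀ ω, (Y ω).carrier} (hτ : IsMeasurableElt τ) (hτ' : IsMeasurableElt τ') :
    Measurable fun ω => R ω (τ ω, τ' ω) := by
  have : Measurable fun t : Ω × ℕ × ℕ => R t.1 t.2 :=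
    measurable_from_prod_countable_left fun n => hR n
  exact this.comp (measurable_id.prodMk (Measurable.prodMk hτ hτ'))

lemma measurable_isMGIsoGraph {Ω : Type*} [MeasurableSpace Ω] {X Y : Ω → CountableMG}
    (hX : Measurable X) (hY : Measurable Y) {R : Ω → ℕ × ℕ → Prop}
    (hR : ∀ t, Measurable fun ω => R ω t) : Measurable fun ω => IsMGIsoGraph (X ω) (Y ω) (R ω) := by
  have hx := isMeasurableElt_elt hX
  have hy := isMeasurableElt_elt hY
  have hcx := fun a => (CountableMG.measurable_mem_carrier a).comp hX
  have hcy := fun a => (CountableMG.measurable_mem_carrier a).comp hY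
  have hxy := fun a b => IsMeasurableElt.graph hR (hx a) (hy b)
  refine measurable_prop_congr (P := fun ω =>
    (∀ t, R ω t → t.1 ∈ (X ω).carrier ∧ t.2 ∈ (Y ω).carrier) ∧
    (∀ A : (X ω).carrier, ∃ B : (Y ω).carrier, R ω (A, B)) ∧
    (∀ B : (Y ω).carrier, ∃ A : (X ω).carrier, R ω (A, B)) ∧
    (∀ a b b', R ω (a, b) → R ω (a, b') → b = b') ∧
    (∀ a a' b, R ω (a, b) → R ω (a', b) → a = a') ∧
    (∀ (A B C : (X ω).carrier) (A' B' C' : (Y ω).carrier), R ω (A, A') → R ω (B, B') →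
      R ω (C, C') → ((X ω).ops.mul A B = some C ↔ (Y ω).ops.mul A' B' = some C')) ∧
    (∀ (A : (X ω).carrier) (A' : (Y ω).carrier), R ω (A, A') →
      R ω ((X ω).ops.inv A, (Y ω).ops.inv A')) ∧
    (∀ (A B : (X ω).carrier) (A' B' : (Y ω).carrier), R ω (A, A') → R ω (B, B') →
      R ω ((X ω).ops.inf A B, (Y ω).ops.inf A' B'))) ?_
    fun ω => ⟨fun ⟨h1, h2, h3, h4, h5, h6, h7, h8⟩ => ⟨h1, h2, h3, h4, h5, h6, h7, h8⟩,
      fun ⟨h1, h2, h3, h4, h5, h6, h7, h8⟩ => ⟨h1, h2, h3, h4, h5, h6, h7, h8⟩⟩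
  refine .and ?_ (.and ?_ (.and ?_ (.and ?_ (.and ?_ (.and ?_ (.and ?_ ?_))))))
  · exact .forall fun t => (hR t).imp ((hcx _).and (hcy _))
  · exact measurable_forall_elt fun a => measurable_exists_elt fun b => hxy a b
  · exact measurable_forall_elt fun a => measurable_exists_elt fun b => hxy b a
  · exact .forall fun a => .forall fun b => .forall fun c => (hR _).imp ((hR _).imp measurable_const)
  · exact .forall fun a => .forall fun b => .forall fun c => (hR _).imp ((hR _).imp measurable_const)
  · exact measurable_forall_elt fun a => measurable_forall_elt fun b => measurable_forall_elt fun c =>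
      measurable_forall_elt fun a' => measurable_forall_elt fun b' => measurable_forall_elt fun c' =>
        (hxy a a').imp ((hxy b b').imp ((hxy c c').imp
          (((hx a).mul hX (hx b) (hx c)).iff ((hy a').mul hY (hy b') (hy c')))))
  · exact measurable_forall_elt fun a => measurable_forall_elt fun a' =>
      (hxy a a').imp (IsMeasurableElt.graph hR ((hx a).inv hX) ((hy a').inv hY))
  · exact measurable_forall_elt fun a => measurable_forall_elt fun b =>
      measurable_forall_elt fun a' => measurable_forall_elt fun b' =>
        (hxy a a').imp ((hxy b b').imp
          (IsMeasurableElt.graph hR ((hx a).inf hX (hx b)) ((hy a').inf hY (hy b'))))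

/-- Inclusion of the composite graph in the third graph suffices, since both are graphs of functions
on the same domain. -/
lemma mgArrow_comp_iff (t : Arrow (MCat Gr S) × Arrow (MCat Gr S) × Arrow (MCat Gr S)) :
    (∃ (X Y Z : MCat Gr S) (f : X ⟶ Y) (g : Y ⟶ Z),
      t = (Arrow.mk f, Arrow.mk g, Arrow.mk (f ≫ g))) ↔
    t.1.right = t.2.1.left ∧ t.2.2.left = t.1.left ∧ t.2.2.right = t.2.1.right ∧
      ∀ a b c, mgGraph t.1 (a, b) → mgGraph t.2.1 (b, c) → mgGraph t.2.2 (a, c) := by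
  constructor
  · rintro ⟨X, Y, Z, f, g, rfl⟩
    refine ⟨rfl, rfl, rfl, fun a b c => ?_⟩
    rintro ⟨A, hA, hB⟩ ⟨B, hB', hC⟩
    dsimp only at hA hB hB' hC
    refine ⟨A, hA, ?_⟩
    have : MGOps.Iso.equiv f A = B := Subtype.val_inj.1 (hB.trans hB'.symm)
    dsimp only
    rw [← hC, ← this]
    rfl
  · obtain ⟨⟨X, Y, f⟩, ⟨Y', Z, g⟩, ⟨X', Z', h⟩⟩ := t
    rintro ⟨h1, h2, h3, h4⟩
    dsimp only at h1 h2 h3 h4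
    subst h1 h2 h3
    refine ⟨X', Y, Z', f, g, ?_⟩
    have : h = f ≫ g := by
      refine MGOps.Iso.ext (Equiv.ext fun A => ?_)
      refine (mgIsoGraph_iff h A _).1 (h4 _ (MGOps.Iso.equiv f A : ℕ) _ ?_ ?_)
      · exact (mgIsoGraph_iff f A _).2 rfl
      · exact (mgIsoGraph_iff g _ _).2 rfl
    rw [this]
    rfl

theorem isBorelCategory_mCat (hGr : MeasurableSet Gr) (hS : InvariantCountableBasis Gr S) :
    IsBorelCategory (MCat Gr S) where
  objects := standardBorelSpace_mCat hGr hS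
  morphisms := by
    have h1 := standardBorelSpace_mCat hGr hS
    refine standardBorelSpace_of_injective (f := fun f : Arrow (MCat Gr S) =>
      ((f.left : MCat Gr S), (f.right : MCat Gr S), mgGraph f)) ?_ rfl ?_
    · rintro ⟨X, Y, f⟩ ⟨X', Y', f'⟩ h
      obtain ⟨rfl, h'⟩ := Prod.mk.inj h
      obtain ⟨rfl, h''⟩ := Prod.mk.inj h'
      have : f = f' := mgIsoGraph_injective h''
      rw [this]
    · have : range (fun f : Arrow (MCat Gr S) =>
          ((f.left : MCat Gr S), (f.right : MCat Gr S), mgGraph f)) =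
          {t | IsMGIsoGraph t.1.str t.2.1.str t.2.2} := by
        ext ⟨X, Y, R⟩
        constructor
        · rintro ⟨f, hf⟩
          rw [← hf]
          exact isMGIsoGraph_mgIsoGraph _
        · intro h
          obtain ⟨e, he⟩ := h.exists_iso
          exact ⟨Arrow.mk (show X ⟶ Y from e), Prod.ext rfl (Prod.ext rfl he)⟩
      rw [this]
      exact measurableSet_setOfPred.2 (measurable_isMGIsoGraph (measurable_str.comp measurable_fst)
        (measurable_str.comp (measurable_fst.comp measurable_snd)) fun t =>
          (measurable_pi_apply t).comp (measurable_snd.comp measurable_snd))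
  dom := measurable_mgArrow_left
  cod := measurable_mgArrow_right
  ident := by
    refine measurable_to_mgArrow measurable_id measurable_id fun t => ?_
    refine measurable_prop_congr (((CountableMG.measurable_mem_carrier t.1).comp
      measurable_str).and (measurable_const (a := t.1 = t.2))) fun X => ?_
    constructor
    · rintro ⟨A, hA, hB⟩
      exact ⟨hA ▸ A.2, hA.symm.trans hB⟩
    · rintro ⟨h, h'⟩
      exact ⟨⟨t.1, h⟩, rfl, h'⟩
  comp := by
    have h1 := standardBorelSpace_mCat hGr hS
    simp only [mgArrow_comp_iff]
    have m1 : Measurable fun t : Arrow (MCat Gr S) × Arrow (MCat Gr S) × Arrow (MCat Gr S) => t.1 :=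
      measurable_fst
    have m2 : Measurable fun t : Arrow (MCat Gr S) × Arrow (MCat Gr S) × Arrow (MCat Gr S) =>
      t.2.1 := measurable_fst.comp measurable_snd
    have m3 : Measurable fun t : Arrow (MCat Gr S) × Arrow (MCat Gr S) × Arrow (MCat Gr S) =>
      t.2.2 := measurable_snd.comp measurable_snd
    refine (measurableSet_eq_fun (measurable_mgArrow_right.comp m1)
      (measurable_mgArrow_left.comp m2)).inter
      ((measurableSet_eq_fun (measurable_mgArrow_left.comp m3)
        (measurable_mgArrow_left.comp m1)).inter
      ((measurableSet_eq_fun (measurable_mgArrow_right.comp m3)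
        (measurable_mgArrow_right.comp m2)).inter ?_))
    exact measurableSet_setOfPred.2 (.forall fun a => .forall fun b => .forall fun c =>
      ((measurable_mgGraph _).comp m1).imp (((measurable_mgGraph _).comp m2).imp
        ((measurable_mgGraph _).comp m3)))

end BorelDuality

namespace BorelDuality

open scoped Pointwise

variable {Gr : Set (ClosedSubgroup (Equiv.Perm ℕ))}
  {S : ∀ G : ClosedSubgroup (Equiv.Perm ℕ), Set (Subgroup G)}

/-! ### The functor sending a group to its coset meet groupoid is Borel -/

lemma IsCosetMeetGroupoid.isClopen {G : ClosedSubgroup (Equiv.Perm ℕ)} {T : Set (Subgroup G)}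
    {M : Type} {s : MGOps M} {c : M → Set G} (hc : IsCosetMeetGroupoid T s c) (hO : IsOpenBasis T)
    (A : M) : IsClopen (c A) := by
  rcases eq_empty_or_nonempty (c A) with h | h
  · rw [h]
    exact isClopen_empty
  · obtain ⟨U, hU, hA⟩ := hc.exists_isLeftCoset h
    exact hA.isClopen (hO.isOpen U hU)

lemma eq_iff_densePt {G : GrCat Gr} {A B : Set G.grp} (hA : IsClopen A) (hB : IsClopen B) :
    A = B ↔ ∀ k, densePt k G ∈ A ↔ densePt k G ∈ B :=
  ⟨fun h _ => h ▸ Iff.rfl, eq_of_dense G.grp hA hB⟩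

lemma isClopen_mul_left {G : ClosedSubgroup (Equiv.Perm ℕ)} (g : G) {A : Set G} (hA : IsClopen A) :
    IsClopen {x | g * x ∈ A} :=
  hA.preimage (continuous_const.mul continuous_id)

lemma isClopen_mul_right {G : ClosedSubgroup (Equiv.Perm ℕ)} (g : G) {A : Set G} (hA : IsClopen A) :
    IsClopen {x | x * g ∈ A} :=
  hA.preimage (continuous_id.mul continuous_const)

lemma isLeftCoset_iff_densePt {G : GrCat Gr} {U : Subgroup G.grp} {A : Set G.grp}
    (hU : IsClopen (U : Set G.grp)) (hA : IsClopen A) : IsLeftCoset U A ↔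
      ∃ i, densePt i G ∈ A ∧ ∀ k, densePt k G ∈ A ↔ (densePt i G)⁻¹ * densePt k G ∈ (U : Set _) := by
  constructor
  · intro h
    obtain ⟨i, hi⟩ := exists_dense_mem G.grp hA.isOpen h.nonempty
    exact ⟨i, hi, fun k => h.mem_iff hi _⟩
  · rintro ⟨i, -, h⟩
    exact isLeftCoset_iff.2 ⟨densePt i G, Set.ext_iff.1
      ((eq_iff_densePt hA (isClopen_mul_left _ hU)).2 h)⟩

lemma isRightCoset_iff_densePt {G : GrCat Gr} {U : Subgroup G.grp} {A : Set G.grp}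
    (hU : IsClopen (U : Set G.grp)) (hA : IsClopen A) : IsRightCoset U A ↔
      ∃ i, densePt i G ∈ A ∧ ∀ k, densePt k G ∈ A ↔ densePt k G * (densePt i G)⁻¹ ∈ (U : Set _) := by
  constructor
  · intro h
    obtain ⟨i, hi⟩ := exists_dense_mem G.grp hA.isOpen h.nonempty
    exact ⟨i, hi, fun k => h.mem_iff hi _⟩
  · rintro ⟨i, -, h⟩
    exact isRightCoset_iff.2 ⟨densePt i G, Set.ext_iff.1
      ((eq_iff_densePt hA (isClopen_mul_right _ hU)).2 h)⟩

/-- For a point `a` of the left coset `A`, the product `A B` is the translate `a B`, and this can be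
tested on the dense sequence. The first alternative is the product of empty sets. -/
lemma composable_mul_iff_densePt {G : GrCat Gr} {T : Set (Subgroup G.grp)} {U : ℕ → Subgroup G.grp}
    (hT : range U = interClosure T) (hU : ∀ i, IsClopen (U i : Set G.grp)) {A B C : Set G.grp}
    (hA : IsClopen A) (hB : IsClopen B) (hC : IsClopen C) :
    (IsCosetMeetGroupoid.Composable T A B ∧ C = A * B) ↔
      ((∀ k, densePt k G ∉ A) ∧ (∀ k, densePt k G ∉ B) ∧ ∀ k, densePt k G ∉ C) ∨
      ∃ i j, densePt j G ∈ A ∧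
        (∀ k, densePt k G ∈ A ↔ (densePt j G)⁻¹ * densePt k G ∈ (U i : Set G.grp)) ∧
        (∃ l, densePt l G ∈ B ∧
          ∀ k, densePt k G ∈ B ↔ densePt k G * (densePt l G)⁻¹ ∈ (U i : Set G.grp)) ∧
        ∀ k, densePt k G ∈ C ↔ (densePt j G)⁻¹ * densePt k G ∈ B := by
  have hempty : ∀ {A : Set G.grp}, IsClopen A → ((∀ k, densePt k G ∉ A) ↔ A = ∅) := by
    intro A hA
    rw [eq_iff_densePt hA isClopen_empty]
    simp
  rw [hempty hA, hempty hB, hempty hC]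
  constructor
  · rintro ⟨⟨rfl, rfl⟩ | ⟨V, hV, hAV, hBV⟩, rfl⟩
    · exact Or.inl ⟨rfl, rfl, Set.empty_mul⟩
    · obtain ⟨i, rfl⟩ := hT.superset hV
      obtain ⟨j, hj, hjA⟩ := (isLeftCoset_iff_densePt (hU i) hA).1 hAV
      exact Or.inr ⟨i, j, hj, hjA, (isRightCoset_iff_densePt (hU i) hB).1 hBV,
        fun k => mem_mul_iff_left hAV hBV hj _⟩
  · rintro (⟨rfl, rfl, rfl⟩ | ⟨i, j, hj, hjA, hB', hC'⟩)
    · exact ⟨Or.inl ⟨rfl, rfl⟩, Set.empty_mul.symm⟩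
    · have hAV := (isLeftCoset_iff_densePt (hU i) hA).2 ⟨j, hj, hjA⟩
      have hBV := (isRightCoset_iff_densePt (hU i) hB).2 hB'
      refine ⟨Or.inr ⟨U i, hT.subset (mem_range_self i), hAV, hBV⟩, ?_⟩
      have : A * B = {x | (densePt j G)⁻¹ * x ∈ B} :=
        Set.ext fun x => mem_mul_iff_left hAV hBV hj x
      rw [this, eq_iff_densePt hC (isClopen_mul_left _ hB)]
      exact hC'

namespace CosetSystem

variable (σ : CosetSystem Gr S) (hS : InvariantCountableBasis Gr S)
  (hIso : IsomorphismInvariant Gr)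

include hS in
lemma isClopen_coset (n : ℕ) (G : GrCat Gr) : IsClopen (σ.coset n G) := by
  rcases (σ.range_coset G).subset (mem_range_self n) with h | ⟨U, hU, h⟩
  · rw [h]
    exact isClopen_empty
  · exact h.isClopen ((hS.isOpenBasis G.mem).isOpen U hU)

section Measurability

variable {Ω : Type*} [MeasurableSpace Ω] {X : Ω → GrCat Gr} (hX : Measurable X)
include hX

lemma measurable_densePt_mem (n k : ℕ) :
    Measurable fun ω => densePt k (X ω) ∈ σ.coset n (X ω) :=
  (σ.measurable_coset n).comp hX (measurable_densePt hX k)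

include hS in
lemma measurable_mem_carrier (n : ℕ) : Measurable fun ω => n ∈ σ.carrier (X ω) := by
  refine measurable_prop_congr (P := fun ω => ∀ m, m < n → ¬ ∀ k,
    densePt k (X ω) ∈ σ.coset m (X ω) ↔ densePt k (X ω) ∈ σ.coset n (X ω)) ?_ fun ω => ?_
  · exact .forall fun m => .forall fun _ => (Measurable.forall fun k =>
      (σ.measurable_densePt_mem hX m k).iff (σ.measurable_densePt_mem hX n k)).not
  · exact forall₂_congr fun m _ => not_congr
      (eq_iff_densePt (σ.isClopen_coset hS m _) (σ.isClopen_coset hS n _))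

lemma measurable_inv_mul_mem_coset (n i k : ℕ) :
    Measurable fun ω => (densePt i (X ω))⁻¹ * densePt k (X ω) ∈ σ.coset n (X ω) :=
  (σ.measurable_coset n).comp hX ((measurable_densePt hX i).inv.mul (measurable_densePt hX k))

include hS in
lemma measurable_composable (a b c : ℕ) : Measurable fun ω =>
    IsCosetMeetGroupoid.Composable (S (X ω).grp) (σ.coset a (X ω)) (σ.coset b (X ω)) ∧
      σ.coset c (X ω) = σ.coset a (X ω) * σ.coset b (X ω) := by
  have hd := σ.measurable_densePt_mem hX
  refine measurable_prop_congr ?_ fun ω => composable_mul_iff_densePt (σ.range_sub (X ω))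
    (fun i => σ.isClopen_sub hS i (X ω)) (σ.isClopen_coset hS _ _) (σ.isClopen_coset hS _ _)
    (σ.isClopen_coset hS _ _)
  refine .or (.and ?_ (.and ?_ ?_)) (.exists fun i => .exists fun j => .and (hd _ _)
    (.and (.forall fun k => (hd _ _).iff ?_) (.and (.exists fun l => .and (hd _ _)
      (.forall fun k => (hd _ _).iff ?_)) (.forall fun k => (hd _ _).iff ?_))))
  · exact .forall fun k => (hd _ _).not
  · exact .forall fun k => (hd _ _).not
  · exact .forall fun k => (hd _ _).not
  · exact (σ.measurable_sub i).comp hX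
      ((measurable_densePt hX j).inv.mul (measurable_densePt hX k))
  · exact (σ.measurable_sub i).comp hX
      ((measurable_densePt hX k).mul (measurable_densePt hX l).inv)
  · exact σ.measurable_inv_mul_mem_coset hX _ _ _

/-- The operations were obtained by choice, but injectivity of the listing makes them determined by
the cosets. Each atomic relation says that clopen sets are equal or composable, and is tested on
dense points. -/
theorem measurable_struct : Measurable fun ω => σ.struct hS (X ω) := by
  have hd := σ.measurable_densePt_mem hX
  have hc := σ.measurable_mem_carrier hS hX
  have hcl := fun n ω => σ.isClopen_coset hS n (X ω)
  have hG := fun ω => σ.isCosetMeetGroupoid hS (X ω)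
  refine CountableMG.measurable_of_rel hc (fun t => ?_) (fun t => ?_) (fun t => ?_) fun a => ?_
  · refine measurable_prop_congr ((hc t.1).and ((hc t.2.1).and ((hc t.2.2).and
      (σ.measurable_composable hS hX t.1 t.2.1 t.2.2)))) fun ω => ?_
    constructor
    · rintro ⟨ha, hb, hc, h⟩
      exact ⟨ha, hb, hc, (hG ω).mul_eq_some.1 h⟩
    · rintro ⟨ha, hb, hc, h⟩
      exact ⟨ha, hb, hc, (hG ω).mul_eq_some.2 h⟩
  · refine measurable_prop_congr ((hc t.1).and ((hc t.2).and (.forall fun k =>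
      (hd t.2 k).iff ((σ.measurable_coset t.1).comp hX (g := fun ω => (densePt k (X ω))⁻¹)
        (measurable_densePt hX k).inv)))) fun ω => ?_
    have key := eq_iff_densePt (hcl t.2 ω) ((hcl t.1 ω).preimage continuous_inv)
    constructor
    · rintro ⟨ha, hb, h⟩
      refine ⟨ha, hb, key.1 ?_⟩
      have h1 := (hG ω).inv ⟨t.1, ha⟩
      rwa [h] at h1
    · rintro ⟨ha, hb, h⟩
      exact ⟨ha, hb, (hG ω).injective (((hG ω).inv ⟨t.1, ha⟩).trans (key.2 h).symm)⟩
  · refine measurable_prop_congr ((hc t.1).and ((hc t.2.1).and ((hc t.2.2).and (.forall fun k =>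
      (hd t.2.2 k).iff ((hd t.1 k).and (hd t.2.1 k)))))) fun ω => ?_
    have key := eq_iff_densePt (hcl t.2.2 ω) ((hcl t.1 ω).inter (hcl t.2.1 ω))
    constructor
    · rintro ⟨ha, hb, hc, h⟩
      refine ⟨ha, hb, hc, key.1 ?_⟩
      have h1 := (hG ω).inf ⟨t.1, ha⟩ ⟨t.2.1, hb⟩
      rwa [h] at h1
    · rintro ⟨ha, hb, hc, h⟩
      exact ⟨ha, hb, hc, (hG ω).injective (((hG ω).inf ⟨t.1, ha⟩ ⟨t.2.1, hb⟩).trans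
        (key.2 h).symm)⟩
  · refine measurable_prop_congr ((hc a).and (.forall fun k => (hd a k).not)) fun ω => ?_
    have key : σ.coset a (X ω) = ∅ ↔ ∀ k, densePt k (X ω) ∉ σ.coset a (X ω) := by
      rw [eq_iff_densePt (hcl a ω) isClopen_empty]
      simp
    constructor
    · rintro ⟨ha, h⟩
      refine ⟨ha, key.1 ?_⟩
      have h1 := (hG ω).bot
      rwa [h] at h1
    · rintro ⟨ha, h⟩
      exact ⟨ha, (hG ω).injective ((hG ω).bot.trans (key.2 h).symm)⟩

end Measurability

lemma measurable_obj : Measurable (σ.obj hS hIso) :=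
  measurable_comap_iff.2 (σ.measurable_struct hS measurable_id)

/-- Writing `α(A) = B` as `A = α⁻¹(B)` means that only the values of `α` at dense points of its
domain enter. -/
lemma mgGraph_functor_map_iff (f : Arrow (GrCat Gr)) (t : ℕ × ℕ) :
    mgGraph (Arrow.mk ((σ.functor hS hIso).map f.hom)) t ↔
      t.1 ∈ σ.carrier f.left ∧ t.2 ∈ σ.carrier f.right ∧
        ∀ k, densePt k f.left ∈ σ.coset t.1 f.left ↔
          (show f.left.grp ≃ₜ* f.right.grp from f.hom) (densePt k f.left) ∈
            σ.coset t.2 f.right := by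
  set α : f.left.grp ≃ₜ* f.right.grp := f.hom with hα
  have key := eq_iff_densePt (σ.isClopen_coset hS t.1 f.left)
    ((σ.isClopen_coset hS t.2 f.right).preimage α.continuous_toFun)
  have himg : ∀ {A : Set f.left.grp} {B : Set f.right.grp}, α.toMulEquiv '' A = B ↔
      A = α ⁻¹' B := by
    intro A B
    constructor
    · rintro rfl
      exact (preimage_image_eq A α.toMulEquiv.injective).symm
    · rintro rfl
      exact image_preimage_eq B α.toMulEquiv.surjective
  constructor
  · rintro ⟨A, hA, hB⟩
    refine ⟨hA ▸ A.2, hB ▸ Subtype.property _, key.1 (himg.1 ?_)⟩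
    have h1 := σ.toCoset_functor_map hS hIso f.hom A
    rw [← hA, ← hB]
    exact h1.symm
  · rintro ⟨ha, hb, h⟩
    refine ⟨⟨t.1, ha⟩, rfl, ?_⟩
    have h1 := σ.toCoset_functor_map hS hIso f.hom ⟨t.1, ha⟩
    have h2 : σ.toCoset f.right ⟨t.2, hb⟩ = α.toMulEquiv '' σ.toCoset f.left ⟨t.1, ha⟩ :=
      (himg.2 (key.2 h)).symm
    exact congrArg Subtype.val (σ.toCoset_injective _ (h1.trans h2.symm))

theorem isBorelFunctor_functor : IsBorelFunctor (σ.functor hS hIso) where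
  obj := σ.measurable_obj hS hIso
  map := by
    refine measurable_to_mgArrow ((σ.measurable_obj hS hIso).comp measurable_arrow_left)
      ((σ.measurable_obj hS hIso).comp measurable_arrow_right) fun t => ?_
    refine measurable_prop_congr ?_ fun f => σ.mgGraph_functor_map_iff hS hIso f t
    refine .and (σ.measurable_mem_carrier hS measurable_arrow_left _)
      (.and (σ.measurable_mem_carrier hS measurable_arrow_right _) (.forall fun k =>
        (σ.measurable_densePt_mem measurable_arrow_left _ _).iff
          ((σ.measurable_coset _).comp measurable_arrow_right ?_)))
    have : (fun f : Arrow (GrCat Gr) => app f (dense k f.left.grp)) = fun f =>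
        ((show f.left.grp ≃ₜ* f.right.grp from f.hom) (densePt k f.left) : Equiv.Perm ℕ) :=
      funext fun f => app_of_mem f (dense_mem k f.left.grp)
    rw [← this]
    exact measurable_app.comp (measurable_id.prodMk
      ((measurable_dense k).comp (measurable_grp.comp measurable_arrow_left)))

theorem isCosetFunctor_functor : IsCosetFunctor (σ.functor hS hIso) σ.toCoset where
  obj G := σ.isCosetMeetGroupoid hS G
  map G H α A := σ.toCoset_functor_map hS hIso α A
  borel n O hO := by
    have hm : Measurable fun G : GrCat Gr => ∃ k, densePt k G ∈ σ.coset n G ∧ dense k G.grp ∈ O :=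
      .exists fun k => (σ.measurable_densePt_mem measurable_id n k).and
        (measurableSet_setOfPred.1
          (((measurable_dense k).comp measurable_grp) hO.measurableSet))
    refine measurableSet_setOfPred.2 (measurable_prop_congr
      ((σ.measurable_mem_carrier hS measurable_id n).and hm) fun G => ?_)
    constructor
    · rintro ⟨hn, _, ⟨x, hx, rfl⟩, hxO⟩
      obtain ⟨k, hk⟩ := exists_dense_mem G.grp ((σ.isClopen_coset hS n G).isOpen.inter
        (hO.preimage continuous_subtype_val)) ⟨x, hx, hxO⟩
      exact ⟨hn, k, hk.1, hk.2⟩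
    · rintro ⟨hn, k, hk, hkO⟩
      exact ⟨hn, _, ⟨_, hk, rfl⟩, hkO⟩

end CosetSystem

end BorelDuality

namespace BorelDuality

open scoped Pointwise

variable {Gr : Set (ClosedSubgroup (Equiv.Perm ℕ))}
  {S : ∀ G : ClosedSubgroup (Equiv.Perm ℕ), Set (Subgroup G)}

/-! ### The functor sending a meet groupoid to its group is Borel -/

lemma measurable_autFunctor_obj : Measurable (autFunctor Gr S).obj :=
  measurable_comap_iff.2 (measurable_autGroup measurable_str fun M : MCat Gr S => M.full)

/-- Here `a` stands for `θ⁻¹ k`, so that the conjugate `θ q θ⁻¹` is expressed through the graph of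
`θ` alone. -/
lemma autMap_apply_eq_iff {M N : CountableMG} (e : MGOps.Iso M.ops N.ops) (q : M.autGroup)
    (k m : ℕ) : (CountableMG.autMap e q : Equiv.Perm ℕ) k = m ↔ (k ∉ N.carrier ∧ k = m) ∨
      ∃ a, mgIsoGraph e (a, k) ∧ mgIsoGraph e ((q : Equiv.Perm ℕ) a, m) := by
  by_cases hk : k ∈ N.carrier
  · have hA := e.equiv.apply_symm_apply ⟨k, hk⟩
    set A := e.equiv.symm ⟨k, hk⟩
    have h1 : (CountableMG.autMap e q : Equiv.Perm ℕ) k =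
        e.equiv ⟨(q : Equiv.Perm ℕ) A, M.autGroup_apply_mem q A⟩ := by
      rw [← CountableMG.autMulEquiv_apply e q A, hA]
      rfl
    rw [h1]
    constructor
    · rintro rfl
      refine Or.inr ⟨A, ⟨A, rfl, congrArg Subtype.val hA⟩, ⟨_, M.autGroup_apply_mem q A⟩, rfl, rfl⟩
    · rintro (⟨h, -⟩ | ⟨a, ⟨A', hA', hk'⟩, ⟨B, hB, hm⟩⟩)
      · exact (h hk).elim
      · dsimp only at hA' hk' hB hm
        have hAA : A' = A := e.equiv.injective ((Subtype.ext hk').trans hA.symm)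
        rw [← hm]
        refine congrArg (fun x => (e.equiv x : ℕ)) (Subtype.ext ?_)
        rw [hB, ← hA', hAA]
  · have h1 : (CountableMG.autMap e q : Equiv.Perm ℕ) k = k :=
      CountableMG.autMulEquiv_apply_of_notMem e q hk
    rw [h1]
    refine ⟨fun h => Or.inl ⟨hk, h⟩, ?_⟩
    rintro (⟨-, h⟩ | ⟨a, h, -⟩)
    · exact h
    · exact (hk (mgIsoGraph_mem h).2).elim

theorem isBorelFunctor_autFunctor : IsBorelFunctor (autFunctor Gr S) where
  obj := measurable_autFunctor_obj
  map := by
    refine measurable_to_arrow (measurable_autFunctor_obj.comp measurable_mgArrow_left)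
      (measurable_autFunctor_obj.comp measurable_mgArrow_right) fun n => ?_
    refine measurable_of_apply_eq fun k m => ?_
    have happ : ∀ f : Arrow (MCat Gr S), app (Arrow.mk ((autFunctor Gr S).map f.hom))
        (dense n f.left.str.autGroup) = (CountableMG.autMap
          (show MGOps.Iso f.left.str.ops f.right.str.ops from f.hom)
          ⟨dense n f.left.str.autGroup, dense_mem _ _⟩ : Equiv.Perm ℕ) :=
      fun f => app_of_mem (Arrow.mk ((autFunctor Gr S).map f.hom)) (dense_mem n f.left.str.autGroup)
    have hd : ∀ a, Measurable fun f : Arrow (MCat Gr S) => dense n f.left.str.autGroup a := fun a =>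
      measurable_perm_iff.1 ((measurable_dense n).comp (measurable_grp.comp
        (measurable_autFunctor_obj.comp measurable_mgArrow_left))) a
    have hg : Measurable fun t : Arrow (MCat Gr S) × ℕ × ℕ => mgGraph t.1 t.2 :=
      measurable_from_prod_countable_left measurable_mgGraph
    refine measurable_prop_congr (.or (.and ((CountableMG.measurable_mem_carrier k).comp
      (measurable_str.comp measurable_mgArrow_right)).not (measurable_const (a := k = m)))
      (.exists fun a => (measurable_mgGraph (a, k)).and
        (hg.comp (measurable_id.prodMk ((hd a).prodMk (measurable_const (a := m))))))) fun f => ?_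
    change app (Arrow.mk ((autFunctor Gr S).map f.hom)) (dense n f.left.str.autGroup) k = m ↔ _
    rw [happ]
    exact autMap_apply_eq_iff _ _ _ _

/-! ### The natural isomorphisms -/

/-- A topological isomorphism as an isomorphism of the category. -/
def grIso {G H : GrCat Gr} (φ : G.grp ≃ₜ* H.grp) : G ≅ H where
  hom := φ
  inv := φ.symm
  hom_inv_id := ContinuousMulEquiv.ext φ.symm_apply_apply
  inv_hom_id := ContinuousMulEquiv.ext φ.apply_symm_apply

/-- An isomorphism of meet groupoids as an isomorphism of the category. -/
def mgIso {M N : MCat Gr S} (e : MGOps.Iso M.str.ops N.str.ops) : M ≅ N where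
  hom := e
  inv := CountableMG.isoSymm e
  hom_inv_id := MGOps.Iso.ext (Equiv.ext e.equiv.symm_apply_apply)
  inv_hom_id := MGOps.Iso.ext (Equiv.ext e.equiv.apply_symm_apply)

lemma autEquiv_autMap {M N : CountableMG} (e : MGOps.Iso M.ops N.ops) (q : M.autGroup)
    (A : M.carrier) : (autEquiv N (CountableMG.autMap e q) : Equiv.Perm N.carrier) (e.equiv A) =
      e.equiv ((autEquiv M q : Equiv.Perm M.carrier) A) := by
  refine Subtype.ext ?_
  rw [autEquiv_apply]
  refine (CountableMG.autMulEquiv_apply e q A (M.autGroup_apply_mem q A)).trans ?_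
  exact congrArg (fun x => (e.equiv x : ℕ)) (Subtype.ext (autEquiv_apply M q A).symm)

lemma autGroup_ext {M : CountableMG} {p q : M.autGroup}
    (h : ∀ A, (autEquiv M p : Equiv.Perm M.carrier) A = (autEquiv M q : Equiv.Perm M.carrier) A) :
    p = q :=
  (autEquiv M).injective (Subtype.ext (Equiv.ext h))

lemma MGOps.Iso.map_bot {M N : Type} {s : MGOps M} {t : MGOps N} (e : Iso s t)
    (hs : s.IsMeetGroupoid) (ht : t.IsMeetGroupoid) : e.equiv s.bot = t.bot := by
  refine ht.le_bot ?_
  obtain ⟨A, hA⟩ := e.equiv.surjective t.bot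
  have h1 : t.Le (e.equiv s.bot) (e.equiv A) := by
    rw [Le, ← e.map_inf, hs.bot_le A]
  rwa [hA] at h1

lemma MGOps.Iso.map_src {M N : Type} {s : MGOps M} {t : MGOps N} (e : Iso s t)
    (hs : s.IsMeetGroupoid) (ht : t.IsMeetGroupoid) (A : M) :
    e.equiv (s.src A) = t.src (e.equiv A) := by
  refine (ht.src_eq_of_mul ?_).symm
  rw [e.map_mul, hs.mul_src, Option.map_some]

namespace CosetSystem

variable (σ : CosetSystem Gr S) (hS : InvariantCountableBasis Gr S)
  (hIso : IsomorphismInvariant Gr)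

/-- The unit of the equivalence. -/
noncomputable def unit : 𝟭 (GrCat Gr) ≅ σ.functor hS hIso ⋙ autFunctor Gr S :=
  NatIso.ofComponents (fun G => grIso (σ.unitIso hS G)) (by
    intro G H α
    refine ContinuousMulEquiv.ext fun g => autGroup_ext fun B => ?_
    obtain ⟨A, rfl⟩ := (MGOps.Iso.equiv ((σ.functor hS hIso).map α)).surjective B
    refine Eq.trans ?_ (autEquiv_autMap ((σ.functor hS hIso).map α) (σ.unitIso hS G g) A).symm
    refine σ.toCoset_injective H ?_
    refine (σ.toCoset_unitIso hS H ((show G.grp ≃ₜ* H.grp from α) g) _).trans ?_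
    refine (congrArg (fun X => (show G.grp ≃ₜ* H.grp from α) g • X)
      (σ.toCoset_functor_map hS hIso α A)).trans ?_
    refine Eq.trans ?_ (σ.toCoset_functor_map hS hIso α _).symm
    refine Eq.trans ?_ (congrArg (fun X => ContinuousMulEquiv.toMulEquiv α '' X)
      (σ.toCoset_unitIso hS G g A).symm)
    -- Naturality of the unit amounts to `α(g A) = α(g) α(A)`.
    exact (Set.image_smul_distrib (ContinuousMulEquiv.toMulEquiv α) g (σ.toCoset G A)).symm)

/-- The permutation attached to `g` takes the index of a coset to the index of its translate by `g`,
and equality with a translate is tested on dense points. -/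
lemma unitIso_apply_eq_iff (G : GrCat Gr) (g : G.grp) (a b : ℕ) :
    (σ.unitIso hS G g : Equiv.Perm ℕ) a = b ↔ (a ∉ σ.carrier G ∧ a = b) ∨
      (a ∈ σ.carrier G ∧ b ∈ σ.carrier G ∧
        ∀ k, densePt k G ∈ σ.coset b G ↔ g⁻¹ * densePt k G ∈ σ.coset a G) := by
  by_cases ha : a ∈ σ.carrier G
  · have h1 := autEquiv_apply (σ.struct hS G) (σ.unitIso hS G g) ⟨a, ha⟩
    have h2 := σ.toCoset_unitIso hS G g ⟨a, ha⟩
    have key : ∀ b, (∀ k, densePt k G ∈ σ.coset b G ↔ g⁻¹ * densePt k G ∈ σ.coset a G) ↔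
        σ.coset b G = g • σ.coset a G := by
      intro b
      have : g • σ.coset a G = {x | g⁻¹ * x ∈ σ.coset a G} := by
        ext x
        exact Set.mem_smul_set_iff_inv_smul_mem
      rw [this, eq_iff_densePt (σ.isClopen_coset hS b G)
        (isClopen_mul_left _ (σ.isClopen_coset hS a G))]
      rfl
    simp only [ha, not_true, false_and, false_or, true_and, key]
    rw [← h1]
    constructor
    · rintro rfl
      exact ⟨Subtype.property _, h2⟩
    · rintro ⟨hb, h⟩
      exact congrArg Subtype.val (σ.toCoset_injective G (h2.trans h.symm :
        σ.toCoset G _ = σ.toCoset G ⟨b, hb⟩))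
  · simp only [ha, not_false_eq_true, true_and, false_and, or_false]
    rw [autGroup_apply_of_notMem (σ.struct hS G) (σ.unitIso hS G g) ha]

lemma measurable_unit :
    Measurable fun G : GrCat Gr => Arrow.mk ((σ.unit hS hIso).hom.app G) := by
  refine measurable_to_arrow measurable_id
    (measurable_autFunctor_obj.comp (σ.measurable_obj hS hIso)) fun n => ?_
  refine measurable_of_apply_eq fun a b => ?_
  have happ : ∀ G : GrCat Gr, app (Arrow.mk ((σ.unit hS hIso).hom.app G)) (dense n G.grp) =
      (σ.unitIso hS G (densePt n G) : Equiv.Perm ℕ) := fun G =>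
    app_of_mem (Arrow.mk ((σ.unit hS hIso).hom.app G)) (dense_mem n G.grp)
  have hc := σ.measurable_mem_carrier hS (measurable_id (α := GrCat Gr))
  refine measurable_prop_congr (.or ((hc a).not.and (measurable_const (a := a = b)))
    ((hc a).and ((hc b).and (.forall fun k => (σ.measurable_densePt_mem measurable_id b k).iff
      (σ.measurable_inv_mul_mem_coset measurable_id a n k))))) fun G => ?_
  change app (Arrow.mk ((σ.unit hS hIso).hom.app G)) (dense n G.grp) a = b ↔ _
  rw [happ]
  exact σ.unitIso_apply_eq_iff hS G _ a b

lemma isCosetMeetGroupoid_hat (M : MCat Gr S) :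
    IsCosetMeetGroupoid (S M.str.autGroup) M.str.ops (MGOps.hat (autEquiv M.str)) := by
  refine M.full.isCosetMeetGroupoid_hat fun V => (M.basis V).trans ?_
  refine exists_congr fun U => and_congr_right fun _ => ?_
  have : {q : M.str.autGroup | (q : Equiv.Perm ℕ) U = U} =
      {q | (autEquiv M.str q : Equiv.Perm M.str.carrier) U = U} := by
    ext q
    rw [mem_ofPred_eq, mem_ofPred_eq, Subtype.ext_iff, autEquiv_apply]
  rw [this]

/-- By `hat`, `M` is itself a coset meet groupoid of its group with respect to the same subgroups as
the one the functor builds; the identity of the group then induces the isomorphism. -/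
lemma exists_counitIso (M : MCat Gr S) :
    ∃ e : MGOps.Iso M.str.ops (σ.obj hS hIso ((autFunctor Gr S).obj M)).str.ops,
      ∀ A, σ.toCoset ((autFunctor Gr S).obj M) (e.equiv A) = MGOps.hat (autEquiv M.str) A := by
  obtain ⟨e, he⟩ := (isCosetMeetGroupoid_hat M).exists_iso
    (σ.isCosetMeetGroupoid hS ((autFunctor Gr S).obj M)) (MulEquiv.refl _) fun U =>
      iff_of_eq (congrArg (fun V => V ∈ interClosure (S M.str.autGroup)) U.map_id.symm)
  exact ⟨e, fun A => (he A).trans (image_id _)⟩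

/-- The identification of a meet groupoid with the coset meet groupoid of its group. -/
noncomputable def counitIso (M : MCat Gr S) :
    MGOps.Iso M.str.ops (σ.obj hS hIso ((autFunctor Gr S).obj M)).str.ops :=
  (σ.exists_counitIso hS hIso M).choose

lemma toCoset_counitIso (M : MCat Gr S) (A : M.str.carrier) :
    σ.toCoset ((autFunctor Gr S).obj M) ((σ.counitIso hS hIso M).equiv A) =
      MGOps.hat (autEquiv M.str) A :=
  (σ.exists_counitIso hS hIso M).choose_spec A

/-- Naturality of the counit: `θ q θ⁻¹` takes the source of `θ A` to `θ A` exactly when `q` takes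
the source of `A` to `A`. -/
lemma image_hat {M N : CountableMG} (hM : M.ops.IsMeetGroupoid) (hN : N.ops.IsMeetGroupoid)
    (e : MGOps.Iso M.ops N.ops) (A : M.carrier) :
    (CountableMG.autMap e).toMulEquiv '' MGOps.hat (autEquiv M) A =
      MGOps.hat (autEquiv N) (e.equiv A) := by
  ext p
  obtain ⟨q, rfl⟩ := (CountableMG.autMap e).toMulEquiv.surjective p
  rw [(CountableMG.autMap e).toMulEquiv.injective.mem_set_image]
  refine and_congr ?_ ?_
  · rw [← e.map_bot hM hN, Ne, Ne, e.equiv.injective.eq_iff]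
  · rw [← e.map_src hM hN]
    refine Iff.trans ?_ (Eq.congr_left (autEquiv_autMap e q _)).symm
    exact e.equiv.injective.eq_iff.symm

/-- The counit of the equivalence. -/
noncomputable def counit : 𝟭 (MCat Gr S) ≅ autFunctor Gr S ⋙ σ.functor hS hIso :=
  NatIso.ofComponents (fun M => mgIso (σ.counitIso hS hIso M)) (by
    intro M N θ
    refine MGOps.Iso.ext (Equiv.ext fun A => σ.toCoset_injective _ ?_)
    refine (σ.toCoset_counitIso hS hIso N (MGOps.Iso.equiv θ A)).trans ?_
    refine Eq.trans ?_ (σ.toCoset_functor_map hS hIso ((autFunctor Gr S).map θ)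
      ((σ.counitIso hS hIso M).equiv A)).symm
    rw [toCoset_counitIso]
    exact (image_hat M.full.toIsMeetGroupoid N.full.toIsMeetGroupoid θ A).symm)

lemma measurable_counit :
    Measurable fun M : MCat Gr S => Arrow.mk ((σ.counit hS hIso).hom.app M) := by
  refine measurable_to_mgArrow measurable_id
    ((σ.measurable_obj hS hIso).comp measurable_autFunctor_obj) fun t => ?_
  have hX := measurable_str (Gr := Gr) (S := S)
  have he := isMeasurableElt_elt hX t.1
  -- The source is the value of the product `A⁻¹ · A`, so its graph is an atomic relation between
  -- Borel terms.
  have hsrc : IsMeasurableElt fun M : MCat Gr S => M.str.ops.src (elt M.str t.1) := by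
    refine isMeasurableElt_of_rel (fun a => measurable_countable_param
      CountableMG.measurable_mulRel hX ((he.inv hX).prodMk (he.prodMk (measurable_const (a := a)))))
      fun M a => ?_
    have h1 := M.full.inv_mul (elt M.str t.1)
    constructor
    · rintro rfl
      exact ⟨Subtype.property _, Subtype.property _, Subtype.property _, h1⟩
    · rintro ⟨_, _, _, h⟩
      exact congrArg Subtype.val (Option.some_inj.1 (h1.symm.trans h))
  have hd : ∀ k, Measurable fun M : MCat Gr S => dense k M.str.autGroup := fun k =>
    (measurable_dense k).comp (measurable_grp.comp measurable_autFunctor_obj)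
  have hhat : ∀ k, Measurable fun M : MCat Gr S => elt M.str t.1 ≠ M.str.ops.bot ∧
      dense k M.str.autGroup (M.str.ops.src (elt M.str t.1) : ℕ) = elt M.str t.1 := fun k =>
    (he.eq (isMeasurableElt_bot hX)).not.and (measurableSet_setOfPred.1
      (measurableSet_eq_fun (Measurable.perm_apply (hd k) hsrc) he))
  refine measurable_prop_congr (((CountableMG.measurable_mem_carrier t.1).comp hX).and
    ((σ.measurable_mem_carrier hS measurable_autFunctor_obj t.2).and (.forall fun k =>
      (σ.measurable_densePt_mem measurable_autFunctor_obj t.2 k).iff (hhat k)))) fun M => ?_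
  have key : ∀ A : M.str.carrier, σ.coset t.2 ((autFunctor Gr S).obj M) =
      MGOps.hat (autEquiv M.str) A ↔ ∀ k, densePt k ((autFunctor Gr S).obj M) ∈
        σ.coset t.2 ((autFunctor Gr S).obj M) ↔ A ≠ M.str.ops.bot ∧
          dense k M.str.autGroup (M.str.ops.src A : ℕ) = A := by
    intro A
    refine (eq_iff_densePt (G := (autFunctor Gr S).obj M) (σ.isClopen_coset hS t.2 _)
      ((isCosetMeetGroupoid_hat M).isClopen (hS.isOpenBasis M.aut_mem) A)).trans ?_
    refine forall_congr' fun k => iff_congr Iff.rfl (and_congr_right fun _ => ?_)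
    exact Subtype.ext_iff.trans (Eq.congr_left (autEquiv_apply M.str _ _))
  constructor
  · rintro ⟨A, hA, hB⟩
    have h1 := σ.toCoset_counitIso hS hIso M A
    refine ⟨hA ▸ A.2, hB ▸ Subtype.property _, ?_⟩
    rw [← hA, elt_coe]
    refine (key A).1 ?_
    rw [← hB]
    exact h1
  · rintro ⟨ha, hb, h⟩
    rw [elt_of_mem ha] at h
    refine ⟨⟨t.1, ha⟩, rfl, ?_⟩
    exact congrArg Subtype.val (σ.toCoset_injective _
      ((σ.toCoset_counitIso hS hIso M ⟨t.1, ha⟩).trans ((key _).2 h).symm :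
        σ.toCoset _ _ = σ.toCoset _ ⟨t.2, hb⟩))

theorem isBorelEquivalence_functor : IsBorelEquivalence (σ.functor hS hIso) (autFunctor Gr S) where
  functor := σ.isBorelFunctor_functor hS hIso
  inverse := isBorelFunctor_autFunctor
  unit := ⟨σ.unit hS hIso, σ.measurable_unit hS hIso⟩
  counit := ⟨σ.counit hS hIso, σ.measurable_counit hS hIso⟩

end CosetSystem

end BorelDuality

/-! ### The duality theorem -/

theorem theorem4p3 (Gr : Set (ClosedSubgroup (Equiv.Perm ℕ))) (hBorel : MeasurableSet Gr)
    (hIso : BorelDuality.IsomorphismInvariant Gr)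
    (S : ∀ G : ClosedSubgroup (Equiv.Perm ℕ), Set (Subgroup G))
    (hS : BorelDuality.InvariantCountableBasis Gr S) :
    BorelDuality.IsBorelCategory (BorelDuality.GrCat Gr) ∧
    BorelDuality.IsBorelCategory (BorelDuality.MCat Gr S) ∧
    ∃ (W : BorelDuality.GrCat Gr ⥤ BorelDuality.MCat Gr S)
      (c : ∀ G : BorelDuality.GrCat Gr, (W.obj G).str.carrier → Set G.grp),
      BorelDuality.IsCosetFunctor W c ∧
      BorelDuality.IsBorelEquivalence W (BorelDuality.autFunctor Gr S) := by
  obtain ⟨σ⟩ := hS.nonempty_cosetSystem hBorel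
  exact ⟨BorelDuality.isBorelCategory_grCat hBorel, BorelDuality.isBorelCategory_mCat hBorel hS,
    σ.functor hS hIso, σ.toCoset, σ.isCosetFunctor_functor hS hIso,
    σ.isBorelEquivalence_functor hS hIso⟩
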